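/- Let $q\ge 1$, let $\Omega_q$ be the unit sphere of $\mathbb{R}^{q+1}$ with surface measure $\omega_q$, and let $(\mathbf X_i,Y_i)$, $i\ge 1$, be i.i.d. in $\Omega_q\times\mathbb{R}$ with $Y_i=m(\mathbf X_i)+\sigma(\mathbf X_i)\varepsilon_i$, where $\mathbf X_i$ has density $f$ with respect to $\omega_q$, $\sigma\ge 0$, $\mathbb{E}[\varepsilon_i\mid \mathbf X_i]=0$, $\mathbb{E}[\varepsilon_i^2\mid \mathbf X_i]=1$, and $\mathbb{E}[|\varepsilon_i|^3\mid \mathbf X_i]$, $\mathbb{E}[\varepsilon_i^4\mid \mathbf X_i]$ are bounded. Assume: (A1) the radial extensions $\mathbf y\mapsto m(\mathbf y/\|\mathbf y\|)$ and $\mathbf y\mapsto f(\mathbf y/\|\mathbf y\|)$ are of class $C^3$, respectively $C^2$, on $\mathbb{R}^{q+1}\setminus\{\mathbf 0\}$, and $f$ is bounded away from zero; (A2) $\sigma^2$ is uniformly continuous and bounded away from zero; (A3) $L:[0,\infty)\to[0,\infty)$ is continuous, bounded, not identically zero, and $L(r)\le Me^{-\alpha r}$ for all $r\ge 0$, with some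 $M,\alpha>0$; (A4) $h=h_n>0$, $h\to 0$ and $nh^q\to\infty$. Let $\omega_{q-1}=2\pi^{q/2}/\Gamma(q/2)$, $$\lambda_{h,q}(L)=\omega_{q-1}\int_0^{2h^{-2}}L(r)r^{\frac q2-1}(2-rh^2)^{\frac q2-1}\,dr,\qquad \lambda_q(L)=2^{\frac q2-1}\omega_{q-1}\int_0^\infty L(r)r^{\frac q2-1}\,dr,$$ and $L_h(\mathbf x,\mathbf y)=(\lambda_{h,q}(L)h^q)^{-1}L\big((1-\mathbf x^T\mathbf y)/h^2\big)$. For $\mathbf x\in\Omega_q$ let $\mathbf B_{\mathbf x}$ be a $(q+1)\times q$ matrix whose columns complete $\mathbf x$ to an orthonormal basis of $\mathbb{R}^{q+1}$. Let $\mathcal W_{\mathbf x}=\mathrm{diag}(L_h(\mathbf x,\mathbf X_1),\dots,L_h(\mathbf x,\mathbf X_n))$, let $\mathcal X_{\mathbf x,0}$ be the column of $n$ ones, and let $\mathcal X_{\mathbf x,1}$ be the $n\times(q+1)$ matrix with rows $(1,(\mathbf X_i-\mathbf x)^T\mathbf B_{\mathbf x})$. With $\mathbf Y=(Y_1,\dots,Y_n)^T$,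 the projected local estimator is $$\hat m_{h,p}(\mathbf x)=\mathbf e_1^T(\mathcal X_{\mathbf x,p}^T\mathcal W_{\mathbf x}\mathcal X_{\mathbf x,p})^{-1}\mathcal X_{\mathbf x,p}^T\mathcal W_{\mathbf x}\mathbf Y,\qquad p=0,1$$ (with the convention that it is $0$ when the matrix is singular). Put $$L_h^*(\mathbf x,\mathbf X_i)=\frac{1}{nh^q\lambda_q(L)f(\mathbf x)}L\Big(\frac{1-\mathbf x^T\mathbf X_i}{h^2}\Big),$$ the same for $p=0$ and $p=1$. Here "$R_n(\mathbf x)=o_{\mathbb P}(1)$ uniformly in $\mathbf x\in S$" means $\sup_{\mathbf x\in S}\mathbb P(|R_n(\mathbf x)|\ge\delta)\to 0$ for every $\delta>0$. Then, for $p=0$ and for $p=1$: 1. $\sup_{\mathbf x\in\Omega_q}\mathbb P\big(\mathcal X_{\mathbf x,p}^T\mathcal W_{\mathbf x}\mathcal X_{\mathbf x,p}\text{ is singular}\big)\to 0$. 2. There are random variables $r_{n,i}(\mathbf x)$ with $$\hat m_{h,p}(\mathbf x)=\sum_{i=1}^n L_h^*(\mathbf x,\mathbf X_i)\,Y_i\,\big(1+r_{n,i}(\mathbf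 x)\big)\ \text{ for all } n \text{ and } \mathbf x,\qquad \max_{1\le i\le n}|r_{n,i}(\mathbf x)|=o_{\mathbb P}(1)\ \text{ uniformly in }\mathbf x\in\Omega_q.$$ 3. Let $S\subseteq\Omega_q$ be arbitrary if $p=0$, and such that $\inf_{S}|m|>0$ if $p=1$. Then the factor can be taken common to all terms: there are random variables $R_n(\mathbf x)$ with $R_n(\mathbf x)=o_{\mathbb P}(1)$ uniformly in $\mathbf x\in S$ and $$\sup_{\mathbf x\in S}\mathbb P\Big(\hat m_{h,p}(\mathbf x)\ne\big(1+R_n(\mathbf x)\big)\sum_{i=1}^n L_h^*(\mathbf x,\mathbf X_i)Y_i\Big)\to 0 .$$ -/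

import Mathlib

open MeasureTheory ProbabilityTheory Filter Topology

noncomputable section

namespace DirReg

open scoped Matrix

/-- The ambient Euclidean space `ℝ^(q+1)`. -/
abbrev Amb (q : ℕ) : Type := EuclideanSpace ℝ (Fin (q + 1))

/-- The unit `q`-sphere in `ℝ^(q+1)`. -/
abbrev Sph (q : ℕ) : Type := Metric.sphere (0 : Amb q) 1

/-- The surface (Lebesgue) measure on the `q`-sphere. -/
def surfaceMeasure (q : ℕ) : Measure (Sph q) := (volume : Measure (Amb q)).toSphere

/-- The surface area `2 π^(q/2) / Γ(q/2)` of the `(q-1)`-sphere in `ℝ^q`, for `q ≥ 1`. -/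
def lowerArea (q : ℕ) : ℝ := 2 * Real.pi ^ ((q : ℝ) / 2) / Real.Gamma ((q : ℝ) / 2)

/-- `λ_{h,q}(L)`, with `h ^ q * λ_{h,q}(L)` the integral over the sphere of
`y ↦ L((1 - xᵀy) / h²)`. -/
def kernelMassAt (q : ℕ) (L : ℝ → ℝ) (h : ℝ) : ℝ :=
  lowerArea q *
    ∫ r in (0 : ℝ)..(2 / h ^ 2),
      L r * r ^ ((q : ℝ) / 2 - 1) * (2 - r * h ^ 2) ^ ((q : ℝ) / 2 - 1)

/-- `λ_q(L)`, the limit of `λ_{h,q}(L)` as `h → 0`. -/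
def kernelMass (q : ℕ) (L : ℝ → ℝ) : ℝ :=
  (2 : ℝ) ^ ((q : ℝ) / 2 - 1) * lowerArea q *
    ∫ r in Set.Ioi (0 : ℝ), L r * r ^ ((q : ℝ) / 2 - 1)

/-- The normalised directional kernel `L_h(x, y) = c_{h,q}(L) L((1 - xᵀy) / h²)`, where
`c_{h,q}(L)⁻¹ = λ_{h,q}(L) h^q`. -/
def dirKernel {q : ℕ} (L : ℝ → ℝ) (h : ℝ) (x y : Sph q) : ℝ :=
  (kernelMassAt q L h * h ^ q)⁻¹ * L ((1 - inner ℝ (x : Amb q) (y : Amb q)) / h ^ 2)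

/-- The equivalent kernel
`L*_h(x, y) = L((1 - xᵀy) / h²) / (n h^q λ_q(L) f(x))`. -/
def equivKernel {q : ℕ} (L : ℝ → ℝ) (f : Sph q → ℝ) (n : ℕ) (h : ℝ) (x y : Sph q) : ℝ :=
  1 / ((n : ℝ) * h ^ q * kernelMass q L * f x) *
    L ((1 - inner ℝ (x : Amb q) (y : Amb q)) / h ^ 2)

/-- `B` is a projection matrix at `x`: its `q` columns complete `x` to an orthonormal basis of
`ℝ^(q+1)` (`q + 1` orthonormal vectors automatically form a basis). -/
def IsProjectionMatrix {q : ℕ} (x : Sph q) (B : Matrix (Fin (q + 1)) (Fin q) ℝ) : Prop :=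
  Orthonormal ℝ
    (Fin.cons (x : Amb q) (fun j => WithLp.toLp 2 (fun k => B k j)) : Fin (q + 1) → Amb q)

section Estimator

variable {q n : ℕ}

/-- The design matrix of the local fit of degree `p`. There are `1 + p q` columns: a column of ones
and, for `p = 1`, the `q` columns whose `i`-th row is `(X_i - x)ᵀ B`. -/
def designMatrix (p : ℕ) (B : Matrix (Fin (q + 1)) (Fin q) ℝ) (x : Sph q) (X : Fin n → Sph q) :
    Matrix (Fin n) (Unit ⊕ (Fin p × Fin q)) ℝ :=
  Matrix.of fun i => Sum.elim (fun _ => 1)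
    (fun jk => (Bᵀ *ᵥ WithLp.ofLp ((X i : Amb q) - (x : Amb q))) jk.2)

/-- The weight matrix `diag(L_h(x, X_1), …, L_h(x, X_n))`. -/
def weightMatrix (L : ℝ → ℝ) (h : ℝ) (x : Sph q) (X : Fin n → Sph q) :
    Matrix (Fin n) (Fin n) ℝ :=
  Matrix.diagonal fun i => dirKernel L h x (X i)

/-- The matrix `𝒳ᵀ 𝒲 𝒳` of the weighted least squares problem. -/
def normalMatrix (p : ℕ) (L : ℝ → ℝ) (h : ℝ) (B : Matrix (Fin (q + 1)) (Fin q) ℝ) (x : Sph q)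
    (X : Fin n → Sph q) : Matrix (Unit ⊕ (Fin p × Fin q)) (Unit ⊕ (Fin p × Fin q)) ℝ :=
  (designMatrix p B x X)ᵀ * weightMatrix L h x X * designMatrix p B x X

/-- The weight `W_n^p(x, X_i) = e₁ᵀ (𝒳ᵀ 𝒲 𝒳)⁻¹ 𝒳ᵀ 𝒲 e_i`. -/
def localWeight (p : ℕ) (L : ℝ → ℝ) (h : ℝ) (B : Matrix (Fin (q + 1)) (Fin q) ℝ) (x : Sph q)
    (X : Fin n → Sph q) (i : Fin n) : ℝ :=
  ((normalMatrix p L h B x X)⁻¹ * (designMatrix p B x X)ᵀ * weightMatrix L h x X) (Sum.inl ()) i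

/-- The projected local estimator `e₁ᵀ (𝒳ᵀ 𝒲 𝒳)⁻¹ 𝒳ᵀ 𝒲 Y` at `x`. -/
def localEstimator (p : ℕ) (L : ℝ → ℝ) (h : ℝ) (B : Matrix (Fin (q + 1)) (Fin q) ℝ) (x : Sph q)
    (X : Fin n → Sph q) (Y : Fin n → ℝ) : ℝ :=
  (((normalMatrix p L h B x X)⁻¹ * (designMatrix p B x X)ᵀ * weightMatrix L h x X) *ᵥ Y)
    (Sum.inl ())

/-- The estimator is linear in the responses, with weights `localWeight`. -/
theorem localEstimator_eq_sum (p : ℕ) (L : ℝ → ℝ) (h : ℝ) (B : Matrix (Fin (q + 1)) (Fin q) ℝ)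
    (x : Sph q) (X : Fin n → Sph q) (Y : Fin n → ℝ) :
    localEstimator p L h B x X Y = ∑ i, localWeight p L h B x X i * Y i := rfl

end Estimator

/-- The radial extension `y ↦ g(y / ‖y‖)` of a function on the sphere to `ℝ^(q+1) \ {0}` (the value
at the origin is irrelevant). -/
def radialExt {q : ℕ} (g : Sph q → ℝ) (y : Amb q) : ℝ :=
  if hy : y = 0 then 0
  else g ⟨‖y‖⁻¹ • y, by
    rw [mem_sphere_zero_iff_norm, norm_smul, norm_inv, norm_norm,
      inv_mul_cancel₀ (norm_ne_zero_iff.mpr hy)]⟩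

/-- Regularity of the regression function `m` and of the design density `f`. -/
structure SmoothDesign {q : ℕ} (m f : Sph q → ℝ) : Prop where
  contDiff_m : ContDiffOn ℝ 3 (radialExt m) {0}ᶜ
  contDiff_f : ContDiffOn ℝ 2 (radialExt f) {0}ᶜ
  f_lower : ∃ c : ℝ, 0 < c ∧ ∀ x, c ≤ f x

/-- Regularity of the conditional standard deviation `σ`. -/
structure RegularNoise {q : ℕ} (σ : Sph q → ℝ) : Prop where
  nonneg : ∀ x, 0 ≤ σ x
  uniformContinuous_sq : UniformContinuous fun x => σ x ^ 2
  sq_lower : ∃ c : ℝ, 0 < c ∧ ∀ x, c ≤ σ x ^ 2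

/-- `L` (of which only the restriction to `[0, ∞)` matters) is a directional kernel: nonnegative,
not identically zero, continuous, bounded and with exponential decay. -/
structure IsDirectionalKernel (L : ℝ → ℝ) : Prop where
  continuousOn : ContinuousOn L (Set.Ici 0)
  nonneg : ∀ r, 0 ≤ r → 0 ≤ L r
  nontrivial : ∃ r, 0 ≤ r ∧ L r ≠ 0
  bounded : ∃ K : ℝ, ∀ r, 0 ≤ r → L r ≤ K
  decay : ∃ M α : ℝ, 0 < M ∧ 0 < α ∧ ∀ r, 0 ≤ r → L r ≤ M * Real.exp (-α * r)

/-- Conditions on the bandwidth sequence. -/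
structure IsBandwidth (q : ℕ) (h : ℕ → ℝ) : Prop where
  pos : ∀ n, 0 < h n
  tendsto_zero : Tendsto h atTop (𝓝 0)
  tendsto_mul : Tendsto (fun n : ℕ => (n : ℝ) * h n ^ q) atTop atTop

/-- The regression model `Y = m(X) + σ(X) ε`: `X` has density `f` with respect to the surface
measure, `E[ε | X] = 0`, `E[ε² | X] = 1`, and the third and fourth absolute conditional moments of
`ε` given `X` are bounded random variables. -/
structure RegressionModel {q : ℕ} {Ω : Type*} [MeasurableSpace Ω] (μ : Measure Ω)
    (m σ f : Sph q → ℝ) (X : Ω → Sph q) (Y ε : Ω → ℝ) : Prop where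
  measurable_X : Measurable X
  measurable_Y : Measurable Y
  measurable_noise : Measurable ε
  density : μ.map X = (surfaceMeasure q).withDensity fun x => ENNReal.ofReal (f x)
  model : ∀ᵐ ω ∂μ, Y ω = m (X ω) + σ (X ω) * ε ω
  memLp_noise : MemLp ε 4 μ
  condMean : μ[ε | MeasurableSpace.comap X inferInstance] =ᵐ[μ] fun _ => 0
  condSq : μ[fun ω => ε ω ^ 2 | MeasurableSpace.comap X inferInstance] =ᵐ[μ] fun _ => 1
  condThird : ∃ C : ℝ, ∀ᵐ ω ∂μ,
    (μ[fun ω => |ε ω| ^ 3 | MeasurableSpace.comap X inferInstance]) ω ≤ C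
  condFourth : ∃ C : ℝ, ∀ᵐ ω ∂μ,
    (μ[fun ω => ε ω ^ 4 | MeasurableSpace.comap X inferInstance]) ω ≤ C

/-- The events `A n x` have probability tending to zero, uniformly in `x ∈ S`. -/
def UniformlyNegligible {Ω ι : Type*} [MeasurableSpace Ω] (μ : Measure Ω) (S : Set ι)
    (A : ℕ → ι → Set Ω) : Prop :=
  Tendsto (fun n => ⨆ x ∈ S, μ (A n x)) atTop (𝓝 0)

/-- `R n x = o_P(1)` uniformly in `x ∈ S`. -/
def UniformOP {Ω ι : Type*} [MeasurableSpace Ω] (μ : Measure Ω) (S : Set ι)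
    (R : ℕ → ι → Ω → ℝ) : Prop :=
  ∀ δ : ℝ, 0 < δ → UniformlyNegligible μ S fun n x => {ω | δ ≤ |R n x ω|}

end DirReg

end

noncomputable section

namespace DirReg

open scoped Matrix ENNReal

/-! Let N be the normal matrix and T the vector of local moments of the responses, with slope
columns divided by h and everything normalised by n h^q. The factor λ_{h,q}(L) cancels, so the
estimator is the intercept entry of N⁻¹T (`localEstimator_eq`), while the sum with the equivalent
kernel is T₁ / (λ_q(L) f(x)). Let G be the Gram matrix of the regressors 1, u under the weight
L(‖u‖²/2) on ℝ^q. In probability, N tends to f(x) G and T to m(x) f(x) G e₁. Since G is invertible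
(`det_gram_ne_zero`) and G₁₁ = λ_q(L) (`kernelMoment_one`), both quantities tend to m(x).

Uniformity in x costs little because the supremum stands outside the probability. Chebyshev's
inequality with variance bounds free of x controls the fluctuations (`uniformOP_average`). The means
are integrals over the sphere which, in gnomonic coordinates rescaled by h, converge by dominated
convergence along every sequence of base points (`tendsto_localIntegral`); this amounts to uniform
convergence (`tendstoUniformly_of_seq`). The limits do not involve the frame and depend continuously
on x in a compact space, so the continuous mapping theorem is uniform as well
(`uniformOP_comp_localStat`), with no regularity of the frame in x.

A difference tending to zero does not control a ratio where m vanishes. For individual factors the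
difference is spread over the terms: r_i = t · sign(Y_i), where t is the difference divided by ∑
L*_h |Y_i|. That denominator stays away from zero in probability even where m = 0, since σ² is
bounded below and the conditional fourth moment of the noise is bounded
(`exists_localAverage_abs_lower`). For a common factor, p = 0 gives the ratio λ_q(L) f(x) / N₁₁
exactly, without the responses; for p = 1 the ratio tends to m(x)/m(x), which requires |m| bounded
below. -/

/-! ### Polar coordinates -/

/-- Polar coordinates for nonnegative integrands. -/
theorem lintegral_polar {q : ℕ} (F : Amb q → ℝ≥0∞) (hF : Measurable F) :
    ∫⁻ y, F y = ∫⁻ θ, ∫⁻ r in Set.Ioi (0 : ℝ), F (r • (θ : Amb q)) * ENNReal.ofReal (r ^ q)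
      ∂(volume : Measure ℝ) ∂(surfaceMeasure q) := by
  have hdim : Module.finrank ℝ (Amb q) - 1 = q := by simp
  have hmp := (volume : Measure (Amb q)).measurePreserving_homeomorphUnitSphereProd
  rw [hdim] at hmp
  have h1 : ∫⁻ y, F y = ∫⁻ y : ({0}ᶜ : Set (Amb q)), F y ∂(volume : Measure (Amb q)).comap (↑) := by
    rw [lintegral_subtype_comap (measurableSet_singleton _).compl, restrict_compl_singleton]
  have hcont : Measurable fun p : Sph q × Set.Ioi (0 : ℝ) => F ((p.2 : ℝ) • (p.1 : Amb q)) :=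
    hF.comp (by fun_prop)
  have h2 : ∫⁻ y : ({0}ᶜ : Set (Amb q)), F y ∂(volume : Measure (Amb q)).comap (↑) =
      ∫⁻ p, F ((p.2 : ℝ) • (p.1 : Amb q)) ∂((surfaceMeasure q).prod (Measure.volumeIoiPow q)) := by
    unfold surfaceMeasure
    rw [← hmp.lintegral_comp hcont]
    refine lintegral_congr fun y => ?_
    congr 1
    have hy : ‖(y : Amb q)‖ ≠ 0 := norm_ne_zero_iff.mpr y.2
    simp [smul_smul, hy]
  rw [h1, h2, lintegral_prod _ hcont.aemeasurable]
  refine lintegral_congr fun θ => ?_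
  have hm : Measurable fun r : ℝ => F (r • (θ : Amb q)) := hF.comp (by fun_prop)
  rw [Measure.volumeIoiPow, lintegral_withDensity_eq_lintegral_mul _ (by fun_prop)
    (show Measurable fun r : Set.Ioi (0 : ℝ) => F ((r : ℝ) • (θ : Amb q)) from
      hm.comp measurable_subtype_coe)]
  rw [← lintegral_subtype_comap measurableSet_Ioi]
  refine lintegral_congr fun r => ?_
  simp [mul_comm]

/-! ### Orthonormal frames at a point of the sphere -/

section Frame

variable {q : ℕ}

/-- The tangent vector at `x` with coordinates `v` in the frame given by the columns of `B`. -/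
def tangentVec (B : Matrix (Fin (q + 1)) (Fin q) ℝ) (v : EuclideanSpace ℝ (Fin q)) : Amb q :=
  ∑ j, v j • WithLp.toLp 2 (fun k => B k j)

/-- The coordinates of `y` along the columns of `B`. -/
def tangentCoord (B : Matrix (Fin (q + 1)) (Fin q) ℝ) (y : Amb q) : EuclideanSpace ℝ (Fin q) :=
  WithLp.toLp 2 (Bᵀ *ᵥ WithLp.ofLp y)

theorem continuous_tangentVec (B : Matrix (Fin (q + 1)) (Fin q) ℝ) :
    Continuous (tangentVec B) := by
  unfold tangentVec; fun_prop

theorem continuous_tangentCoord (B : Matrix (Fin (q + 1)) (Fin q) ℝ) :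
    Continuous (tangentCoord B) := by
  unfold tangentCoord
  refine (PiLp.continuous_toLp 2 _).comp ?_
  exact Continuous.matrix_mulVec continuous_const (PiLp.continuous_ofLp 2 _)

theorem tangentCoord_apply (B : Matrix (Fin (q + 1)) (Fin q) ℝ) (y : Amb q) (j : Fin q) :
    tangentCoord B y j = inner ℝ (WithLp.toLp 2 (fun k => B k j) : Amb q) y := by
  simp [tangentCoord, Matrix.mulVec, dotProduct, PiLp.inner_apply, mul_comm]

theorem tangentCoord_smul (B : Matrix (Fin (q + 1)) (Fin q) ℝ) (c : ℝ) (y : Amb q) :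
    tangentCoord B (c • y) = c • tangentCoord B y := by
  ext j; simp [tangentCoord_apply, inner_smul_right]

variable {x : Sph q} {B : Matrix (Fin (q + 1)) (Fin q) ℝ}

/-- The orthonormal basis consisting of `x` and the columns of `B`. -/
def IsProjectionMatrix.basis (hB : IsProjectionMatrix x B) :
    OrthonormalBasis (Fin (q + 1)) ℝ (Amb q) :=
  (basisOfOrthonormalOfCardEqFinrank hB (by simp)).toOrthonormalBasis
    ((congrArg (Orthonormal ℝ) (coe_basisOfOrthonormalOfCardEqFinrank hB (by simp))).mpr hB)

theorem IsProjectionMatrix.coe_basis (hB : IsProjectionMatrix x B) :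
    ⇑hB.basis = Fin.cons (x : Amb q) (fun j => WithLp.toLp 2 (fun k => B k j)) :=
  (Module.Basis.coe_toOrthonormalBasis _ _).trans
    (coe_basisOfOrthonormalOfCardEqFinrank hB (by simp))

theorem IsProjectionMatrix.basis_zero (hB : IsProjectionMatrix x B) :
    hB.basis 0 = (x : Amb q) := by
  rw [hB.coe_basis]; rfl

theorem IsProjectionMatrix.basis_succ (hB : IsProjectionMatrix x B) (j : Fin q) :
    hB.basis j.succ = WithLp.toLp 2 (fun k => B k j) := by
  rw [hB.coe_basis]; rfl

theorem IsProjectionMatrix.repr_symm (hB : IsProjectionMatrix x B) (s : ℝ)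
    (v : EuclideanSpace ℝ (Fin q)) :
    hB.basis.repr.symm (WithLp.toLp 2 (Fin.cons s (WithLp.ofLp v) : Fin (q + 1) → ℝ)) =
      s • (x : Amb q) + tangentVec B v := by
  rw [← OrthonormalBasis.sum_repr_symm]
  simp [Fin.sum_univ_succ, tangentVec, hB.basis_zero, hB.basis_succ]

theorem IsProjectionMatrix.norm_sq_add (hB : IsProjectionMatrix x B) (s : ℝ)
    (v : EuclideanSpace ℝ (Fin q)) :
    ‖s • (x : Amb q) + tangentVec B v‖ ^ 2 = s ^ 2 + ‖v‖ ^ 2 := by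
  rw [← hB.repr_symm, LinearIsometryEquiv.norm_map, EuclideanSpace.norm_sq_eq,
    EuclideanSpace.norm_sq_eq]
  simp [Fin.sum_univ_succ]

theorem IsProjectionMatrix.inner_add (hB : IsProjectionMatrix x B) (s : ℝ)
    (v : EuclideanSpace ℝ (Fin q)) :
    inner ℝ (x : Amb q) (s • (x : Amb q) + tangentVec B v) = s := by
  rw [← hB.repr_symm, ← hB.basis_zero, ← OrthonormalBasis.repr_apply_apply]
  simp

theorem IsProjectionMatrix.tangentCoord_add (hB : IsProjectionMatrix x B) (s : ℝ)
    (v : EuclideanSpace ℝ (Fin q)) :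
    tangentCoord B (s • (x : Amb q) + tangentVec B v) = v := by
  ext j
  rw [tangentCoord_apply, ← hB.repr_symm, ← hB.basis_succ, ← OrthonormalBasis.repr_apply_apply]
  simp

theorem IsProjectionMatrix.tangentCoord_self (hB : IsProjectionMatrix x B) :
    tangentCoord B (x : Amb q) = 0 := by
  have h := hB.tangentCoord_add 1 0
  simpa [tangentVec] using h

theorem IsProjectionMatrix.norm_tangentCoord_le (hB : IsProjectionMatrix x B) (y : Amb q) :
    ‖tangentCoord B y‖ ≤ ‖y‖ := by
  have h : ‖tangentCoord B y‖ ^ 2 ≤ ‖y‖ ^ 2 := by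
    rw [← hB.basis.repr.norm_map y, EuclideanSpace.norm_sq_eq, EuclideanSpace.norm_sq_eq,
      Fin.sum_univ_succ]
    simp only [tangentCoord_apply, OrthonormalBasis.repr_apply_apply, hB.basis_succ]
    nlinarith [sq_nonneg ‖inner ℝ (hB.basis 0) y‖]
  exact le_of_sq_le_sq h (norm_nonneg _)

/-- The frame is an orthonormal basis, so passing from coordinates to vectors is a linear isometry;
the remaining factors only regroup ℝ × ℝ^q as ℝ^(q+1). -/
theorem IsProjectionMatrix.measurePreserving (hB : IsProjectionMatrix x B) :
    MeasurePreserving (fun p : ℝ × EuclideanSpace ℝ (Fin q) =>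
      p.1 • (x : Amb q) + tangentVec B p.2) (volume.prod volume) volume := by
  have h1 : MeasurePreserving (Prod.map id (WithLp.ofLp : EuclideanSpace ℝ (Fin q) → _))
      (volume.prod volume) ((volume : Measure ℝ).prod volume) :=
    (MeasurePreserving.id _).prod (PiLp.volume_preserving_ofLp (Fin q))
  have h2 := (volume_preserving_piFinSuccAbove (fun _ : Fin (q + 1) => ℝ) 0).symm
  have h3 := PiLp.volume_preserving_toLp (Fin (q + 1))
  have h4 := hB.basis.repr.symm.measurePreserving
  have h := h4.comp (h3.comp (h2.comp h1))
  refine (congrArg (MeasurePreserving · (volume.prod volume) volume) ?_).mp h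
  funext p
  rw [← hB.repr_symm]
  refine congrArg hB.basis.repr.symm (congrArg (WithLp.toLp 2) (funext fun i => ?_))
  refine Fin.cases ?_ (fun j => ?_) i <;> simp [MeasurableEquiv.piFinSuccAbove]

end Frame

theorem setLIntegral_Ioo_rpow_nat (q : ℕ) {a : ℝ} (ha : 0 ≤ a) :
    ∫⁻ r in Set.Ioo 0 a, ENNReal.ofReal (r ^ q) = ENNReal.ofReal (a ^ (q + 1) / (q + 1)) := by
  rw [Measure.restrict_congr_set Ioo_ae_eq_Ioc,
    ← ofReal_integral_eq_lintegral_ofReal (intervalIntegral.intervalIntegrable_pow _).1,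
    ← intervalIntegral.integral_of_le ha]
  · simp
  · exact (ae_restrict_iff' measurableSet_Ioc).mpr (ae_of_all _ fun r hr => pow_nonneg hr.1.le _)

theorem lintegral_eq_rpow_mul_lintegral_comp_smul {q : ℕ} (G : EuclideanSpace ℝ (Fin q) → ℝ≥0∞)
    (hG : Measurable G) {s : ℝ} (hs : 0 < s) :
    ∫⁻ v, G v = ENNReal.ofReal (s ^ q) * ∫⁻ u, G (s • u) := by
  have h := Measure.map_addHaar_smul (volume : Measure (EuclideanSpace ℝ (Fin q))) hs.ne'
  have h2 : ∫⁻ u, G (s • u) = ∫⁻ v, G v ∂(Measure.map (s • ·) volume) := by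
    rw [lintegral_map hG (by fun_prop)]
  rw [h2, h, lintegral_smul_measure, smul_eq_mul, ← mul_assoc, ← ENNReal.ofReal_mul (by positivity)]
  simp [abs_of_pos hs, hs.ne']

/-! ### Gnomonic coordinates on a hemisphere -/

section Gnomonic

variable {q : ℕ}

/-- The projection of `y` to the unit sphere, with value `x` at the origin. -/
def normalize (x : Sph q) (y : Amb q) : Sph q :=
  ⟨if y = 0 then (x : Amb q) else ‖y‖⁻¹ • y, by
    split_ifs with h
    · exact x.2
    · rw [mem_sphere_zero_iff_norm, norm_smul, norm_inv, norm_norm,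
        inv_mul_cancel₀ (norm_ne_zero_iff.mpr h)]⟩

theorem coe_normalize (x : Sph q) {y : Amb q} (hy : y ≠ 0) :
    (normalize x y : Amb q) = ‖y‖⁻¹ • y := by
  simp [normalize, hy]

theorem measurable_normalize (x : Sph q) : Measurable (normalize x) := by
  refine Measurable.subtype_mk ?_
  exact Measurable.ite (measurableSet_singleton _) measurable_const (by fun_prop)

theorem normalize_smul (x : Sph q) {s : ℝ} (hs : 0 < s) {y : Amb q} (hy : y ≠ 0) :
    normalize x (s • y) = normalize x y := by
  refine Subtype.ext ?_
  rw [coe_normalize x hy, coe_normalize x (smul_ne_zero hs.ne' hy), norm_smul, smul_smul]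
  congr 1
  rw [Real.norm_of_nonneg hs.le]
  field_simp

theorem normalize_coe (x θ : Sph q) : normalize x (θ : Amb q) = θ := by
  refine Subtype.ext ?_
  have h : (θ : Amb q) ≠ 0 := ne_zero_of_mem_unit_sphere θ
  rw [coe_normalize x h]; simp

variable {x : Sph q} {B : Matrix (Fin (q + 1)) (Fin q) ℝ}

/-- The inverse of the central projection of an open hemisphere to its tangent space. -/
def gnomonic (x : Sph q) (B : Matrix (Fin (q + 1)) (Fin q) ℝ) (v : EuclideanSpace ℝ (Fin q)) :
    Sph q :=
  normalize x ((1 : ℝ) • (x : Amb q) + tangentVec B v)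

theorem measurable_gnomonic (x : Sph q) (B : Matrix (Fin (q + 1)) (Fin q) ℝ) :
    Measurable (gnomonic x B) := by
  refine (measurable_normalize x).comp ?_
  have := (continuous_tangentVec B).measurable
  fun_prop

theorem IsProjectionMatrix.norm_add (hB : IsProjectionMatrix x B) (s : ℝ)
    (v : EuclideanSpace ℝ (Fin q)) :
    ‖s • (x : Amb q) + tangentVec B v‖ = √(s ^ 2 + ‖v‖ ^ 2) := by
  rw [← hB.norm_sq_add, Real.sqrt_sq (norm_nonneg _)]

theorem IsProjectionMatrix.add_ne_zero (hB : IsProjectionMatrix x B) {s : ℝ} (hs : s ≠ 0)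
    (v : EuclideanSpace ℝ (Fin q)) :
    s • (x : Amb q) + tangentVec B v ≠ 0 := by
  rw [← norm_ne_zero_iff, hB.norm_add]
  positivity

theorem IsProjectionMatrix.coe_gnomonic (hB : IsProjectionMatrix x B)
    (v : EuclideanSpace ℝ (Fin q)) :
    (gnomonic x B v : Amb q) = (√(1 + ‖v‖ ^ 2))⁻¹ • ((1 : ℝ) • (x : Amb q) + tangentVec B v) := by
  rw [gnomonic, coe_normalize x (hB.add_ne_zero one_ne_zero v), hB.norm_add, one_pow]

theorem IsProjectionMatrix.inner_gnomonic (hB : IsProjectionMatrix x B)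
    (v : EuclideanSpace ℝ (Fin q)) :
    inner ℝ (x : Amb q) (gnomonic x B v : Amb q) = (√(1 + ‖v‖ ^ 2))⁻¹ := by
  rw [hB.coe_gnomonic, inner_smul_right, hB.inner_add, mul_one]

theorem IsProjectionMatrix.tangentCoord_gnomonic (hB : IsProjectionMatrix x B)
    (v : EuclideanSpace ℝ (Fin q)) :
    tangentCoord B (gnomonic x B v : Amb q) = (√(1 + ‖v‖ ^ 2))⁻¹ • v := by
  rw [hB.coe_gnomonic, tangentCoord_smul, hB.tangentCoord_add]

theorem tangentVec_smul (B : Matrix (Fin (q + 1)) (Fin q) ℝ) (s : ℝ)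
    (v : EuclideanSpace ℝ (Fin q)) : tangentVec B (s • v) = s • tangentVec B v := by
  simp [tangentVec, Finset.smul_sum, smul_smul]

/-- The integral of a homogeneous function over a slab in two ways: in polar coordinates, and in
the coordinates along `x` and along the tangent space. -/
theorem IsProjectionMatrix.lintegral_hemisphere (hB : IsProjectionMatrix x B) (F : Sph q → ℝ≥0∞)
    (hF : Measurable F) :
    ∫⁻ θ in {θ : Sph q | 0 < inner ℝ (x : Amb q) (θ : Amb q)}, F θ ∂(surfaceMeasure q) =
      ∫⁻ v, F (gnomonic x B v) * ENNReal.ofReal ((√(1 + ‖v‖ ^ 2))⁻¹ ^ (q + 1)) := by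
  -- The weight a^(q+1), with a = xᵀθ, cancels the radial integral of r^q over 0 < r < 1/a, which is
  -- a^(-(q+1))/(q+1). In gnomonic coordinates a = (1 + ‖v‖²)^(-1/2), so the same weight becomes the
  -- Jacobian.
  set H : Sph q → ℝ≥0∞ := fun θ =>
    F θ * ENNReal.ofReal ((inner ℝ (x : Amb q) (θ : Amb q)) ^ (q + 1)) with hH
  have hHm : Measurable H := hF.mul (by fun_prop)
  set c : ℝ≥0∞ := ENNReal.ofReal (1 / ((q : ℝ) + 1)) with hc
  have hc0 : c ≠ 0 := by rw [hc]; simp; positivity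
  have hcT : c ≠ ⊤ := ENNReal.ofReal_ne_top
  -- A function homogeneous of degree zero, cut off to the slab 0 < xᵀy < 1.
  set K : Amb q → ℝ≥0∞ := fun y =>
    (Set.Ioo (0 : ℝ) 1).indicator 1 (inner ℝ (x : Amb q) y) * H (normalize x y) with hK
  have hind : Measurable ((Set.Ioo (0 : ℝ) 1).indicator (1 : ℝ → ℝ≥0∞)) :=
    measurable_one.indicator measurableSet_Ioo
  have hKm : Measurable K :=
    (hind.comp (by fun_prop)).mul (hHm.comp (measurable_normalize x))
  have hpolar : ∫⁻ y, K y =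
      (∫⁻ θ in {θ : Sph q | 0 < inner ℝ (x : Amb q) (θ : Amb q)}, F θ ∂(surfaceMeasure q)) * c := by
    rw [lintegral_polar K hKm, ← lintegral_mul_const _ hF,
      ← lintegral_indicator (measurableSet_lt measurable_const (by fun_prop))]
    refine lintegral_congr fun θ => ?_
    set a : ℝ := inner ℝ (x : Amb q) (θ : Amb q) with ha
    have hr : ∀ r ∈ Set.Ioi (0 : ℝ), K (r • (θ : Amb q)) * ENNReal.ofReal (r ^ q) =
        H θ * ((Set.Ioo (0 : ℝ) 1).indicator 1 (r * a) * ENNReal.ofReal (r ^ q)) := by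
      intro r hr
      rw [hK]
      simp only [normalize_smul x hr (ne_zero_of_mem_unit_sphere θ), normalize_coe,
        inner_smul_right, ← ha]
      ring
    have hmr : Measurable fun r : ℝ =>
        (Set.Ioo (0 : ℝ) 1).indicator (1 : ℝ → ℝ≥0∞) (r * a) * ENNReal.ofReal (r ^ q) :=
      (hind.comp (by fun_prop : Measurable fun r : ℝ => r * a)).mul (by fun_prop)
    rw [setLIntegral_congr_fun measurableSet_Ioi hr, lintegral_const_mul _ hmr]
    by_cases hapos : 0 < a
    · rw [Set.indicator_of_mem (by exact hapos)]
      have hset : ∀ r ∈ Set.Ioi (0 : ℝ),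
          (Set.Ioo (0 : ℝ) 1).indicator 1 (r * a) * ENNReal.ofReal (r ^ q) =
          (Set.Iio a⁻¹).indicator (fun r => ENNReal.ofReal (r ^ q)) r := by
        intro r hr
        have hr' : 0 < r := hr
        by_cases hra : r < a⁻¹
        · rw [Set.indicator_of_mem (show r ∈ Set.Iio a⁻¹ from hra), Set.indicator_of_mem]
          · simp
          · exact ⟨by positivity, by rwa [← lt_div_iff₀ hapos, one_div]⟩
        · rw [Set.indicator_of_notMem (show r ∉ Set.Iio a⁻¹ from hra), Set.indicator_of_notMem]
          · simp
          · intro h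
            exact hra (by rw [← one_div, lt_div_iff₀ hapos]; exact h.2)
      rw [setLIntegral_congr_fun measurableSet_Ioi hset, lintegral_indicator measurableSet_Iio,
        Measure.restrict_restrict measurableSet_Iio, Set.inter_comm, Set.Ioi_inter_Iio,
        setLIntegral_Ioo_rpow_nat q (by positivity), hH]
      simp only [← ha, mul_assoc]
      rw [← ENNReal.ofReal_mul (by positivity), hc]
      congr 2
      field_simp
      rw [← mul_pow, mul_one_div_cancel hapos.ne', one_pow]
    · rw [Set.indicator_of_notMem (by exact hapos)]
      have hset : ∀ r ∈ Set.Ioi (0 : ℝ),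
          (Set.Ioo (0 : ℝ) 1).indicator 1 (r * a) * ENNReal.ofReal (r ^ q) = 0 := by
        intro r hr
        have hr' : 0 < r := hr
        rw [Set.indicator_of_notMem, zero_mul]
        intro h
        have := h.1
        exact hapos ((pos_iff_pos_of_mul_pos this).mp hr')
      rw [setLIntegral_congr_fun measurableSet_Ioi hset]
      simp
  have hcart : ∫⁻ y, K y =
      (∫⁻ v, F (gnomonic x B v) * ENNReal.ofReal ((√(1 + ‖v‖ ^ 2))⁻¹ ^ (q + 1))) * c := by
    have hm : Measurable fun p : ℝ × EuclideanSpace ℝ (Fin q) =>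
        K (p.1 • (x : Amb q) + tangentVec B p.2) := by
      refine hKm.comp ?_
      have := (continuous_tangentVec B).measurable
      fun_prop
    rw [← hB.measurePreserving.lintegral_comp hKm, lintegral_prod _ hm.aemeasurable]
    -- By homogeneity, v = s u carries the slice at height s to the slice at height 1, with Jacobian
    -- s^q; integrating s^q over (0, 1) gives the same constant 1/(q+1) as in polar coordinates.
    have hs : ∀ s : ℝ, ∫⁻ v, K (s • (x : Amb q) + tangentVec B v) =
        (Set.Ioo (0 : ℝ) 1).indicator (fun s => ENNReal.ofReal (s ^ q)) s *
          ∫⁻ u, H (gnomonic x B u) := by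
      intro s
      by_cases hs : s ∈ Set.Ioo (0 : ℝ) 1
      · have hms : Measurable fun v => K (s • (x : Amb q) + tangentVec B v) :=
          Measurable.comp (g := K) hKm
            ((continuous_tangentVec B).const_add (s • (x : Amb q))).measurable
        rw [Set.indicator_of_mem hs, lintegral_eq_rpow_mul_lintegral_comp_smul _ hms hs.1]
        refine congrArg _ (lintegral_congr fun u => ?_)
        have hne : (x : Amb q) + tangentVec B u ≠ 0 := by
          simpa using hB.add_ne_zero one_ne_zero u
        have h1 : normalize x (s • (x : Amb q) + tangentVec B (s • u)) = gnomonic x B u := by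
          rw [tangentVec_smul, ← smul_add, normalize_smul x hs.1 hne, gnomonic, one_smul]
        simp only [hK, hB.inner_add, h1]
        rw [Set.indicator_of_mem hs, Pi.one_apply, one_mul]
      · rw [Set.indicator_of_notMem hs, zero_mul]
        simp only [hK, hB.inner_add, Set.indicator_of_notMem hs, zero_mul, lintegral_zero]
    simp_rw [hs]
    rw [lintegral_mul_const _ (by
      exact Measurable.indicator (by fun_prop) measurableSet_Ioo),
      lintegral_indicator measurableSet_Ioo, setLIntegral_Ioo_rpow_nat q zero_le_one, one_pow,
      mul_comm]
    simp only [hH, hB.inner_gnomonic]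
    rfl
  rw [hpolar] at hcart
  exact (ENNReal.mul_left_inj hc0 hcT).mp hcart

/-- The surface measure on a hemisphere in gnomonic coordinates. -/
theorem IsProjectionMatrix.restrict_hemisphere (hB : IsProjectionMatrix x B) :
    (surfaceMeasure q).restrict {θ : Sph q | 0 < inner ℝ (x : Amb q) (θ : Amb q)} =
      ((volume : Measure (EuclideanSpace ℝ (Fin q))).withDensity
        fun v => ENNReal.ofReal ((√(1 + ‖v‖ ^ 2))⁻¹ ^ (q + 1))).map (gnomonic x B) := by
  refine Measure.ext_of_lintegral _ fun F hF => ?_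
  rw [hB.lintegral_hemisphere F hF, lintegral_map hF (measurable_gnomonic x B),
    lintegral_withDensity_eq_lintegral_mul _ (by fun_prop)
      (show Measurable fun v => F (gnomonic x B v) from hF.comp (measurable_gnomonic x B))]
  exact lintegral_congr fun v => mul_comm _ _

theorem IsProjectionMatrix.integral_hemisphere (hB : IsProjectionMatrix x B) (F : Sph q → ℝ)
    (hF : Measurable F) :
    ∫ θ in {θ : Sph q | 0 < inner ℝ (x : Amb q) (θ : Amb q)}, F θ ∂(surfaceMeasure q) =
      ∫ v, (√(1 + ‖v‖ ^ 2))⁻¹ ^ (q + 1) * F (gnomonic x B v) := by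
  rw [hB.restrict_hemisphere, integral_map (measurable_gnomonic x B).aemeasurable
    hF.aestronglyMeasurable, integral_withDensity_eq_integral_toReal_smul (by fun_prop)
      (ae_of_all _ fun _ => ENNReal.ofReal_lt_top)]
  refine integral_congr_ae (ae_of_all _ fun v => ?_)
  simp only [smul_eq_mul]
  rw [ENNReal.toReal_ofReal (by positivity)]

end Gnomonic

/-! ### Growth conditions and Gaussian bounds -/

/-- Continuous functions growing more slowly than every Gaussian `exp (β ‖u‖ ^ 2)`. -/
structure ModerateGrowth {q : ℕ} (ψ : EuclideanSpace ℝ (Fin q) → ℝ) : Prop where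
  continuous : Continuous ψ
  bound : ∀ β : ℝ, 0 < β → ∃ C : ℝ, 0 ≤ C ∧ ∀ u, |ψ u| ≤ C * Real.exp (β * ‖u‖ ^ 2)

theorem ModerateGrowth.mul {q : ℕ} {ψ φ : EuclideanSpace ℝ (Fin q) → ℝ} (hψ : ModerateGrowth ψ)
    (hφ : ModerateGrowth φ) : ModerateGrowth fun u => ψ u * φ u where
  continuous := hψ.continuous.mul hφ.continuous
  bound β hβ := by
    obtain ⟨C, hC, h1⟩ := hψ.bound (β / 2) (by positivity)
    obtain ⟨D, hD, h2⟩ := hφ.bound (β / 2) (by positivity)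
    refine ⟨C * D, by positivity, fun u => ?_⟩
    rw [abs_mul]
    calc |ψ u| * |φ u| ≤ (C * Real.exp (β / 2 * ‖u‖ ^ 2)) * (D * Real.exp (β / 2 * ‖u‖ ^ 2)) :=
          mul_le_mul (h1 u) (h2 u) (abs_nonneg _) (by positivity)
      _ = C * D * (Real.exp (β / 2 * ‖u‖ ^ 2) * Real.exp (β / 2 * ‖u‖ ^ 2)) := by ring
      _ = _ := by rw [← Real.exp_add]; ring_nf

theorem ModerateGrowth.const {q : ℕ} (c : ℝ) :
    ModerateGrowth fun _ : EuclideanSpace ℝ (Fin q) => c where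
  continuous := continuous_const
  bound β hβ := ⟨|c|, abs_nonneg _, fun u =>
    le_mul_of_one_le_right (abs_nonneg _) (Real.one_le_exp (by positivity))⟩

theorem ModerateGrowth.coord {q : ℕ} (j : Fin q) :
    ModerateGrowth fun u : EuclideanSpace ℝ (Fin q) => u j where
  continuous := by fun_prop
  bound β hβ := by
    refine ⟨1 + 1 / β, by positivity, fun u => ?_⟩
    have h1 : |u j| ≤ ‖u‖ := by simpa using PiLp.norm_apply_le u j
    have h2 : ‖u‖ ≤ 1 + ‖u‖ ^ 2 := by nlinarith [sq_nonneg (‖u‖ - 1), norm_nonneg u]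
    have h3 := Real.add_one_le_exp (β * ‖u‖ ^ 2)
    have h4 : 1 + ‖u‖ ^ 2 ≤ (1 + 1 / β) * (β * ‖u‖ ^ 2 + 1) := by
      have : (1 + 1 / β) * (β * ‖u‖ ^ 2 + 1) = 1 + ‖u‖ ^ 2 + β * ‖u‖ ^ 2 + 1 / β := by
        field_simp; ring
      rw [this]
      have : 0 ≤ β * ‖u‖ ^ 2 + 1 / β := by positivity
      linarith
    exact h1.trans (h2.trans (h4.trans (mul_le_mul_of_nonneg_left h3 (by positivity))))

theorem integrable_exp_neg_mul_norm_sq (q : ℕ) {b : ℝ} (hb : 0 < b) :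
    Integrable fun u : EuclideanSpace ℝ (Fin q) => Real.exp (-b * ‖u‖ ^ 2) := by
  have h := (GaussianFourier.integrable_cexp_neg_mul_sq_norm_add_of_euclideanSpace
    (ι := Fin q) (b := (b : ℂ)) (by simpa using hb) 0 0).norm
  refine h.congr (ae_of_all _ fun u => ?_)
  simp only [Complex.norm_exp]
  congr 1
  norm_cast
  simp

/-- With k = 1/h, eventually k ≥ 1 and hence k ≤ k², so the expression is dominated by k^q e^(-ak).
-/
theorem tendsto_exp_neg_div_sq_div_pow (q : ℕ) {a : ℝ} (ha : 0 < a) {h : ℕ → ℝ}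
    (hpos : ∀ n, 0 < h n) (h0 : Tendsto h atTop (𝓝 0)) :
    Tendsto (fun n => (h n ^ q)⁻¹ * Real.exp (-a / h n ^ 2)) atTop (𝓝 0) := by
  have hk : Tendsto (fun n => (h n)⁻¹) atTop atTop :=
    Tendsto.inv_tendsto_nhdsGT_zero (tendsto_nhdsWithin_iff.mpr ⟨h0, Eventually.of_forall hpos⟩)
  have h1 := (tendsto_rpow_mul_exp_neg_mul_atTop_nhds_zero (q : ℝ) a ha).comp hk
  refine squeeze_zero' (Eventually.of_forall fun n => ?_) ?_ h1
  · have := hpos n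
    positivity
  · filter_upwards [hk.eventually_ge_atTop 1] with n hn
    have hp := hpos n
    simp only [Function.comp_apply, Real.rpow_natCast, inv_pow]
    refine mul_le_mul_of_nonneg_left (Real.exp_le_exp.mpr ?_) (by positivity)
    have : (h n)⁻¹ ≤ (h n)⁻¹ ^ 2 := by nlinarith
    rw [neg_div, neg_mul, neg_le_neg_iff, div_eq_mul_inv, ← inv_pow]
    exact mul_le_mul_of_nonneg_left this ha.le

/-! ### Local integrals: the parts far from and near the base point -/

section Kernel

variable {q : ℕ} {L : ℝ → ℝ}

theorem one_sub_inner_nonneg (x y : Sph q) :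
    0 ≤ 1 - inner ℝ (x : Amb q) (y : Amb q) := by
  have := real_inner_le_norm (x : Amb q) (y : Amb q)
  rw [norm_eq_of_mem_sphere, norm_eq_of_mem_sphere] at this
  linarith

theorem IsDirectionalKernel.continuous_comp (hL : IsDirectionalKernel L) {α : Type*}
    [TopologicalSpace α] {g : α → ℝ} (hg : Continuous g) (h0 : ∀ a, 0 ≤ g a) :
    Continuous fun a => L (g a) :=
  hL.continuousOn.comp_continuous hg h0

theorem IsDirectionalKernel.continuous_sphere (hL : IsDirectionalKernel L) (h : ℝ) (x : Sph q) :
    Continuous fun y : Sph q => L ((1 - inner ℝ (x : Amb q) (y : Amb q)) / h ^ 2) :=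
  hL.continuous_comp (by fun_prop) fun y => div_nonneg (one_sub_inner_nonneg x y) (sq_nonneg h)

/-- Second moments of local averages are local integrals for L², so the concentration results for L
must apply to its square. -/
theorem IsDirectionalKernel.sq (hL : IsDirectionalKernel L) :
    IsDirectionalKernel fun r => L r ^ 2 where
  continuousOn := hL.continuousOn.pow 2
  nonneg r _ := sq_nonneg _
  nontrivial := by
    obtain ⟨r, hr, h⟩ := hL.nontrivial
    exact ⟨r, hr, pow_ne_zero 2 h⟩
  bounded := by
    obtain ⟨K, hK⟩ := hL.bounded
    exact ⟨K ^ 2, fun r hr => pow_le_pow_left₀ (hL.nonneg r hr) (hK r hr) 2⟩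
  decay := by
    obtain ⟨M, α, hM, hα, h⟩ := hL.decay
    refine ⟨M ^ 2, 2 * α, by positivity, by positivity, fun r hr => ?_⟩
    refine (pow_le_pow_left₀ (hL.nonneg r hr) (h r hr) 2).trans (le_of_eq ?_)
    rw [mul_pow, ← Real.exp_nat_mul]
    congr 2
    push_cast
    ring

/-- The integral of `L ((1 - xᵀy) / h²) ψ(Bᵀ y / h) G(y)` over the sphere. -/
def localIntegral (L : ℝ → ℝ) (ψ : EuclideanSpace ℝ (Fin q) → ℝ) (G : Sph q → ℝ) (h : ℝ)
    (x : Sph q) (B : Matrix (Fin (q + 1)) (Fin q) ℝ) : ℝ :=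
  ∫ y : Sph q, L ((1 - inner ℝ (x : Amb q) (y : Amb q)) / h ^ 2) *
    ψ (h⁻¹ • tangentCoord B (y : Amb q)) * G y ∂(surfaceMeasure q)

/-- The limit of the normalised local integrals with `G = 1`. -/
def kernelMoment (L : ℝ → ℝ) (ψ : EuclideanSpace ℝ (Fin q) → ℝ) : ℝ :=
  ∫ u : EuclideanSpace ℝ (Fin q), L (‖u‖ ^ 2 / 2) * ψ u

theorem continuous_localIntegrand (hL : IsDirectionalKernel L)
    {ψ : EuclideanSpace ℝ (Fin q) → ℝ} (hψ : Continuous ψ) (h : ℝ) (x : Sph q)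
    (B : Matrix (Fin (q + 1)) (Fin q) ℝ) :
    Continuous fun y : Sph q => L ((1 - inner ℝ (x : Amb q) (y : Amb q)) / h ^ 2) *
      ψ (h⁻¹ • tangentCoord B (y : Amb q)) := by
  have h1 : Continuous fun y : Sph q => tangentCoord B (y : Amb q) :=
    (continuous_tangentCoord B).comp continuous_subtype_val
  have h2 : Continuous fun y : Sph q => h⁻¹ • tangentCoord B (y : Amb q) := h1.const_smul h⁻¹
  exact (hL.continuous_sphere h x).mul (hψ.comp h2)

/-- With s = √(1 + h²t), the identity s² - 1 = h²t removes the division by h². In the coordinates v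
= h u this is the argument of L with t = ‖u‖², and it makes the limit t/2 visible. -/
theorem one_sub_inv_sqrt_div {h t : ℝ} (hh : 0 < h) (ht : 0 ≤ t) :
    (1 - (√(1 + h ^ 2 * t))⁻¹) / h ^ 2 = t / (√(1 + h ^ 2 * t) * (1 + √(1 + h ^ 2 * t))) := by
  have hs : √(1 + h ^ 2 * t) ^ 2 = 1 + h ^ 2 * t := Real.sq_sqrt (by positivity)
  have hs0 : 0 < √(1 + h ^ 2 * t) := Real.sqrt_pos.mpr (by positivity)
  generalize √(1 + h ^ 2 * t) = s at *
  field_simp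
  linear_combination hs

theorem dist_gnomonic_sq {x : Sph q} {B : Matrix (Fin (q + 1)) (Fin q) ℝ}
    (hB : IsProjectionMatrix x B) (v : EuclideanSpace ℝ (Fin q)) :
    dist (gnomonic x B v) x ^ 2 = 2 - 2 * (√(1 + ‖v‖ ^ 2))⁻¹ := by
  rw [Subtype.dist_eq, dist_eq_norm, @norm_sub_sq_real, norm_eq_of_mem_sphere,
    norm_eq_of_mem_sphere, real_inner_comm, hB.inner_gnomonic]
  ring

theorem exists_abs_le_of_continuous {G : Sph q → ℝ} (hG : Continuous G) :
    ∃ C : ℝ, 0 ≤ C ∧ ∀ y, |G y| ≤ C := by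
  obtain ⟨C, hC⟩ := isCompact_univ.exists_bound_of_continuousOn hG.continuousOn
  exact ⟨max C 0, le_max_right _ _, fun y => (hC y trivial).trans (le_max_left _ _)⟩

/-- The part of a local integral that lies away from `x` is negligible. -/
theorem tendsto_localIntegral_far (hL : IsDirectionalKernel L)
    {ψ : EuclideanSpace ℝ (Fin q) → ℝ} (hψ : ModerateGrowth ψ) {G : Sph q → ℝ} (hG : Continuous G)
    {h : ℕ → ℝ} (hpos : ∀ n, 0 < h n) (h0 : Tendsto h atTop (𝓝 0)) (x : ℕ → Sph q)
    (B : ℕ → Matrix (Fin (q + 1)) (Fin q) ℝ) (hB : ∀ n, IsProjectionMatrix (x n) (B n)) :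
    Tendsto (fun n => (h n ^ q)⁻¹ *
      ∫ y in {y : Sph q | 1 / 2 < inner ℝ (x n : Amb q) (y : Amb q)}ᶜ,
        L ((1 - inner ℝ (x n : Amb q) (y : Amb q)) / h n ^ 2) *
          ψ ((h n)⁻¹ • tangentCoord (B n) (y : Amb q)) * G y ∂(surfaceMeasure q)) atTop (𝓝 0) := by
  obtain ⟨M, α, hM, hα, hdec⟩ := hL.decay
  -- Where xᵀy ≤ 1/2 the argument of L is at least 1/(2h²), so L contributes the exponent -α/(2h²).
  -- Since ‖Bᵀy‖ ≤ 1, growth rate α/4 costs at most α/(4h²), which leaves -α/(4h²).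
  obtain ⟨C, hC, hψC⟩ := hψ.bound (α / 4) (by positivity)
  obtain ⟨D, hD, hGD⟩ := exists_abs_le_of_continuous hG
  have hlim := (tendsto_exp_neg_div_sq_div_pow q (a := α / 4) (by positivity) hpos h0).mul_const
    (M * C * D * (surfaceMeasure q).real Set.univ)
  rw [zero_mul] at hlim
  refine squeeze_zero_norm (fun n => ?_) hlim
  have hn := hpos n
  have hfin : IsFiniteMeasure (surfaceMeasure q) := by unfold surfaceMeasure; infer_instance
  have hbound : ∀ y ∈ {y : Sph q | 1 / 2 < inner ℝ (x n : Amb q) (y : Amb q)}ᶜ,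
      ‖L ((1 - inner ℝ (x n : Amb q) (y : Amb q)) / h n ^ 2) *
          ψ ((h n)⁻¹ • tangentCoord (B n) (y : Amb q)) * G y‖ ≤
        M * C * D * Real.exp (-(α / 4) / h n ^ 2) := by
    intro y hy
    have hy' : inner ℝ (x n : Amb q) (y : Amb q) ≤ 1 / 2 := not_lt.mp hy
    have hr0 : 0 ≤ (1 - inner ℝ (x n : Amb q) (y : Amb q)) / h n ^ 2 :=
      div_nonneg (one_sub_inner_nonneg _ _) (sq_nonneg _)
    have hr : 1 / 2 / h n ^ 2 ≤ (1 - inner ℝ (x n : Amb q) (y : Amb q)) / h n ^ 2 := by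
      gcongr; linarith
    have h1 : |L ((1 - inner ℝ (x n : Amb q) (y : Amb q)) / h n ^ 2)| ≤
        M * Real.exp (-α * (1 / 2 / h n ^ 2)) := by
      rw [abs_of_nonneg (hL.nonneg _ hr0)]
      refine (hdec _ hr0).trans ?_
      refine mul_le_mul_of_nonneg_left (Real.exp_le_exp.mpr ?_) hM.le
      nlinarith
    have h2 : |ψ ((h n)⁻¹ • tangentCoord (B n) (y : Amb q))| ≤
        C * Real.exp (α / 4 * (1 / h n ^ 2)) := by
      refine (hψC _).trans (mul_le_mul_of_nonneg_left (Real.exp_le_exp.mpr ?_) hC)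
      refine mul_le_mul_of_nonneg_left ?_ (by positivity)
      have h3 := (hB n).norm_tangentCoord_le (y : Amb q)
      rw [norm_eq_of_mem_sphere] at h3
      rw [norm_smul, norm_inv, Real.norm_of_nonneg hn.le, mul_pow, inv_pow, one_div]
      exact mul_le_of_le_one_right (by positivity) (pow_le_one₀ (norm_nonneg _) h3)
    rw [Real.norm_eq_abs, abs_mul, abs_mul]
    calc _ ≤ (M * Real.exp (-α * (1 / 2 / h n ^ 2))) * (C * Real.exp (α / 4 * (1 / h n ^ 2))) * D := by
          gcongr
          exact hGD y
      _ = M * C * D * (Real.exp (-α * (1 / 2 / h n ^ 2)) * Real.exp (α / 4 * (1 / h n ^ 2))) := by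
          ring
      _ = _ := by rw [← Real.exp_add]; ring_nf
  have h5 := norm_setIntegral_le_of_norm_le_const
    (measure_lt_top (surfaceMeasure q) _) hbound
  rw [norm_mul, norm_inv, Real.norm_of_nonneg (by positivity : 0 ≤ h n ^ q)]
  calc _ ≤ (h n ^ q)⁻¹ * (M * C * D * Real.exp (-(α / 4) / h n ^ 2) *
        (surfaceMeasure q).real Set.univ) := by
        gcongr
        refine h5.trans ?_
        exact mul_le_mul_of_nonneg_left (measureReal_mono (Set.subset_univ _)) (by positivity)
    _ = _ := by ring

/-- The part of a local integral near `x` in rescaled gnomonic coordinates. -/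
theorem localIntegral_near_eq (hL : IsDirectionalKernel L)
    {ψ : EuclideanSpace ℝ (Fin q) → ℝ} (hψ : Continuous ψ) {G : Sph q → ℝ} (hG : Continuous G)
    {h : ℝ} (hh : 0 < h) {x : Sph q} {B : Matrix (Fin (q + 1)) (Fin q) ℝ}
    (hB : IsProjectionMatrix x B) :
    (h ^ q)⁻¹ * ∫ y in {y : Sph q | 1 / 2 < inner ℝ (x : Amb q) (y : Amb q)},
        L ((1 - inner ℝ (x : Amb q) (y : Amb q)) / h ^ 2) *
          ψ (h⁻¹ • tangentCoord B (y : Amb q)) * G y ∂(surfaceMeasure q) =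
      ∫ u : EuclideanSpace ℝ (Fin q), (√(1 + h ^ 2 * ‖u‖ ^ 2))⁻¹ ^ (q + 1) *
        ({u : EuclideanSpace ℝ (Fin q) | √(1 + h ^ 2 * ‖u‖ ^ 2) < 2}.indicator
          (fun u => L (‖u‖ ^ 2 / (√(1 + h ^ 2 * ‖u‖ ^ 2) * (1 + √(1 + h ^ 2 * ‖u‖ ^ 2)))) *
            ψ ((√(1 + h ^ 2 * ‖u‖ ^ 2))⁻¹ • u) * G (gnomonic x B (h • u))) u) := by
  set F : Sph q → ℝ := fun y => L ((1 - inner ℝ (x : Amb q) (y : Amb q)) / h ^ 2) *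
    ψ (h⁻¹ • tangentCoord B (y : Amb q)) * G y with hF
  have hFc : Continuous F := (continuous_localIntegrand hL hψ h x B).mul hG
  have hms : MeasurableSet {y : Sph q | 1 / 2 < inner ℝ (x : Amb q) (y : Amb q)} :=
    measurableSet_lt measurable_const (by fun_prop)
  have hsub : {y : Sph q | 1 / 2 < inner ℝ (x : Amb q) (y : Amb q)} ⊆
      {y : Sph q | 0 < inner ℝ (x : Amb q) (y : Amb q)} := by
    intro y hy
    have : (1 : ℝ) / 2 < inner ℝ (x : Amb q) (y : Amb q) := hy
    exact lt_trans (by norm_num) this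
  have h1 : ∫ y in {y : Sph q | 1 / 2 < inner ℝ (x : Amb q) (y : Amb q)}, F y ∂(surfaceMeasure q) =
      ∫ y in {y : Sph q | 0 < inner ℝ (x : Amb q) (y : Amb q)},
        {y : Sph q | 1 / 2 < inner ℝ (x : Amb q) (y : Amb q)}.indicator F y ∂(surfaceMeasure q) := by
    rw [setIntegral_indicator hms, Set.inter_eq_self_of_subset_right hsub]
  rw [h1, hB.integral_hemisphere _ (hFc.measurable.indicator hms)]
  -- The substitution v = h u absorbs the factor (h^q)⁻¹.
  have h2 := Measure.integral_comp_smul_of_nonneg (volume : Measure (EuclideanSpace ℝ (Fin q)))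
    (fun v => (√(1 + ‖v‖ ^ 2))⁻¹ ^ (q + 1) *
      {y : Sph q | 1 / 2 < inner ℝ (x : Amb q) (y : Amb q)}.indicator F (gnomonic x B v)) h
    (hR := hh.le)
  rw [finrank_euclideanSpace, Fintype.card_fin, smul_eq_mul] at h2
  rw [← h2]
  refine integral_congr_ae (ae_of_all _ fun u => ?_)
  have hn : ‖h • u‖ ^ 2 = h ^ 2 * ‖u‖ ^ 2 := by
    rw [norm_smul, Real.norm_of_nonneg hh.le, mul_pow]
  have hs : 0 < √(1 + h ^ 2 * ‖u‖ ^ 2) := Real.sqrt_pos.mpr (by positivity)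
  simp only [hn]
  congr 1
  -- Since xᵀy is the reciprocal of this root, the cut xᵀy > 1/2 reads as root < 2.
  by_cases hu : √(1 + h ^ 2 * ‖u‖ ^ 2) < 2
  · rw [Set.indicator_of_mem,
      Set.indicator_of_mem (s := {u : EuclideanSpace ℝ (Fin q) | √(1 + h ^ 2 * ‖u‖ ^ 2) < 2}) hu]
    · simp only [hF, hB.inner_gnomonic, hB.tangentCoord_gnomonic, hn]
      rw [one_sub_inv_sqrt_div hh (sq_nonneg _), smul_comm, smul_smul h⁻¹ h u,
        inv_mul_cancel₀ hh.ne', one_smul]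
    · rw [Set.mem_ofPred_eq, hB.inner_gnomonic, hn, one_div]
      exact (inv_lt_inv₀ (by norm_num) hs).mpr hu
  · rw [Set.indicator_of_notMem,
      Set.indicator_of_notMem (s := {u : EuclideanSpace ℝ (Fin q) | √(1 + h ^ 2 * ‖u‖ ^ 2) < 2}) hu]
    rw [Set.mem_ofPred_eq, hB.inner_gnomonic, hn, one_div]
    exact fun h' => hu ((inv_lt_inv₀ (by norm_num) hs).mp h')

end Kernel

instance {q : ℕ} : IsFiniteMeasure (surfaceMeasure q) := by
  unfold surfaceMeasure; infer_instance

/-! ### Concentration of local integrals at the base point, uniformly -/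

section Kernel

variable {q : ℕ} {L : ℝ → ℝ}

theorem ModerateGrowth.integrable_kernel (hL : IsDirectionalKernel L)
    {ψ : EuclideanSpace ℝ (Fin q) → ℝ} (hψ : ModerateGrowth ψ) :
    Integrable fun u : EuclideanSpace ℝ (Fin q) => L (‖u‖ ^ 2 / 2) * ψ u := by
  obtain ⟨M, α, hM, hα, hdec⟩ := hL.decay
  obtain ⟨C, hC, hψC⟩ := hψ.bound (α / 4) (by positivity)
  refine ((integrable_exp_neg_mul_norm_sq q (b := α / 4) (by positivity)).const_mul
    (M * C)).mono' ?_ (ae_of_all _ fun u => ?_)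
  · exact ((hL.continuous_comp (by fun_prop) fun u => by positivity).mul
      hψ.continuous).aestronglyMeasurable
  · have h0 : 0 ≤ ‖u‖ ^ 2 / 2 := by positivity
    rw [Real.norm_eq_abs, abs_mul, abs_of_nonneg (hL.nonneg _ h0)]
    calc _ ≤ (M * Real.exp (-α * (‖u‖ ^ 2 / 2))) * (C * Real.exp (α / 4 * ‖u‖ ^ 2)) :=
          mul_le_mul (hdec _ h0) (hψC u) (abs_nonneg _) (by positivity)
      _ = M * C * (Real.exp (-α * (‖u‖ ^ 2 / 2)) * Real.exp (α / 4 * ‖u‖ ^ 2)) := by ring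
      _ = _ := by rw [← Real.exp_add]; ring_nf

/-- The integrand of a local integral in rescaled gnomonic coordinates. -/
def nearIntegrand (L : ℝ → ℝ) (ψ : EuclideanSpace ℝ (Fin q) → ℝ) (G : Sph q → ℝ) (h : ℝ)
    (x : Sph q) (B : Matrix (Fin (q + 1)) (Fin q) ℝ) (u : EuclideanSpace ℝ (Fin q)) : ℝ :=
  (√(1 + h ^ 2 * ‖u‖ ^ 2))⁻¹ ^ (q + 1) *
    ({u : EuclideanSpace ℝ (Fin q) | √(1 + h ^ 2 * ‖u‖ ^ 2) < 2}.indicator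
      (fun u => L (‖u‖ ^ 2 / (√(1 + h ^ 2 * ‖u‖ ^ 2) * (1 + √(1 + h ^ 2 * ‖u‖ ^ 2)))) *
        ψ ((√(1 + h ^ 2 * ‖u‖ ^ 2))⁻¹ • u) * G (gnomonic x B (h • u))) u)

theorem measurable_nearIntegrand (hL : IsDirectionalKernel L)
    {ψ : EuclideanSpace ℝ (Fin q) → ℝ} (hψ : Continuous ψ) {G : Sph q → ℝ} (hG : Continuous G)
    (h : ℝ) (x : Sph q) (B : Matrix (Fin (q + 1)) (Fin q) ℝ) :
    Measurable (nearIntegrand L ψ G h x B) := by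
  have hs : ∀ u : EuclideanSpace ℝ (Fin q), 0 < √(1 + h ^ 2 * ‖u‖ ^ 2) := fun u =>
    Real.sqrt_pos.mpr (by positivity)
  refine Measurable.mul (by fun_prop) (Measurable.indicator ?_
    (measurableSet_lt (by fun_prop) measurable_const))
  refine Measurable.mul (Measurable.mul ?_ ?_) ?_
  · refine (hL.continuous_comp ?_ fun u => ?_).measurable
    · refine Continuous.div (by fun_prop) (by fun_prop) fun u => ?_
      have := hs u
      positivity
    · have := hs u
      positivity
  · refine (hψ.comp (Continuous.smul (Continuous.inv₀ (by fun_prop) fun u => (hs u).ne')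
      continuous_id)).measurable
  · exact hG.measurable.comp ((measurable_gnomonic x B).comp (by fun_prop))

/-- The dominating function for the near part, free of h, x and the frame. On the cut the root s
satisfies s(1 + s) ≤ 6, so L decays at least like exp(-α‖u‖²/6); growth of ψ at rate α/12 leaves a
Gaussian of rate α/12. -/
theorem abs_nearIntegrand_le (hL : IsDirectionalKernel L)
    {ψ : EuclideanSpace ℝ (Fin q) → ℝ} {M α C D : ℝ} (hM : 0 ≤ M) (hα : 0 < α) (hC : 0 ≤ C)
    (hD : 0 ≤ D) (hdec : ∀ r, 0 ≤ r → L r ≤ M * Real.exp (-α * r))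
    (hψ : ∀ u, |ψ u| ≤ C * Real.exp (α / 12 * ‖u‖ ^ 2)) {G : Sph q → ℝ} (hG : ∀ y, |G y| ≤ D)
    (h : ℝ) (x : Sph q) (B : Matrix (Fin (q + 1)) (Fin q) ℝ) (u : EuclideanSpace ℝ (Fin q)) :
    |nearIntegrand L ψ G h x B u| ≤ M * C * D * Real.exp (-(α / 12) * ‖u‖ ^ 2) := by
  unfold nearIntegrand
  have hs1 : 1 ≤ √(1 + h ^ 2 * ‖u‖ ^ 2) := Real.one_le_sqrt.mpr (by nlinarith [sq_nonneg (h * ‖u‖)])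
  by_cases hu : √(1 + h ^ 2 * ‖u‖ ^ 2) < 2
  · rw [Set.indicator_of_mem
      (s := {u : EuclideanSpace ℝ (Fin q) | √(1 + h ^ 2 * ‖u‖ ^ 2) < 2}) hu]
    generalize √(1 + h ^ 2 * ‖u‖ ^ 2) = s at hs1 hu
    have hspos : 0 < s := by linarith
    have hr0 : 0 ≤ ‖u‖ ^ 2 / (s * (1 + s)) := by positivity
    have hr : ‖u‖ ^ 2 / 6 ≤ ‖u‖ ^ 2 / (s * (1 + s)) := by
      gcongr
      nlinarith
    have h1 : |L (‖u‖ ^ 2 / (s * (1 + s)))| ≤ M * Real.exp (-α * (‖u‖ ^ 2 / 6)) := by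
      rw [abs_of_nonneg (hL.nonneg _ hr0)]
      refine (hdec _ hr0).trans (mul_le_mul_of_nonneg_left (Real.exp_le_exp.mpr ?_) hM)
      nlinarith
    have h2 : |ψ (s⁻¹ • u)| ≤ C * Real.exp (α / 12 * ‖u‖ ^ 2) := by
      refine (hψ _).trans (mul_le_mul_of_nonneg_left (Real.exp_le_exp.mpr ?_) hC)
      rw [norm_smul, norm_inv, Real.norm_of_nonneg hspos.le]
      have h3 : s⁻¹ * ‖u‖ ≤ ‖u‖ :=
        mul_le_of_le_one_left (norm_nonneg _) (inv_le_one_of_one_le₀ hs1)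
      gcongr
    have h4 : |s⁻¹ ^ (q + 1)| ≤ 1 := by
      rw [abs_of_nonneg (by positivity)]
      exact pow_le_one₀ (by positivity) (inv_le_one_of_one_le₀ hs1)
    rw [abs_mul, abs_mul, abs_mul]
    calc _ ≤ 1 * ((M * Real.exp (-α * (‖u‖ ^ 2 / 6))) * (C * Real.exp (α / 12 * ‖u‖ ^ 2)) * D) := by
          gcongr
          exact hG _
      _ = M * C * D * (Real.exp (-α * (‖u‖ ^ 2 / 6)) * Real.exp (α / 12 * ‖u‖ ^ 2)) := by ring
      _ = _ := by rw [← Real.exp_add]; ring_nf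
  · rw [Set.indicator_of_notMem
      (s := {u : EuclideanSpace ℝ (Fin q) | √(1 + h ^ 2 * ‖u‖ ^ 2) < 2}) hu, mul_zero, abs_zero]
    positivity

/-- The base points move with n, so G at the base point need not converge and only a difference can
tend to zero. The point with coordinates h u approaches the base point at a rate that depends on h
and ‖u‖ only, and G is uniformly continuous on the compact sphere. -/
theorem tendsto_nearIntegrand (hL : IsDirectionalKernel L)
    {ψ : EuclideanSpace ℝ (Fin q) → ℝ} (hψ : Continuous ψ) {G : Sph q → ℝ} (hG : Continuous G)
    {h : ℕ → ℝ} (h0 : Tendsto h atTop (𝓝 0)) (x : ℕ → Sph q)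
    (B : ℕ → Matrix (Fin (q + 1)) (Fin q) ℝ) (hB : ∀ n, IsProjectionMatrix (x n) (B n))
    (u : EuclideanSpace ℝ (Fin q)) :
    Tendsto (fun n => nearIntegrand L ψ G (h n) (x n) (B n) u -
      G (x n) * (L (‖u‖ ^ 2 / 2) * ψ u)) atTop (𝓝 0) := by
  have hs : Tendsto (fun n => √(1 + h n ^ 2 * ‖u‖ ^ 2)) atTop (𝓝 1) := by
    have h1 : Tendsto (fun n => √(1 + h n ^ 2 * ‖u‖ ^ 2)) atTop (𝓝 √(1 + 0 ^ 2 * ‖u‖ ^ 2)) :=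
      (((h0.pow 2).mul_const _).const_add 1).sqrt
    simpa using h1
  have hsi : Tendsto (fun n => (√(1 + h n ^ 2 * ‖u‖ ^ 2))⁻¹) atTop (𝓝 1) := by
    simpa using hs.inv₀ one_ne_zero
  have hA : Tendsto (fun n => (√(1 + h n ^ 2 * ‖u‖ ^ 2))⁻¹ ^ (q + 1) *
      (L (‖u‖ ^ 2 / (√(1 + h n ^ 2 * ‖u‖ ^ 2) * (1 + √(1 + h n ^ 2 * ‖u‖ ^ 2)))) *
        ψ ((√(1 + h n ^ 2 * ‖u‖ ^ 2))⁻¹ • u))) atTop (𝓝 (L (‖u‖ ^ 2 / 2) * ψ u)) := by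
    have h1 : Tendsto (fun n => (√(1 + h n ^ 2 * ‖u‖ ^ 2))⁻¹ ^ (q + 1)) atTop (𝓝 1) := by
      simpa using hsi.pow (q + 1)
    have h2 : Tendsto (fun n => ‖u‖ ^ 2 / (√(1 + h n ^ 2 * ‖u‖ ^ 2) *
        (1 + √(1 + h n ^ 2 * ‖u‖ ^ 2)))) atTop (𝓝 (‖u‖ ^ 2 / 2)) := by
      have := (tendsto_const_nhds (x := ‖u‖ ^ 2)).div (hs.mul (hs.const_add 1)) (by norm_num)
      norm_num at this
      exact this
    have h3 := (hL.continuousOn (‖u‖ ^ 2 / 2) (by simp; positivity)).tendsto.comp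
      (tendsto_nhdsWithin_iff.mpr ⟨h2, Eventually.of_forall fun n => by
        rw [Set.mem_Ici]; positivity⟩)
    have h4 : Tendsto (fun n => ψ ((√(1 + h n ^ 2 * ‖u‖ ^ 2))⁻¹ • u)) atTop (𝓝 (ψ u)) := by
      refine (hψ.tendsto _).comp ?_
      simpa using hsi.smul_const u
    simpa using h1.mul (h3.mul h4)
  have hdist : Tendsto (fun n => dist (gnomonic (x n) (B n) (h n • u)) (x n)) atTop (𝓝 0) := by
    have h1 : ∀ n, dist (gnomonic (x n) (B n) (h n • u)) (x n) =
        √(2 - 2 * (√(1 + h n ^ 2 * ‖u‖ ^ 2))⁻¹) := by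
      intro n
      have h2 := dist_gnomonic_sq (hB n) (h n • u)
      rw [norm_smul, mul_pow, Real.norm_eq_abs, sq_abs] at h2
      rw [← h2, Real.sqrt_sq dist_nonneg]
    simp_rw [h1]
    have h3 := ((hsi.const_mul 2).const_sub 2).sqrt
    simpa using h3
  have hGd : Tendsto (fun n => G (gnomonic (x n) (B n) (h n • u)) - G (x n)) atTop (𝓝 0) := by
    have hu := CompactSpace.uniformContinuous_of_continuous hG
    rw [Metric.uniformContinuous_iff] at hu
    rw [Metric.tendsto_atTop]
    intro ε hε
    obtain ⟨δ, hδ, hδ'⟩ := hu ε hε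
    obtain ⟨N, hN⟩ := Metric.tendsto_atTop.mp hdist δ hδ
    refine ⟨N, fun n hn => ?_⟩
    have h1 := hN n hn
    rw [Real.dist_eq, sub_zero, abs_of_nonneg dist_nonneg] at h1
    have h2 := hδ' h1
    rw [Real.dist_eq] at h2 ⊢
    simpa using h2
  obtain ⟨D, hD, hGD⟩ := exists_abs_le_of_continuous hG
  have h5 : Tendsto (fun n => ((√(1 + h n ^ 2 * ‖u‖ ^ 2))⁻¹ ^ (q + 1) *
      (L (‖u‖ ^ 2 / (√(1 + h n ^ 2 * ‖u‖ ^ 2) * (1 + √(1 + h n ^ 2 * ‖u‖ ^ 2)))) *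
        ψ ((√(1 + h n ^ 2 * ‖u‖ ^ 2))⁻¹ • u)) - L (‖u‖ ^ 2 / 2) * ψ u) * G (x n)) atTop (𝓝 0) := by
    refine Tendsto.zero_mul_isBoundedUnder_le ?_ ⟨D, ?_⟩
    · have h7 := hA.sub_const (L (‖u‖ ^ 2 / 2) * ψ u)
      rwa [sub_self] at h7
    · exact eventually_map.mpr (Eventually.of_forall fun n => hGD _)
  have h6 := (hA.mul hGd).add h5
  rw [mul_zero, add_zero] at h6
  refine h6.congr' ?_
  -- For fixed u the root tends to 1, so the cutoff is eventually inactive.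
  filter_upwards [hs.eventually_lt_const (by norm_num : (1 : ℝ) < 2)] with n hn
  rw [nearIntegrand, Set.indicator_of_mem
      (s := {u : EuclideanSpace ℝ (Fin q) | √(1 + h n ^ 2 * ‖u‖ ^ 2) < 2}) hn]
  ring

/-- Local integrals concentrate at `x`, along arbitrary sequences of base points. -/
theorem tendsto_localIntegral (hL : IsDirectionalKernel L)
    {ψ : EuclideanSpace ℝ (Fin q) → ℝ} (hψ : ModerateGrowth ψ) {G : Sph q → ℝ} (hG : Continuous G)
    {h : ℕ → ℝ} (hpos : ∀ n, 0 < h n) (h0 : Tendsto h atTop (𝓝 0)) (x : ℕ → Sph q)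
    (B : ℕ → Matrix (Fin (q + 1)) (Fin q) ℝ) (hB : ∀ n, IsProjectionMatrix (x n) (B n)) :
    Tendsto (fun n => (h n ^ q)⁻¹ * localIntegral L ψ G (h n) (x n) (B n) -
      G (x n) * kernelMoment L ψ) atTop (𝓝 0) := by
  obtain ⟨M, α, hM, hα, hdec⟩ := hL.decay
  obtain ⟨C, hC, hψC⟩ := hψ.bound (α / 12) (by positivity)
  obtain ⟨D, hD, hGD⟩ := exists_abs_le_of_continuous hG
  have hker := hψ.integrable_kernel hL
  have hbd := (integrable_exp_neg_mul_norm_sq q (b := α / 12) (by positivity)).const_mul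
    (M * C * D)
  have hle : ∀ n u, |nearIntegrand L ψ G (h n) (x n) (B n) u| ≤
      M * C * D * Real.exp (-(α / 12) * ‖u‖ ^ 2) := fun n u =>
    abs_nearIntegrand_le hL hM.le hα hC hD hdec hψC hGD _ _ _ _
  have hmeas : ∀ n, AEStronglyMeasurable (nearIntegrand L ψ G (h n) (x n) (B n)) volume := fun n =>
    (measurable_nearIntegrand hL hψ.continuous hG _ _ _).aestronglyMeasurable
  have hint : ∀ n, Integrable (nearIntegrand L ψ G (h n) (x n) (B n)) := fun n =>
    hbd.mono' (hmeas n) (ae_of_all _ (hle n))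
  have hnear : Tendsto (fun n => (∫ u, nearIntegrand L ψ G (h n) (x n) (B n) u) -
      G (x n) * kernelMoment L ψ) atTop (𝓝 0) := by
    have h1 := tendsto_integral_of_dominated_convergence
      (F := fun n u => nearIntegrand L ψ G (h n) (x n) (B n) u -
        G (x n) * (L (‖u‖ ^ 2 / 2) * ψ u)) (f := fun _ => (0 : ℝ)) (μ := volume)
      (fun u => M * C * D * Real.exp (-(α / 12) * ‖u‖ ^ 2) + D * |L (‖u‖ ^ 2 / 2) * ψ u|)
      (fun n => (hmeas n).sub (hker.const_mul _).aestronglyMeasurable)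
      (hbd.add (hker.abs.const_mul D))
      (fun n => ae_of_all _ fun u => ?_)
      (ae_of_all _ fun u => tendsto_nearIntegrand hL hψ.continuous hG h0 x B hB u)
    · rw [integral_zero] at h1
      refine h1.congr fun n => ?_
      rw [integral_sub (hint n) (hker.const_mul _), integral_const_mul]
      rfl
    · refine (norm_sub_le _ _).trans (add_le_add (hle n u) ?_)
      rw [Real.norm_eq_abs, abs_mul]
      exact mul_le_mul_of_nonneg_right (hGD _) (abs_nonneg _)
  have hfar := tendsto_localIntegral_far hL hψ hG hpos h0 x B hB
  have h2 := hnear.add hfar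
  rw [add_zero] at h2
  refine h2.congr fun n => ?_
  have hcont : Continuous fun y : Sph q =>
      L ((1 - inner ℝ (x n : Amb q) (y : Amb q)) / h n ^ 2) *
        ψ ((h n)⁻¹ • tangentCoord (B n) (y : Amb q)) * G y :=
    (continuous_localIntegrand hL hψ.continuous _ _ _).mul hG
  have hI : Integrable (fun y : Sph q =>
      L ((1 - inner ℝ (x n : Amb q) (y : Amb q)) / h n ^ 2) *
        ψ ((h n)⁻¹ • tangentCoord (B n) (y : Amb q)) * G y) (surfaceMeasure q) :=
    hcont.integrable_of_hasCompactSupport (HasCompactSupport.of_compactSpace _)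
  have hms : MeasurableSet {y : Sph q | 1 / 2 < inner ℝ (x n : Amb q) (y : Amb q)} :=
    measurableSet_lt measurable_const (by fun_prop)
  have h3 := localIntegral_near_eq hL hψ.continuous hG (hpos n) (hB n)
  have h4 : ∫ u, nearIntegrand L ψ G (h n) (x n) (B n) u = _ := h3.symm
  rw [h4, localIntegral, ← integral_add_compl hms hI]
  ring

/-- Given ε, select at each n a point with error at least ε whenever there is one. Convergence along
this sequence says that eventually there is none. This lets dominated convergence, a statement about
sequences, yield uniformity in the base point. -/
theorem tendstoUniformly_of_seq {α : Type*} [Nonempty α] {F : ℕ → α → ℝ} {f : α → ℝ}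
    (h : ∀ x : ℕ → α, Tendsto (fun n => F n (x n) - f (x n)) atTop (𝓝 0)) :
    TendstoUniformly F f atTop := by
  classical
  rw [Metric.tendstoUniformly_iff]
  intro ε hε
  let x : ℕ → α := fun n =>
    if hn : ∃ y, ε ≤ |F n y - f y| then hn.choose else Classical.arbitrary α
  have hx := (h x).abs
  rw [abs_zero] at hx
  filter_upwards [hx.eventually_lt_const hε] with n hn y
  rw [dist_comm, Real.dist_eq]
  by_contra hy
  have hex : ∃ y, ε ≤ |F n y - f y| := ⟨y, not_lt.mp hy⟩
  have h1 := hex.choose_spec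
  simp only [x, dif_pos hex] at hn
  exact absurd hn (not_lt.mpr h1)

theorem nonempty_of_sphere (q : ℕ) : Nonempty (Sph q) :=
  (NormedSpace.sphere_nonempty.mpr zero_le_one).to_subtype

theorem tendstoUniformly_localIntegral (hL : IsDirectionalKernel L)
    {ψ : EuclideanSpace ℝ (Fin q) → ℝ} (hψ : ModerateGrowth ψ) {G : Sph q → ℝ} (hG : Continuous G)
    {h : ℕ → ℝ} (hpos : ∀ n, 0 < h n) (h0 : Tendsto h atTop (𝓝 0))
    (B : Sph q → Matrix (Fin (q + 1)) (Fin q) ℝ) (hB : ∀ x, IsProjectionMatrix x (B x)) :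
    TendstoUniformly (fun n x => (h n ^ q)⁻¹ * localIntegral L ψ G (h n) x (B x))
      (fun x => G x * kernelMoment L ψ) atTop := by
  have := nonempty_of_sphere q
  exact tendstoUniformly_of_seq fun x =>
    tendsto_localIntegral hL hψ hG hpos h0 x (fun n => B (x n)) fun n => hB (x n)

theorem eventually_localIntegral_le (hL : IsDirectionalKernel L)
    {ψ : EuclideanSpace ℝ (Fin q) → ℝ} (hψ : ModerateGrowth ψ) {G : Sph q → ℝ} (hG : Continuous G)
    {h : ℕ → ℝ} (hpos : ∀ n, 0 < h n) (h0 : Tendsto h atTop (𝓝 0))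
    (B : Sph q → Matrix (Fin (q + 1)) (Fin q) ℝ) (hB : ∀ x, IsProjectionMatrix x (B x)) :
    ∃ C : ℝ, ∀ᶠ n in atTop, ∀ x, localIntegral L ψ G (h n) x (B x) ≤ C * h n ^ q := by
  obtain ⟨D, hD, hGD⟩ := exists_abs_le_of_continuous hG
  have h1 := Metric.tendstoUniformly_iff.mp
    (tendstoUniformly_localIntegral hL hψ hG hpos h0 B hB) 1 one_pos
  refine ⟨D * |kernelMoment L ψ| + 1, h1.mono fun n hn x => ?_⟩
  have h2 := hn x
  rw [dist_comm, Real.dist_eq] at h2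
  have h3 := (abs_lt.mp h2).2
  have h4 : G x * kernelMoment L ψ ≤ D * |kernelMoment L ψ| :=
    (le_abs_self _).trans ((abs_mul _ _).le.trans
      (mul_le_mul_of_nonneg_right (hGD x) (abs_nonneg _)))
  have hp : 0 < h n ^ q := pow_pos (hpos n) q
  have h5 : (h n ^ q)⁻¹ * localIntegral L ψ G (h n) x (B x) ≤ D * |kernelMoment L ψ| + 1 := by
    linarith
  rwa [inv_mul_le_iff₀ hp, mul_comm] at h5

end Kernel

/-! ### Normalising constants and the limiting Gram matrix -/

section Moments

variable {q : ℕ} {L : ℝ → ℝ}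

/-- The point supplied by nontriviality may be r = 0; continuity from the right moves it into the
interior. -/
theorem IsDirectionalKernel.exists_pos (hL : IsDirectionalKernel L) : ∃ r, 0 < r ∧ 0 < L r := by
  obtain ⟨r, hr, hLr⟩ := hL.nontrivial
  have hpos : 0 < L r := lt_of_le_of_ne (hL.nonneg r hr) (Ne.symm hLr)
  have h1 : ∀ᶠ s in 𝓝[Set.Ici 0] r, 0 < L s := (hL.continuousOn r hr).eventually_const_lt hpos
  have h2 : ∀ᶠ s in 𝓝[>] r, 0 < L s :=
    h1.filter_mono (nhdsWithin_mono _ fun s hs => hr.trans (le_of_lt hs))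
  obtain ⟨s, hs, hs'⟩ := (h2.and self_mem_nhdsWithin).exists
  exact ⟨s, lt_of_le_of_lt hr hs', hs⟩

/-- The total mass of the limit kernel, in Cartesian and in radial form. -/
theorem kernelMoment_one (hq : 1 ≤ q) (L : ℝ → ℝ) :
    kernelMoment L (fun _ : EuclideanSpace ℝ (Fin q) => 1) = kernelMass q L := by
  have hqpos : (0 : ℝ) < q := by exact_mod_cast hq
  have : Nonempty (Fin q) := ⟨⟨0, hq⟩⟩
  have h1 := integral_fun_norm_addHaar (volume : Measure (EuclideanSpace ℝ (Fin q)))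
    (fun t => L (t ^ 2 / 2))
  rw [finrank_euclideanSpace, Fintype.card_fin] at h1
  have h2 : (volume : Measure (EuclideanSpace ℝ (Fin q))).real (Metric.ball 0 1) =
      √Real.pi ^ q / Real.Gamma (q / 2 + 1) := by
    rw [measureReal_def, EuclideanSpace.volume_ball, Fintype.card_fin]
    simp only [ENNReal.ofReal_one, one_pow, one_mul]
    exact ENNReal.toReal_ofReal (div_nonneg (by positivity)
      (Real.Gamma_pos_of_pos (by positivity)).le)
  have h3 : ∫ y in Set.Ioi (0 : ℝ), y ^ (q - 1) • L (y ^ 2 / 2) =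
      2 ^ ((q : ℝ) / 2 - 1) * ∫ r in Set.Ioi (0 : ℝ), L r * r ^ ((q : ℝ) / 2 - 1) := by
    -- The substitution r = y²/2 is made in two moves: squaring, then scaling by 2.
    have h4 := integral_comp_rpow_Ioi_of_pos
      (g := fun y => L (y / 2) * y ^ ((q : ℝ) / 2 - 1)) (p := 2) two_pos
    have h5 := integral_comp_mul_left_Ioi (fun y => L (y / 2) * y ^ ((q : ℝ) / 2 - 1)) 0
      (two_pos : (0 : ℝ) < 2)
    rw [mul_zero, smul_eq_mul] at h5
    have h6 : ∫ y in Set.Ioi (0 : ℝ), y ^ (q - 1) • L (y ^ 2 / 2) =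
        2⁻¹ * ∫ y in Set.Ioi (0 : ℝ), L (y / 2) * y ^ ((q : ℝ) / 2 - 1) := by
      rw [← h4, ← integral_const_mul]
      refine setIntegral_congr_fun measurableSet_Ioi fun y hy => ?_
      have hy' : (0 : ℝ) < y := hy
      have h7 : (y ^ (2 : ℝ)) ^ ((q : ℝ) / 2 - 1) = y ^ ((q : ℝ) - 2) := by
        rw [← Real.rpow_mul hy'.le]
        congr 1; ring
      have h8 : y ^ (q - 1) = y ^ ((2 : ℝ) - 1) * y ^ ((q : ℝ) - 2) := by
        rw [← Real.rpow_add hy', ← Real.rpow_natCast, Nat.cast_sub hq]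
        congr 1; push_cast; ring
      simp only [smul_eq_mul]
      rw [h7, h8, Real.rpow_two]
      ring
    rw [h6, ← h5, ← integral_const_mul]
    refine setIntegral_congr_fun measurableSet_Ioi fun y hy => ?_
    have hy' : (0 : ℝ) < y := hy
    rw [mul_div_cancel_left₀ _ two_ne_zero, Real.mul_rpow two_pos.le hy'.le]
    ring
  -- The area of the unit sphere of ℝ^q is q times the volume of its unit ball.
  have h9 : (q : ℝ) * (√Real.pi ^ q / Real.Gamma (q / 2 + 1)) = lowerArea q := by
    have hG := Real.Gamma_add_one (s := (q : ℝ) / 2) (by positivity)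
    have hGp : 0 < Real.Gamma ((q : ℝ) / 2) := Real.Gamma_pos_of_pos (by positivity)
    have hpi : √Real.pi ^ q = Real.pi ^ ((q : ℝ) / 2) := by
      rw [Real.sqrt_eq_rpow, ← Real.rpow_natCast, ← Real.rpow_mul Real.pi_pos.le]
      congr 1; ring
    rw [lowerArea, hG, hpi]
    field_simp
  simp only [kernelMoment, mul_one]
  rw [h1, h2, h3, kernelMass, ← h9, nsmul_eq_mul, smul_eq_mul]
  ring

theorem kernelMass_pos (hq : 1 ≤ q) (hL : IsDirectionalKernel L) : 0 < kernelMass q L := by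
  rw [← kernelMoment_one hq, kernelMoment]
  obtain ⟨r, hr, hLr⟩ := hL.exists_pos
  have hc : Continuous fun u : EuclideanSpace ℝ (Fin q) => L (‖u‖ ^ 2 / 2) * 1 :=
    (hL.continuous_comp (by fun_prop) fun u => by positivity).mul continuous_const
  have hnn : ∀ u : EuclideanSpace ℝ (Fin q), 0 ≤ L (‖u‖ ^ 2 / 2) * 1 := fun u => by
    have := hL.nonneg (‖u‖ ^ 2 / 2) (by positivity)
    simpa using this
  rw [integral_pos_iff_support_of_nonneg hnn ((ModerateGrowth.const 1).integrable_kernel hL)]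
  -- A vector of norm √(2r) has ‖u‖²/2 = r, a point where L is positive.
  refine hc.isOpen_support.measure_pos _ ⟨EuclideanSpace.single ⟨0, hq⟩ √(2 * r), ?_⟩
  rw [Function.mem_support, PiLp.norm_single, Real.norm_of_nonneg (Real.sqrt_nonneg _),
    Real.sq_sqrt (by positivity), mul_div_cancel_left₀ _ two_ne_zero, mul_one]
  exact hLr.ne'

/-- For q = 1 the exponent is -1/2 and the two factors are singular at opposite ends. On each half
of the interval one factor is continuous and the other is an integrable power, reflected by r ↦ b -
r on the right half. -/
theorem intervalIntegrable_beta {a b : ℝ} (ha : -1 < a) (hb : 0 < b) {h : ℝ} (hh : 2 = b * h ^ 2) :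
    IntervalIntegrable (fun r : ℝ => r ^ a * (2 - r * h ^ 2) ^ a) volume 0 b := by
  have hh2 : 0 < h ^ 2 := by
    by_contra hcon
    nlinarith [sq_nonneg h]
  have h1 : IntervalIntegrable (fun r : ℝ => r ^ a * (2 - r * h ^ 2) ^ a) volume 0 (b / 2) := by
    refine (intervalIntegral.intervalIntegrable_rpow' ha).mul_continuousOn ?_
    refine ContinuousOn.rpow_const (by fun_prop) fun r hr => Or.inl ?_
    rw [Set.uIcc_of_le (by positivity)] at hr
    nlinarith [hr.2]
  have h2 : IntervalIntegrable (fun r : ℝ => r ^ a * (2 - r * h ^ 2) ^ a) volume (b / 2) b := by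
    have h3 := ((intervalIntegral.intervalIntegrable_rpow' (a := 0) (b := b / 2) ha).comp_sub_left
      b).symm
    rw [sub_zero, show b - b / 2 = b / 2 by ring] at h3
    have h4 : IntervalIntegrable (fun r : ℝ => (b - r) ^ a * (r ^ a * (h ^ 2) ^ a)) volume
        (b / 2) b := by
      refine h3.mul_continuousOn (ContinuousOn.mul ?_ continuousOn_const)
      refine ContinuousOn.rpow_const continuousOn_id fun r hr => Or.inl ?_
      rw [Set.uIcc_of_le (by linarith)] at hr
      have : 0 < r := by linarith [hr.1]
      exact this.ne'
    refine h4.congr fun r hr => ?_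
    rw [Set.uIoc_of_le (by linarith)] at hr
    have h5 : 2 - r * h ^ 2 = (b - r) * h ^ 2 := by rw [hh]; ring
    simp only [h5]
    rw [Real.mul_rpow (by linarith [hr.2]) hh2.le]
    ring
  exact h1.trans h2

/-- Nonvanishing is all that is needed of λ_{h,q}(L), because it cancels from the estimator. The
range of integration only has to contain a point where L is positive. -/
theorem kernelMassAt_pos (hq : 1 ≤ q) (hL : IsDirectionalKernel L) {r h : ℝ} (hr : 0 < r)
    (hLr : 0 < L r) (hh : 0 < h) (hrh : r < 2 / h ^ 2) : 0 < kernelMassAt q L h := by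
  have hqpos : (0 : ℝ) < q := by exact_mod_cast hq
  have hb : 0 < 2 / h ^ 2 := by positivity
  have harea : 0 < lowerArea q := by
    have := Real.Gamma_pos_of_pos (s := (q : ℝ) / 2) (by positivity)
    unfold lowerArea
    positivity
  refine mul_pos harea ?_
  have hint : IntervalIntegrable (fun r => L r * r ^ ((q : ℝ) / 2 - 1) *
      (2 - r * h ^ 2) ^ ((q : ℝ) / 2 - 1)) volume 0 (2 / h ^ 2) := by
    simp_rw [mul_assoc]
    refine (intervalIntegrable_beta (by linarith [div_pos hqpos two_pos]) hb
      (by field_simp)).continuousOn_mul ?_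
    refine hL.continuousOn.mono fun s hs => ?_
    rw [Set.uIcc_of_le hb.le] at hs
    exact hs.1
  rw [intervalIntegral.integral_of_le hb.le, setIntegral_pos_iff_support_of_nonneg_ae _ hint.1]
  · have hopen : IsOpen (Set.Ioo 0 (2 / h ^ 2) ∩ L ⁻¹' {0}ᶜ) :=
      (hL.continuousOn.mono fun s hs => hs.1.le).isOpen_inter_preimage isOpen_Ioo
        isOpen_compl_singleton
    refine (hopen.measure_pos volume ⟨r, ⟨hr, hrh⟩, hLr.ne'⟩).trans_le (measure_mono ?_)
    rintro s ⟨hs, hs'⟩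
    refine ⟨?_, hs.1, hs.2.le⟩
    have h1 : 0 < s ^ ((q : ℝ) / 2 - 1) := Real.rpow_pos_of_pos hs.1 _
    have h2 : 0 < (2 - s * h ^ 2) ^ ((q : ℝ) / 2 - 1) := by
      refine Real.rpow_pos_of_pos ?_ _
      have := (lt_div_iff₀ (by positivity)).mp hs.2
      linarith
    exact mul_ne_zero (mul_ne_zero hs' h1.ne') h2.ne'
  · refine (ae_restrict_iff' measurableSet_Ioc).mpr (ae_of_all _ fun s hs => ?_)
    have h2 : 0 ≤ 2 - s * h ^ 2 := by
      have := (le_div_iff₀ (by positivity)).mp hs.2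
      linarith
    exact mul_nonneg (mul_nonneg (hL.nonneg s hs.1.le) (Real.rpow_nonneg hs.1.le _))
      (Real.rpow_nonneg h2 _)

theorem eventually_kernelMassAt_pos (hq : 1 ≤ q) (hL : IsDirectionalKernel L) {h : ℕ → ℝ}
    (hpos : ∀ n, 0 < h n) (h0 : Tendsto h atTop (𝓝 0)) :
    ∀ᶠ n in atTop, 0 < kernelMassAt q L (h n) := by
  obtain ⟨r, hr, hLr⟩ := hL.exists_pos
  have h1 : Tendsto (fun n => r * h n ^ 2) atTop (𝓝 0) := by simpa using (h0.pow 2).const_mul r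
  filter_upwards [h1.eventually_lt_const two_pos] with n hn
  exact kernelMassAt_pos hq hL hr hLr (hpos n) ((lt_div_iff₀ (pow_pos (hpos n) 2)).mpr hn)

/-- The regressors of the local fit of degree `p`, as functions of the rescaled coordinates. -/
def regressor (p : ℕ) (a : Unit ⊕ (Fin p × Fin q)) (u : EuclideanSpace ℝ (Fin q)) : ℝ :=
  Sum.elim (fun _ => 1) (fun jk => u jk.2) a

theorem moderateGrowth_regressor (p : ℕ) (a : Unit ⊕ (Fin p × Fin q)) :
    ModerateGrowth (regressor p a) := by
  rcases a with a | a
  · exact ModerateGrowth.const 1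
  · exact ModerateGrowth.coord a.2

/-- The Gram matrix of the regressors with respect to the limit kernel. -/
def gram (q p : ℕ) (L : ℝ → ℝ) (a b : Unit ⊕ (Fin p × Fin q)) : ℝ :=
  kernelMoment L fun u => regressor p a u * regressor p b u

theorem gram_inl_inl (hq : 1 ≤ q) (p : ℕ) (L : ℝ → ℝ) :
    gram q p L (Sum.inl ()) (Sum.inl ()) = kernelMass q L := by
  rw [← kernelMoment_one hq]
  simp [gram, regressor]

/-- A null vector v gives an affine function P with ∫ L(‖u‖²/2) P(u)² = 0. By continuity P vanishes
on the nonempty open set where L(‖u‖²/2) > 0, and an affine function vanishing there has zero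
coefficients. -/
theorem det_gram_ne_zero (hq : 1 ≤ q) (hL : IsDirectionalKernel L) {p : ℕ} (hp : p = 0 ∨ p = 1) :
    (Matrix.of (gram q p L)).det ≠ 0 := by
  intro hdet
  obtain ⟨v, hv0, hv⟩ := Matrix.exists_mulVec_eq_zero_iff.mpr hdet
  apply hv0
  set P : EuclideanSpace ℝ (Fin q) → ℝ := fun u => ∑ a, v a * regressor p a u with hP
  have hPc : Continuous P := by
    refine continuous_finsetSum _ fun a _ => ?_
    exact continuous_const.mul (moderateGrowth_regressor p a).continuous
  have hint : ∀ a b, Integrable fun u : EuclideanSpace ℝ (Fin q) =>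
      L (‖u‖ ^ 2 / 2) * (regressor p a u * regressor p b u) := fun a b =>
    ((moderateGrowth_regressor p a).mul (moderateGrowth_regressor p b)).integrable_kernel hL
  have hexp : ∀ u : EuclideanSpace ℝ (Fin q), L (‖u‖ ^ 2 / 2) * P u ^ 2 =
      ∑ a, ∑ b, v a * v b * (L (‖u‖ ^ 2 / 2) * (regressor p a u * regressor p b u)) := by
    intro u
    rw [show P u ^ 2 = (∑ a, v a * regressor p a u) * ∑ b, v b * regressor p b u from sq _,
      Finset.sum_mul_sum, Finset.mul_sum]
    refine Finset.sum_congr rfl fun a _ => ?_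
    rw [Finset.mul_sum]
    exact Finset.sum_congr rfl fun b _ => by ring
  have hPint : Integrable fun u : EuclideanSpace ℝ (Fin q) => L (‖u‖ ^ 2 / 2) * P u ^ 2 := by
    simp_rw [hexp]
    exact integrable_finsetSum _ fun a _ => integrable_finsetSum _ fun b _ =>
      (hint a b).const_mul _
  have hzero : ∫ u : EuclideanSpace ℝ (Fin q), L (‖u‖ ^ 2 / 2) * P u ^ 2 = 0 := by
    simp_rw [hexp]
    rw [integral_finsetSum _ fun a _ => integrable_finsetSum _ fun b _ => (hint a b).const_mul _]
    refine Finset.sum_eq_zero fun a _ => ?_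
    rw [integral_finsetSum _ fun b _ => (hint a b).const_mul _]
    have h1 := congrFun hv a
    simp only [Matrix.mulVec, dotProduct, Matrix.of_apply, Pi.zero_apply] at h1
    calc _ = v a * ∑ b, gram q p L a b * v b := by
          rw [Finset.mul_sum]
          refine Finset.sum_congr rfl fun b _ => ?_
          rw [integral_const_mul, gram, kernelMoment]
          ring
      _ = 0 := by rw [h1, mul_zero]
  have hLc : Continuous fun u : EuclideanSpace ℝ (Fin q) => L (‖u‖ ^ 2 / 2) :=
    hL.continuous_comp (by fun_prop) fun u => by positivity
  have hae := (integral_eq_zero_iff_of_nonneg (fun u => mul_nonneg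
    (hL.nonneg _ (by positivity)) (sq_nonneg _)) hPint).mp hzero
  have heq := (Continuous.ae_eq_iff_eq volume (hLc.mul (hPc.pow 2)) continuous_zero).mp hae
  have hPz : ∀ u : EuclideanSpace ℝ (Fin q), L (‖u‖ ^ 2 / 2) ≠ 0 → P u = 0 := by
    intro u hu
    have h1 : L (‖u‖ ^ 2 / 2) * P u ^ 2 = 0 := congrFun heq u
    exact pow_eq_zero_iff two_ne_zero |>.mp ((mul_eq_zero.mp h1).resolve_left hu)
  obtain ⟨r, hr, hLr⟩ := hL.exists_pos
  set u0 : EuclideanSpace ℝ (Fin q) := EuclideanSpace.single ⟨0, hq⟩ √(2 * r) with hu0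
  have hLu0 : L (‖u0‖ ^ 2 / 2) ≠ 0 := by
    rw [hu0, PiLp.norm_single, Real.norm_of_nonneg (Real.sqrt_nonneg _),
      Real.sq_sqrt (by positivity), mul_div_cancel_left₀ _ two_ne_zero]
    exact hLr.ne'
  -- For p ≥ 2 the slope columns would be repeated and the Gram matrix singular; here each
  -- coordinate occurs at most once.
  have hsub : Subsingleton (Fin p) := by
    rcases hp with rfl | rfl <;> infer_instance
  have hPu : ∀ u, P u = v (Sum.inl ()) + ∑ k, ∑ j, v (Sum.inr (k, j)) * u j := by
    intro u
    simp [hP, regressor, Fintype.sum_sum_type, Fintype.sum_prod_type]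
  have hcoef : ∀ k j, v (Sum.inr (k, j)) = 0 := by
    intro k j
    have hev : ∀ᶠ t : ℝ in 𝓝[≠] 0,
        L (‖u0 + t • EuclideanSpace.single j (1 : ℝ)‖ ^ 2 / 2) ≠ 0 := by
      have hc : Continuous fun t : ℝ => L (‖u0 + t • EuclideanSpace.single j (1 : ℝ)‖ ^ 2 / 2) :=
        hLc.comp (by fun_prop : Continuous fun t : ℝ =>
          u0 + t • (EuclideanSpace.single j (1 : ℝ) : EuclideanSpace ℝ (Fin q)))
      have h1 : ∀ᶠ t : ℝ in 𝓝 0,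
          L (‖u0 + t • EuclideanSpace.single j (1 : ℝ)‖ ^ 2 / 2) ≠ 0 :=
        hc.continuousAt.eventually_ne (by simpa using hLu0)
      exact h1.filter_mono nhdsWithin_le_nhds
    -- Comparing P at u0 and at a small nonzero displacement along the j-th axis isolates the j-th
    -- slope.
    obtain ⟨t, ht, ht0⟩ := (hev.and self_mem_nhdsWithin).exists
    have h1 := hPz _ ht
    have h2 := hPz _ hLu0
    rw [hPu] at h1 h2
    have h3 : ∑ k, ∑ j', v (Sum.inr (k, j')) *
        (u0 + t • (EuclideanSpace.single j (1 : ℝ) : EuclideanSpace ℝ (Fin q))) j' =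
        (∑ k, ∑ j', v (Sum.inr (k, j')) * u0 j') + ∑ k, v (Sum.inr (k, j)) * t := by
      rw [← Finset.sum_add_distrib]
      refine Finset.sum_congr rfl fun k _ => ?_
      simp [mul_add, Finset.sum_add_distrib]
    rw [h3] at h1
    have h4 : ∑ k, v (Sum.inr (k, j)) * t = 0 := by linarith
    rw [Fintype.sum_subsingleton _ k] at h4
    exact (mul_eq_zero.mp h4).resolve_right ht0
  have hconst : v (Sum.inl ()) = 0 := by
    have h2 := hPz _ hLu0
    rw [hPu] at h2
    simpa [hcoef] using h2
  funext a
  rcases a with a | ⟨k, j⟩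
  · exact hconst
  · exact hcoef k j

end Moments

/-! ### Uniform smallness in probability and the weak law -/

section Negligible

variable {Ω ι : Type*} [MeasurableSpace Ω] {μ : Measure Ω} {S : Set ι} {A A' : ℕ → ι → Set Ω}

theorem UniformlyNegligible.of_le {b : ℕ → ℝ≥0∞} (hb : Tendsto b atTop (𝓝 0))
    (h : ∀ᶠ n in atTop, ∀ x ∈ S, μ (A n x) ≤ b n) : UniformlyNegligible μ S A :=
  tendsto_of_tendsto_of_tendsto_of_le_of_le' tendsto_const_nhds hb
    (Eventually.of_forall fun _ => zero_le) (h.mono fun _ hn => iSup₂_le hn)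

theorem UniformlyNegligible.mono (h : UniformlyNegligible μ S A)
    (hsub : ∀ᶠ n in atTop, ∀ x ∈ S, A' n x ⊆ A n x) : UniformlyNegligible μ S A' :=
  UniformlyNegligible.of_le h (hsub.mono fun n hn x hx =>
    (measure_mono (hn x hx)).trans (le_iSup₂ (f := fun x (_ : x ∈ S) => μ (A n x)) x hx))

theorem UniformlyNegligible.subset (h : UniformlyNegligible μ S A) {T : Set ι} (hT : T ⊆ S) :
    UniformlyNegligible μ T A :=
  UniformlyNegligible.of_le h (Eventually.of_forall fun n x hx =>
    le_iSup₂ (f := fun x (_ : x ∈ S) => μ (A n x)) x (hT hx))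

theorem UniformlyNegligible.union (h : UniformlyNegligible μ S A)
    (h' : UniformlyNegligible μ S A') : UniformlyNegligible μ S fun n x => A n x ∪ A' n x := by
  have hsum := Tendsto.add (show Tendsto _ _ _ from h) (show Tendsto _ _ _ from h')
  rw [add_zero] at hsum
  exact UniformlyNegligible.of_le hsum (Eventually.of_forall fun n x hx =>
    (measure_union_le _ _).trans (add_le_add
      (le_iSup₂ (f := fun x (_ : x ∈ S) => μ (A n x)) x hx)
      (le_iSup₂ (f := fun x (_ : x ∈ S) => μ (A' n x)) x hx)))

theorem UniformlyNegligible.iUnion {κ : Type*} [Fintype κ] {A : κ → ℕ → ι → Set Ω}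
    (h : ∀ k, UniformlyNegligible μ S (A k)) :
    UniformlyNegligible μ S fun n x => ⋃ k, A k n x := by
  have hsum := tendsto_finsetSum (s := (Finset.univ : Finset κ)) fun k _ =>
    (show Tendsto _ _ _ from h k)
  rw [Finset.sum_const_zero] at hsum
  exact UniformlyNegligible.of_le hsum (Eventually.of_forall fun n x hx =>
    (measure_iUnion_fintype_le _ _).trans (Finset.sum_le_sum fun k _ =>
      le_iSup₂ (f := fun x (_ : x ∈ S) => μ (A k n x)) x hx))

theorem UniformOP.add_deterministic {R R' : ℕ → ι → Ω → ℝ} (hR : UniformOP μ S R)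
    {d : ℕ → ι → ℝ} {e : ι → ℝ} (hd : TendstoUniformly d e atTop)
    (hR' : ∀ n x ω, R' n x ω = R n x ω + (d n x - e x)) : UniformOP μ S R' := by
  intro δ hδ
  refine (hR (δ / 2) (by positivity)).mono ?_
  filter_upwards [Metric.tendstoUniformly_iff.mp hd (δ / 2) (by positivity)] with n hn x _ ω hω
  have h1 := hn x
  rw [dist_comm, Real.dist_eq] at h1
  have h2 : δ ≤ |R' n x ω| := hω
  rw [hR'] at h2
  have h3 := abs_add_le (R n x ω) (d n x - e x)
  show δ / 2 ≤ |R n x ω|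
  linarith

/-- Weak law of large numbers for triangular arrays, uniformly in the index `x`. -/
theorem uniformOP_average [IsProbabilityMeasure μ] {E : Type*} [MeasurableSpace E]
    {Z : ℕ → Ω → E} (hindep : iIndepFun Z μ)
    (hident : ∀ i, IdentDistrib (Z i) (Z 0) μ μ) {φ : ℕ → ι → E → ℝ}
    (hφ : ∀ n x, Measurable (φ n x)) {w : ℕ → ℝ} (hw : ∀ n, 0 < w n)
    (hnw : Tendsto (fun n : ℕ => (n : ℝ) * w n) atTop atTop)
    (hmem : ∀ n x, MemLp (fun ω => φ n x (Z 0 ω)) 2 μ)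
    (hsq : ∃ C : ℝ, ∀ᶠ n in atTop, ∀ x, ∫ ω, φ n x (Z 0 ω) ^ 2 ∂μ ≤ C * w n) :
    UniformOP μ Set.univ fun n x ω => ((n : ℝ) * w n)⁻¹ * ∑ i : Fin n, φ n x (Z i ω) -
      (w n)⁻¹ * ∫ ω, φ n x (Z 0 ω) ∂μ := by
  obtain ⟨C, hC⟩ := hsq
  intro δ hδ
  -- The Chebyshev bound: variance at most n C w_n, divided by the squared threshold (δ n w_n)².
  have hlim : Tendsto (fun n : ℕ => ENNReal.ofReal (C / δ ^ 2 * ((n : ℝ) * w n)⁻¹)) atTop (𝓝 0) := by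
    have h1 := (tendsto_inv_atTop_zero.comp hnw).const_mul (C / δ ^ 2)
    rw [mul_zero] at h1
    simpa using ENNReal.tendsto_ofReal h1
  refine UniformlyNegligible.of_le hlim ?_
  filter_upwards [hC, eventually_gt_atTop 0] with n hn hn0 x _
  have hnpos : (0 : ℝ) < n := by exact_mod_cast hn0
  have hid : ∀ i : Fin n, IdentDistrib (fun ω => φ n x (Z i ω)) (fun ω => φ n x (Z 0 ω)) μ μ :=
    fun i => (hident i).comp (hφ n x)
  have hmemi : ∀ i : Fin n, MemLp (fun ω => φ n x (Z i ω)) 2 μ := fun i =>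
    (hid i).memLp_iff.mpr (hmem n x)
  set T : Ω → ℝ := ∑ i : Fin n, fun ω => φ n x (Z i ω) with hT
  have hTm : MemLp T 2 μ := memLp_finsetSum' _ fun i _ => hmemi i
  have hvar : variance T μ ≤ n * (C * w n) := by
    rw [hT, IndepFun.variance_sum (fun i _ => hmemi i)]
    · calc _ ≤ ∑ i : Fin n, C * w n := by
            refine Finset.sum_le_sum fun i _ => ?_
            rw [(hid i).variance_eq]
            exact (variance_le_expectation_sq (hmem n x).aestronglyMeasurable).trans (hn x)
        _ = _ := by simp
    · intro i _ j _ hij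
      have h1 := hindep.indepFun (i := (i : ℕ)) (j := (j : ℕ)) (fun h => hij (Fin.ext h))
      exact h1.comp (hφ n x) (hφ n x)
  have hmean : ∫ ω, T ω ∂μ = n * ∫ ω, φ n x (Z 0 ω) ∂μ := by
    simp only [hT, Finset.sum_apply]
    rw [integral_finsetSum _ fun i _ => (hmemi i).integrable one_le_two,
      Finset.sum_congr rfl fun i _ => (hid i).integral_eq]
    simp
  have hwn := hw n
  have hcheb := meas_ge_le_variance_div_sq hTm (c := δ * (n * w n)) (by positivity)
  refine (measure_mono fun ω hω => ?_).trans (hcheb.trans (ENNReal.ofReal_le_ofReal ?_))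
  · have h1 : δ ≤ |((n : ℝ) * w n)⁻¹ * ∑ i : Fin n, φ n x (Z i ω) -
      (w n)⁻¹ * ∫ ω, φ n x (Z 0 ω) ∂μ| := hω
    have h2 : ((n : ℝ) * w n)⁻¹ * ∑ i : Fin n, φ n x (Z i ω) -
      (w n)⁻¹ * ∫ ω, φ n x (Z 0 ω) ∂μ = (T ω - ∫ ω, T ω ∂μ) / (n * w n) := by
      rw [hmean, hT, Finset.sum_apply]
      field_simp
    rw [h2, abs_div, abs_of_pos (show 0 < (n : ℝ) * w n by positivity),
      le_div_iff₀ (by positivity)] at h1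
    exact h1
  · rw [div_le_iff₀ (by positivity)]
    refine hvar.trans (le_of_eq ?_)
    field_simp

end Negligible

/-! ### Continuity of the model functions -/

section Design

variable {q : ℕ}

theorem radialExt_coe (g : Sph q → ℝ) (x : Sph q) : radialExt g (x : Amb q) = g x := by
  have h : (x : Amb q) ≠ 0 := ne_zero_of_mem_unit_sphere x
  simp [radialExt, h]

theorem continuous_of_radialExt {g : Sph q → ℝ} {k : WithTop ℕ∞}
    (hg : ContDiffOn ℝ k (radialExt g) {0}ᶜ) : Continuous g := by
  have h := hg.continuousOn.comp_continuous (f := fun x : Sph q => (x : Amb q))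
    continuous_subtype_val fun x => ne_zero_of_mem_unit_sphere x
  exact h.congr fun x => radialExt_coe g x

theorem RegularNoise.continuous {σ : Sph q → ℝ} (hσ : RegularNoise σ) : Continuous σ := by
  have h : σ = fun x => √(σ x ^ 2) := funext fun x => (Real.sqrt_sq (hσ.nonneg x)).symm
  rw [h]
  exact hσ.uniformContinuous_sq.continuous.sqrt

end Design

/-! ### Moments of the response weighted by functions of the design -/

section Moments

variable {q : ℕ} {Ω : Type*} [MeasurableSpace Ω] {μ : Measure Ω}
  {m σ f : Sph q → ℝ} {X : Ω → Sph q} {Y ε : Ω → ℝ}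

theorem RegressionModel.integral_design (hM : RegressionModel μ m σ f X Y ε)
    (hf : Continuous f) (hf0 : ∀ x, 0 ≤ f x) {g : Sph q → ℝ} (hg : Continuous g) :
    ∫ ω, g (X ω) ∂μ = ∫ y, g y * f y ∂(surfaceMeasure q) := by
  rw [← integral_map hM.measurable_X.aemeasurable hg.aestronglyMeasurable, hM.density,
    integral_withDensity_eq_integral_toReal_smul hf.measurable.ennreal_ofReal
      (ae_of_all _ fun _ => ENNReal.ofReal_lt_top)]
  refine integral_congr_ae (ae_of_all _ fun y => ?_)
  simp only [smul_eq_mul]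
  rw [ENNReal.toReal_ofReal (hf0 y), mul_comm]

theorem integrable_pow_four_of_memLp {W : Ω → ℝ} (hW : MemLp W 4 μ) :
    Integrable (fun ω => W ω ^ 4) μ := by
  have h := hW.integrable_norm_pow (p := 4) (by norm_num)
  refine h.congr (ae_of_all _ fun ω => ?_)
  simp [Real.norm_eq_abs, Even.pow_abs (by decide : Even 4)]

variable [IsProbabilityMeasure μ]

theorem memLp_comp_design {r : ℝ≥0∞} (hX : Measurable X) {g : Sph q → ℝ} (hg : Continuous g) :
    MemLp (fun ω => g (X ω)) r μ := by
  obtain ⟨C, _, hC⟩ := exists_abs_le_of_continuous hg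
  exact MemLp.of_bound (hg.measurable.comp hX).aestronglyMeasurable C
    (ae_of_all _ fun ω => hC (X ω))

theorem memLp_comp_design_mul {r : ℝ≥0∞} (hX : Measurable X) {g : Sph q → ℝ}
    (hg : Continuous g) {W : Ω → ℝ} (hW : MemLp W r μ) :
    MemLp (fun ω => g (X ω) * W ω) r μ :=
  hW.mul' (memLp_comp_design (r := ⊤) hX hg)

theorem RegressionModel.memLp_response (hM : RegressionModel μ m σ f X Y ε)
    (hm : Continuous m) (hσ : Continuous σ) : MemLp Y 4 μ := by
  have h := (memLp_comp_design hM.measurable_X hm).add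
    (memLp_comp_design_mul hM.measurable_X hσ hM.memLp_noise)
  exact h.ae_eq (hM.model.mono fun ω hω => hω.symm)

theorem integrable_sq_of_memLp_four {W : Ω → ℝ} (hW : MemLp W 4 μ) :
    Integrable (fun ω => W ω ^ 2) μ :=
  (hW.mono_exponent (by norm_num : (2 : ℝ≥0∞) ≤ 4)).integrable_sq

/-- The tower property with g(X) pulled out; every conditional moment assumption on the noise enters
through it. -/
theorem integral_comp_mul_condExp (hX : Measurable X) {g : Sph q → ℝ} (hg : Continuous g)
    {W : Ω → ℝ} (hW : Integrable W μ) :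
    ∫ ω, g (X ω) * W ω ∂μ =
      ∫ ω, g (X ω) * (μ[W | MeasurableSpace.comap X inferInstance]) ω ∂μ := by
  have hgm : StronglyMeasurable[MeasurableSpace.comap X inferInstance] fun ω => g (X ω) :=
    hg.stronglyMeasurable.comp_measurable (comap_measurable X)
  have hint : Integrable ((fun ω => g (X ω)) * W) μ :=
    memLp_one_iff_integrable.mp (memLp_comp_design_mul hX hg (memLp_one_iff_integrable.mpr hW))
  have h1 := condExp_mul_of_stronglyMeasurable_left hgm hint hW
  have h2 := integral_condExp (μ := μ) (f := (fun ω => g (X ω)) * W) hX.comap_le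
  exact h2.symm.trans (integral_congr_ae h1)

theorem RegressionModel.integral_mul_noise (hM : RegressionModel μ m σ f X Y ε)
    {g : Sph q → ℝ} (hg : Continuous g) : ∫ ω, g (X ω) * ε ω ∂μ = 0 := by
  rw [integral_comp_mul_condExp hM.measurable_X hg (hM.memLp_noise.integrable (by norm_num)),
    integral_congr_ae (g := fun _ => (0 : ℝ)) (hM.condMean.mono fun ω hω => by simp [hω]),
    integral_zero]

theorem RegressionModel.integral_mul_noise_sq (hM : RegressionModel μ m σ f X Y ε)
    {g : Sph q → ℝ} (hg : Continuous g) :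
    ∫ ω, g (X ω) * ε ω ^ 2 ∂μ = ∫ ω, g (X ω) ∂μ := by
  rw [integral_comp_mul_condExp hM.measurable_X hg (integrable_sq_of_memLp_four hM.memLp_noise)]
  exact integral_congr_ae (hM.condSq.mono fun ω hω => by simp [hω])

theorem RegressionModel.exists_integral_mul_noise_four_le
    (hM : RegressionModel μ m σ f X Y ε) : ∃ C : ℝ, 0 ≤ C ∧ ∀ g : Sph q → ℝ, Continuous g →
      (∀ x, 0 ≤ g x) → ∫ ω, g (X ω) * ε ω ^ 4 ∂μ ≤ C * ∫ ω, g (X ω) ∂μ := by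
  obtain ⟨C, hC⟩ := hM.condFourth
  refine ⟨max C 0, le_max_right _ _, fun g hg hg0 => ?_⟩
  rw [integral_comp_mul_condExp hM.measurable_X hg (integrable_pow_four_of_memLp hM.memLp_noise),
    ← integral_const_mul]
  refine integral_mono_ae ?_ ?_ (hC.mono fun ω hω => ?_)
  · exact memLp_one_iff_integrable.mp (memLp_comp_design_mul hM.measurable_X hg
      (memLp_one_iff_integrable.mpr integrable_condExp))
  · exact (memLp_one_iff_integrable.mp (memLp_comp_design hM.measurable_X hg)).const_mul _
  · simp only
    rw [mul_comm (max C 0)]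
    exact mul_le_mul_of_nonneg_left (hω.trans (le_max_left _ _)) (hg0 _)

theorem RegressionModel.integral_mul_response (hM : RegressionModel μ m σ f X Y ε)
    (hm : Continuous m) (hσ : Continuous σ) {g : Sph q → ℝ} (hg : Continuous g) :
    ∫ ω, g (X ω) * Y ω ∂μ = ∫ ω, g (X ω) * m (X ω) ∂μ := by
  have hε := hM.memLp_noise.mono_exponent (by norm_num : (1 : ℝ≥0∞) ≤ 4)
  have h1 : ∫ ω, g (X ω) * Y ω ∂μ =
      ∫ ω, (g (X ω) * m (X ω) + (g (X ω) * σ (X ω)) * ε ω) ∂μ :=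
    integral_congr_ae (hM.model.mono fun ω hω => by simp only [hω]; ring)
  have hc : Continuous fun x => g x * σ x := hg.mul hσ
  have h2 := hM.integral_mul_noise hc
  rw [h1, integral_add, h2, add_zero]
  · exact memLp_one_iff_integrable.mp (memLp_comp_design hM.measurable_X (hg.mul hm))
  · exact memLp_one_iff_integrable.mp (memLp_comp_design_mul hM.measurable_X hc hε)

theorem RegressionModel.integral_mul_response_sq (hM : RegressionModel μ m σ f X Y ε)
    (hm : Continuous m) (hσ : Continuous σ) {g : Sph q → ℝ} (hg : Continuous g) :
    ∫ ω, g (X ω) * Y ω ^ 2 ∂μ = ∫ ω, g (X ω) * (m (X ω) ^ 2 + σ (X ω) ^ 2) ∂μ := by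
  have hε := hM.memLp_noise.mono_exponent (by norm_num : (1 : ℝ≥0∞) ≤ 4)
  have hε2 := memLp_one_iff_integrable.mpr (integrable_sq_of_memLp_four hM.memLp_noise)
  have hc1 : Continuous fun x => g x * m x ^ 2 := hg.mul (hm.pow 2)
  have hc2 : Continuous fun x => 2 * (g x * m x * σ x) := continuous_const.mul ((hg.mul hm).mul hσ)
  have hc3 : Continuous fun x => g x * σ x ^ 2 := hg.mul (hσ.pow 2)
  have i1 := memLp_one_iff_integrable.mp
    (memLp_comp_design (μ := μ) (r := 1) hM.measurable_X hc1)
  have i2 := memLp_one_iff_integrable.mp (memLp_comp_design_mul hM.measurable_X hc2 hε)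
  have i3 := memLp_one_iff_integrable.mp (memLp_comp_design_mul hM.measurable_X hc3 hε2)
  have i4 := memLp_one_iff_integrable.mp
    (memLp_comp_design (μ := μ) (r := 1) hM.measurable_X hc3)
  have h1 : ∫ ω, g (X ω) * Y ω ^ 2 ∂μ =
      ∫ ω, ((g (X ω) * m (X ω) ^ 2 + 2 * (g (X ω) * m (X ω) * σ (X ω)) * ε ω) +
        g (X ω) * σ (X ω) ^ 2 * ε ω ^ 2) ∂μ :=
    integral_congr_ae (hM.model.mono fun ω hω => by simp only [hω]; ring)
  have h2 := hM.integral_mul_noise hc2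
  have h3 := hM.integral_mul_noise_sq hc3
  have i12 : Integrable (fun ω => g (X ω) * m (X ω) ^ 2 +
      2 * (g (X ω) * m (X ω) * σ (X ω)) * ε ω) μ := i1.add i2
  rw [h1, integral_add i12 i3, integral_add i1 i2, h2, h3, add_zero, ← integral_add i1 i4]
  exact integral_congr_ae (ae_of_all _ fun ω => by ring)

theorem RegressionModel.exists_integral_mul_response_four_le
    (hM : RegressionModel μ m σ f X Y ε) (hm : Continuous m) (hσ : Continuous σ) :
    ∃ C : ℝ, 0 ≤ C ∧ ∀ g : Sph q → ℝ, Continuous g → (∀ x, 0 ≤ g x) →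
      ∫ ω, g (X ω) * Y ω ^ 4 ∂μ ≤ C * ∫ ω, g (X ω) ∂μ := by
  obtain ⟨C, hC, hCe⟩ := hM.exists_integral_mul_noise_four_le
  obtain ⟨D, hD, hmD⟩ := exists_abs_le_of_continuous hm
  obtain ⟨E, hE, hσE⟩ := exists_abs_le_of_continuous hσ
  -- The factor 8 = 2³ comes from (a + b)⁴ ≤ 8 (a⁴ + b⁴); D and E bound |m| and |σ|.
  refine ⟨8 * (D ^ 4 + E ^ 4 * C), by positivity, fun g hg hg0 => ?_⟩
  have i1 := memLp_one_iff_integrable.mp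
    (memLp_comp_design (μ := μ) (r := 1) hM.measurable_X hg)
  have i2 := memLp_one_iff_integrable.mp (memLp_comp_design_mul hM.measurable_X hg
    (memLp_one_iff_integrable.mpr (integrable_pow_four_of_memLp hM.memLp_noise)))
  have i3 := memLp_one_iff_integrable.mp (memLp_comp_design_mul hM.measurable_X hg
    (memLp_one_iff_integrable.mpr (integrable_pow_four_of_memLp (hM.memLp_response hm hσ))))
  calc ∫ ω, g (X ω) * Y ω ^ 4 ∂μ
      ≤ ∫ ω, (8 * D ^ 4 * g (X ω) + 8 * E ^ 4 * (g (X ω) * ε ω ^ 4)) ∂μ := by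
        refine integral_mono_ae i3 ((i1.const_mul _).add (i2.const_mul _))
          (hM.model.mono fun ω hω => ?_)
        simp only
        have h1 : m (X ω) ^ 4 ≤ D ^ 4 := by
          rw [← Even.pow_abs (by decide : Even 4)]
          exact pow_le_pow_left₀ (abs_nonneg _) (hmD _) 4
        have h2 : σ (X ω) ^ 4 ≤ E ^ 4 := by
          rw [← Even.pow_abs (by decide : Even 4)]
          exact pow_le_pow_left₀ (abs_nonneg _) (hσE _) 4
        have h3 : Y ω ^ 4 ≤ 8 * (m (X ω) ^ 4 + (σ (X ω) * ε ω) ^ 4) := by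
          rw [hω]
          have h5 := Even.add_pow_le (by decide : Even 4) (a := m (X ω)) (b := σ (X ω) * ε ω)
          norm_num at h5
          exact h5
        have h4 : (σ (X ω) * ε ω) ^ 4 ≤ E ^ 4 * ε ω ^ 4 := by
          rw [mul_pow]
          exact mul_le_mul_of_nonneg_right h2 (by positivity)
        have h5 := hg0 (X ω)
        calc g (X ω) * Y ω ^ 4 ≤ g (X ω) * (8 * (D ^ 4 + E ^ 4 * ε ω ^ 4)) :=
              mul_le_mul_of_nonneg_left (by linarith) h5
          _ = _ := by ring
    _ = 8 * D ^ 4 * ∫ ω, g (X ω) ∂μ + 8 * E ^ 4 * ∫ ω, g (X ω) * ε ω ^ 4 ∂μ := by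
        rw [integral_add (i1.const_mul _) (i2.const_mul _), integral_const_mul,
          integral_const_mul]
    _ ≤ 8 * D ^ 4 * ∫ ω, g (X ω) ∂μ + 8 * E ^ 4 * (C * ∫ ω, g (X ω) ∂μ) := by
        have := hCe g hg hg0
        gcongr
    _ = _ := by ring

end Moments

/-! ### Laws of large numbers for local averages -/

section LocalAverages

variable {q : ℕ} {Ω : Type*} [MeasurableSpace Ω]

/-- The kernel weight of `y` in a local average at `x`. -/
def localKernel (L : ℝ → ℝ) (ψ : EuclideanSpace ℝ (Fin q) → ℝ) (h : ℝ) (x : Sph q)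
    (B : Matrix (Fin (q + 1)) (Fin q) ℝ) (y : Sph q) : ℝ :=
  L ((1 - inner ℝ (x : Amb q) (y : Amb q)) / h ^ 2) * ψ (h⁻¹ • tangentCoord B (y : Amb q))

theorem continuous_localKernel {L : ℝ → ℝ} (hL : IsDirectionalKernel L)
    {ψ : EuclideanSpace ℝ (Fin q) → ℝ} (hψ : ModerateGrowth ψ) (h : ℝ) (x : Sph q)
    (B : Matrix (Fin (q + 1)) (Fin q) ℝ) : Continuous (localKernel L ψ h x B) :=
  continuous_localIntegrand hL hψ.continuous h x B

/-- The sampling scheme: an i.i.d. sample from a regression model with continuous regression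
function, noise level and design density, a kernel, a bandwidth sequence and a choice of frames. -/
structure SamplingScheme (μ : Measure Ω) (m σ f : Sph q → ℝ) (L : ℝ → ℝ) (h : ℕ → ℝ)
    (X : ℕ → Ω → Sph q) (Y ε : ℕ → Ω → ℝ) (B : Sph q → Matrix (Fin (q + 1)) (Fin q) ℝ) :
    Prop where
  one_le : 1 ≤ q
  frame : ∀ x, IsProjectionMatrix x (B x)
  model : ∀ i, RegressionModel μ m σ f (X i) (Y i) (ε i)
  indep : iIndepFun (fun i ω => (X i ω, Y i ω)) μ
  ident : ∀ i, IdentDistrib (fun ω => (X i ω, Y i ω)) (fun ω => (X 0 ω, Y 0 ω)) μ μ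
  continuous_m : Continuous m
  continuous_σ : Continuous σ
  continuous_f : Continuous f
  f_lower : ∃ c : ℝ, 0 < c ∧ ∀ x, c ≤ f x
  σ_lower : ∃ c : ℝ, 0 < c ∧ ∀ x, c ≤ σ x ^ 2
  kernel : IsDirectionalKernel L
  bandwidth : IsBandwidth q h

variable {μ : Measure Ω} {m σ f : Sph q → ℝ} {L : ℝ → ℝ} {h : ℕ → ℝ}
  {X : ℕ → Ω → Sph q} {Y ε : ℕ → Ω → ℝ} {B : Sph q → Matrix (Fin (q + 1)) (Fin q) ℝ}

/-- The normalised average of `W (Y_i)` with local weights. -/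
def localAverage (L : ℝ → ℝ) (ψ : EuclideanSpace ℝ (Fin q) → ℝ) (W : ℝ → ℝ) (h : ℕ → ℝ)
    (X : ℕ → Ω → Sph q) (Y : ℕ → Ω → ℝ) (B : Sph q → Matrix (Fin (q + 1)) (Fin q) ℝ)
    (n : ℕ) (x : Sph q) (ω : Ω) : ℝ :=
  ((n : ℝ) * h n ^ q)⁻¹ * ∑ i : Fin n, localKernel L ψ (h n) x (B x) (X i ω) * W (Y i ω)

namespace SamplingScheme

theorem f_nonneg (H : SamplingScheme μ m σ f L h X Y ε B) (x : Sph q) : 0 ≤ f x := by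
  obtain ⟨c, hc, h⟩ := H.f_lower
  exact hc.le.trans (h x)

theorem integral_localKernel (H : SamplingScheme μ m σ f L h X Y ε B)
    {ψ : EuclideanSpace ℝ (Fin q) → ℝ} (hψ : ModerateGrowth ψ) {G : Sph q → ℝ} (hG : Continuous G)
    (n : ℕ) (x : Sph q) :
    ∫ ω, localKernel L ψ (h n) x (B x) (X 0 ω) * G (X 0 ω) ∂μ =
      localIntegral L ψ (fun y => G y * f y) (h n) x (B x) := by
  have hc : Continuous fun y => localKernel L ψ (h n) x (B x) y * G y :=
    (continuous_localKernel H.kernel hψ _ _ _).mul hG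
  rw [(H.model 0).integral_design H.continuous_f H.f_nonneg hc]
  simp only [localIntegral, localKernel, mul_assoc]

/-- The square of a local kernel is the local kernel of L² and ψ², so its mean is of order h^q. This
is the second moment bound that the weak law requires with w_n = h_n^q. -/
theorem exists_integral_localKernel_sq_le (H : SamplingScheme μ m σ f L h X Y ε B)
    {ψ : EuclideanSpace ℝ (Fin q) → ℝ} (hψ : ModerateGrowth ψ) {G : Sph q → ℝ}
    (hG : Continuous G) :
    ∃ C : ℝ, ∀ᶠ n in atTop, ∀ x,
      ∫ ω, localKernel L ψ (h n) x (B x) (X 0 ω) ^ 2 * G (X 0 ω) ∂μ ≤ C * h n ^ q := by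
  obtain ⟨C, hC⟩ := eventually_localIntegral_le H.kernel.sq (hψ.mul hψ) (hG.mul H.continuous_f)
    H.bandwidth.pos H.bandwidth.tendsto_zero B H.frame
  refine ⟨C, hC.mono fun n hn x => ?_⟩
  have hc : Continuous fun y => localKernel L ψ (h n) x (B x) y ^ 2 * G y :=
    ((continuous_localKernel H.kernel hψ _ _ _).pow 2).mul hG
  rw [(H.model 0).integral_design H.continuous_f H.f_nonneg hc]
  refine (le_of_eq ?_).trans (hn x)
  refine integral_congr_ae (ae_of_all _ fun y => ?_)
  simp only [localKernel, Pi.mul_apply]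
  ring

variable [IsProbabilityMeasure μ]

/-- Law of large numbers for local averages, centred at their means. -/
theorem uniformOP_localAverage_sub_mean (H : SamplingScheme μ m σ f L h X Y ε B)
    {ψ : EuclideanSpace ℝ (Fin q) → ℝ} (hψ : ModerateGrowth ψ) {W : ℝ → ℝ} (hW : Measurable W)
    {G : Sph q → ℝ} (hG : Continuous G)
    (hmem : MemLp (fun ω => W (Y 0 ω)) 2 μ)
    (hsq : ∀ g : Sph q → ℝ, Continuous g →
      ∫ ω, g (X 0 ω) * W (Y 0 ω) ^ 2 ∂μ = ∫ ω, g (X 0 ω) * G (X 0 ω) ∂μ) :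
    UniformOP μ Set.univ fun n x ω => localAverage L ψ W h X Y B n x ω -
      (h n ^ q)⁻¹ * ∫ ω, localKernel L ψ (h n) x (B x) (X 0 ω) * W (Y 0 ω) ∂μ := by
  have hK : ∀ n x, Continuous (localKernel L ψ (h n) x (B x)) := fun n x =>
    continuous_localKernel H.kernel hψ _ _ _
  refine uniformOP_average (Z := fun i ω => (X i ω, Y i ω)) H.indep H.ident
    (φ := fun n x z => localKernel L ψ (h n) x (B x) z.1 * W z.2) (fun n x => ?_)
    (fun n => pow_pos (H.bandwidth.pos n) q) H.bandwidth.tendsto_mul (fun n x => ?_) ?_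
  · exact ((hK n x).measurable.comp measurable_fst).mul (hW.comp measurable_snd)
  · exact memLp_comp_design_mul (H.model 0).measurable_X (hK n x) hmem
  · obtain ⟨C, hC⟩ := H.exists_integral_localKernel_sq_le hψ hG
    refine ⟨C, hC.mono fun n hn x => ?_⟩
    refine (le_of_eq ?_).trans (hn x)
    have hc : Continuous fun y => localKernel L ψ (h n) x (B x) y ^ 2 := (hK n x).pow 2
    rw [← hsq _ hc]
    exact integral_congr_ae (ae_of_all _ fun ω => mul_pow _ _ _)

theorem uniformOP_localAverage_one (H : SamplingScheme μ m σ f L h X Y ε B)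
    {ψ : EuclideanSpace ℝ (Fin q) → ℝ} (hψ : ModerateGrowth ψ) :
    UniformOP μ Set.univ fun n x ω => localAverage L ψ (fun _ => 1) h X Y B n x ω -
      f x * kernelMoment L ψ := by
  have h1 := H.uniformOP_localAverage_sub_mean hψ (W := fun _ => 1) measurable_const
    (G := fun _ => 1) continuous_const (memLp_const 1) (fun g _ => by simp)
  have h2 := tendstoUniformly_localIntegral H.kernel hψ H.continuous_f H.bandwidth.pos
    H.bandwidth.tendsto_zero B H.frame
  refine h1.add_deterministic h2 fun n x ω => ?_
  rw [H.integral_localKernel hψ (G := fun _ => 1) continuous_const]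
  simp only [one_mul]
  ring

theorem memLp_response (H : SamplingScheme μ m σ f L h X Y ε B) : MemLp (Y 0) 4 μ :=
  (H.model 0).memLp_response H.continuous_m H.continuous_σ

theorem uniformOP_localAverage_id (H : SamplingScheme μ m σ f L h X Y ε B)
    {ψ : EuclideanSpace ℝ (Fin q) → ℝ} (hψ : ModerateGrowth ψ) :
    UniformOP μ Set.univ fun n x ω => localAverage L ψ (fun t => t) h X Y B n x ω -
      m x * f x * kernelMoment L ψ := by
  have h1 := H.uniformOP_localAverage_sub_mean hψ (W := fun t => t) measurable_id
    (G := fun x => m x ^ 2 + σ x ^ 2) ((H.continuous_m.pow 2).add (H.continuous_σ.pow 2))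
    (H.memLp_response.mono_exponent (by norm_num))
    (fun g hg => (H.model 0).integral_mul_response_sq H.continuous_m H.continuous_σ hg)
  have h2 := tendstoUniformly_localIntegral H.kernel hψ (H.continuous_m.mul H.continuous_f)
    H.bandwidth.pos H.bandwidth.tendsto_zero B H.frame
  refine h1.add_deterministic h2 fun n x ω => ?_
  rw [(H.model 0).integral_mul_response H.continuous_m H.continuous_σ
    (continuous_localKernel H.kernel hψ _ _ _), H.integral_localKernel hψ H.continuous_m]
  simp only [Pi.mul_def]
  ring

/-- With s = |t|/κ this is s(1 - s²) ≤ 1 multiplied by |t|. Its use is to bound a weighted mean of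
|Y| below by second and fourth moments; being linear in the moments, it replaces an interpolation by
Hölder's inequality. -/
theorem sq_div_sub_le_abs {κ : ℝ} (hκ : 0 < κ) (t : ℝ) : t ^ 2 / κ - t ^ 4 / κ ^ 3 ≤ |t| := by
  have h1 : t ^ 2 / κ - t ^ 4 / κ ^ 3 = |t| * ((|t| / κ) * (1 - (|t| / κ) ^ 2)) := by
    have h2 : t ^ 4 = |t| ^ 4 := (Even.pow_abs (by decide) t).symm
    rw [← sq_abs t, h2]
    field_simp
  rw [h1]
  refine mul_le_of_le_one_right (abs_nonneg _) ?_
  have hs : 0 ≤ |t| / κ := by positivity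
  generalize |t| / κ = s at hs
  nlinarith [sq_nonneg (s - 1), mul_nonneg hs (sq_nonneg s), sq_nonneg s]

/-- The mean of the local average of `|Y_i|` is bounded below. -/
theorem exists_le_integral_abs_response (H : SamplingScheme μ m σ f L h X Y ε B) :
    ∃ c : ℝ, 0 < c ∧ ∀ᶠ n in atTop, ∀ x, c ≤
      (h n ^ q)⁻¹ * ∫ ω, localKernel L (fun _ => 1) (h n) x (B x) (X 0 ω) * |Y 0 ω| ∂μ := by
  have hψ : ModerateGrowth (fun _ : EuclideanSpace ℝ (Fin q) => (1 : ℝ)) := ModerateGrowth.const 1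
  obtain ⟨C, hC, hfour⟩ := (H.model 0).exists_integral_mul_response_four_le H.continuous_m
    H.continuous_σ
  obtain ⟨s, hs, hσs⟩ := H.σ_lower
  obtain ⟨d, hd, hfd⟩ := H.f_lower
  have hlam : 0 < kernelMass q L := kernelMass_pos H.one_le H.kernel
  -- Chosen so that the fourth moment term, at most C/κ³ times the mean of K, takes at most half of
  -- the second moment term, at least s/κ times that mean. Using C + 1 keeps κ positive when C = 0.
  set κ : ℝ := √(2 * (C + 1) / s) with hκdef
  have hκ : 0 < κ := Real.sqrt_pos.mpr (by positivity)
  have hκ2 : κ ^ 2 = 2 * (C + 1) / s := Real.sq_sqrt (by positivity)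
  -- The normalised mean of K tends to f(x) λ_q(L) ≥ d λ_q(L), so half of that bound holds
  -- eventually for all x.
  refine ⟨s / (2 * κ) * (d * kernelMass q L / 2), by positivity, ?_⟩
  have hunif := Metric.tendstoUniformly_iff.mp (tendstoUniformly_localIntegral H.kernel hψ
    H.continuous_f H.bandwidth.pos H.bandwidth.tendsto_zero B H.frame)
    (d * kernelMass q L / 2) (by positivity)
  filter_upwards [hunif] with n hn x
  have hpos : 0 < h n ^ q := pow_pos (H.bandwidth.pos n) q
  set K := localKernel L (fun _ => 1) (h n) x (B x) with hK
  have hKc : Continuous K := continuous_localKernel H.kernel hψ _ _ _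
  have hK0 : ∀ y, 0 ≤ K y := fun y => by
    have := H.kernel.nonneg _ (div_nonneg (one_sub_inner_nonneg x y) (sq_nonneg (h n)))
    simpa [hK, localKernel] using this
  have hY := H.memLp_response
  have hXm := (H.model 0).measurable_X
  have i2 := memLp_one_iff_integrable.mp (memLp_comp_design_mul (μ := μ) hXm hKc
    (memLp_one_iff_integrable.mpr (integrable_sq_of_memLp_four hY)))
  have i4 := memLp_one_iff_integrable.mp (memLp_comp_design_mul (μ := μ) hXm hKc
    (memLp_one_iff_integrable.mpr (integrable_pow_four_of_memLp hY)))
  have i1 := memLp_one_iff_integrable.mp (memLp_comp_design_mul (μ := μ) hXm hKc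
    (hY.mono_exponent (by norm_num : (1 : ℝ≥0∞) ≤ 4)).abs)
  have iK := memLp_one_iff_integrable.mp (memLp_comp_design (μ := μ) (r := 1) hXm hKc)
  have iG := memLp_one_iff_integrable.mp (memLp_comp_design (μ := μ) (r := 1) hXm
    (hKc.mul ((H.continuous_m.pow 2).add (H.continuous_σ.pow 2))))
  have hmean : d * kernelMass q L / 2 ≤ (h n ^ q)⁻¹ * ∫ ω, K (X 0 ω) ∂μ := by
    have h1 := hn x
    have h2 := H.integral_localKernel hψ (G := fun _ => 1) continuous_const n x
    simp only [mul_one, one_mul] at h2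
    rw [dist_comm, Real.dist_eq, kernelMoment_one H.one_le, ← h2] at h1
    have h3 : d * kernelMass q L ≤ f x * kernelMass q L :=
      mul_le_mul_of_nonneg_right (hfd x) hlam.le
    have h4 := (abs_lt.mp h1).1
    linarith
  have hsecond : s * ∫ ω, K (X 0 ω) ∂μ ≤ ∫ ω, K (X 0 ω) * Y 0 ω ^ 2 ∂μ := by
    rw [(H.model 0).integral_mul_response_sq H.continuous_m H.continuous_σ hKc,
      ← integral_const_mul]
    refine integral_mono (iK.const_mul s) iG fun ω => ?_
    have h1 := hσs (X 0 ω)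
    have h2 := hK0 (X 0 ω)
    show s * K (X 0 ω) ≤ K (X 0 ω) * (m (X 0 ω) ^ 2 + σ (X 0 ω) ^ 2)
    nlinarith [sq_nonneg (m (X 0 ω))]
  have hfourth := hfour K hKc hK0
  have hEK : 0 ≤ ∫ ω, K (X 0 ω) ∂μ := integral_nonneg fun ω => hK0 _
  have habs : (∫ ω, K (X 0 ω) * Y 0 ω ^ 2 ∂μ) / κ - (∫ ω, K (X 0 ω) * Y 0 ω ^ 4 ∂μ) / κ ^ 3 ≤
      ∫ ω, K (X 0 ω) * |Y 0 ω| ∂μ := by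
    rw [← integral_div, ← integral_div, ← integral_sub (i2.div_const _) (i4.div_const _)]
    refine integral_mono ((i2.div_const _).sub (i4.div_const _)) i1 fun ω => ?_
    have h1 := mul_le_mul_of_nonneg_left (sq_div_sub_le_abs hκ (Y 0 ω)) (hK0 (X 0 ω))
    refine (le_of_eq ?_).trans h1
    ring
  have hkey : s / (2 * κ) * ∫ ω, K (X 0 ω) ∂μ ≤ ∫ ω, K (X 0 ω) * |Y 0 ω| ∂μ := by
    refine le_trans ?_ habs
    have h1 : (∫ ω, K (X 0 ω) * Y 0 ω ^ 4 ∂μ) / κ ^ 3 ≤ s / (2 * κ) * ∫ ω, K (X 0 ω) ∂μ := by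
      have h2 : κ ^ 3 = κ * (2 * (C + 1) / s) := by rw [← hκ2]; ring
      rw [div_le_iff₀ (by positivity), h2]
      have h3 : s / (2 * κ) * (∫ ω, K (X 0 ω) ∂μ) * (κ * (2 * (C + 1) / s)) =
          (C + 1) * ∫ ω, K (X 0 ω) ∂μ := by field_simp
      rw [h3]
      linarith
    have h4 : s / κ * ∫ ω, K (X 0 ω) ∂μ ≤ (∫ ω, K (X 0 ω) * Y 0 ω ^ 2 ∂μ) / κ := by
      rw [div_mul_eq_mul_div]
      gcongr
    have h5 : s / κ * ∫ ω, K (X 0 ω) ∂μ = s / (2 * κ) * (∫ ω, K (X 0 ω) ∂μ) +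
        s / (2 * κ) * ∫ ω, K (X 0 ω) ∂μ := by
      field_simp; ring
    linarith
  calc s / (2 * κ) * (d * kernelMass q L / 2)
      ≤ s / (2 * κ) * ((h n ^ q)⁻¹ * ∫ ω, K (X 0 ω) ∂μ) := by gcongr
    _ = (h n ^ q)⁻¹ * (s / (2 * κ) * ∫ ω, K (X 0 ω) ∂μ) := by ring
    _ ≤ _ := by gcongr

/-- Local averages of `|Y_i|` are bounded away from zero with probability tending to one. -/
theorem exists_localAverage_abs_lower (H : SamplingScheme μ m σ f L h X Y ε B) :
    ∃ c : ℝ, 0 < c ∧ UniformlyNegligible μ Set.univ fun n x =>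
      {ω | localAverage L (fun _ => 1) (fun t => |t|) h X Y B n x ω < c} := by
  obtain ⟨c, hc, hlow⟩ := H.exists_le_integral_abs_response
  have h1 := H.uniformOP_localAverage_sub_mean (ModerateGrowth.const 1) (W := fun t => |t|)
    (by fun_prop)
    (G := fun x => m x ^ 2 + σ x ^ 2) ((H.continuous_m.pow 2).add (H.continuous_σ.pow 2))
    (H.memLp_response.mono_exponent (by norm_num)).abs
    (fun g hg => by
      simp only [sq_abs]
      exact (H.model 0).integral_mul_response_sq H.continuous_m H.continuous_σ hg)
  refine ⟨c / 2, by positivity, (h1 (c / 2) (by positivity)).mono ?_⟩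
  filter_upwards [hlow] with n hn x _ ω hω
  have h2 := hn x
  have h3 : localAverage L (fun _ => 1) (fun t => |t|) h X Y B n x ω < c / 2 := hω
  rw [Set.mem_ofPred_eq, abs_sub_comm]
  exact le_trans (by linarith) (le_abs_self _)

end SamplingScheme

end LocalAverages

/-! ### The matrix inverse as a function of the entries -/

section MatrixInverse

variable {κ : Type*} [Fintype κ] [DecidableEq κ]

/-- Cramer's rule, valid also for singular N because 0⁻¹ = 0 matches the convention N⁻¹ = 0.
Measurability of the inverse therefore needs no case distinction. -/
theorem matrix_inv_apply (N : Matrix κ κ ℝ) (a b : κ) :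
    N⁻¹ a b = N.det⁻¹ * N.adjugate a b := by
  rw [Matrix.inv_def, Ring.inverse_eq_inv', Matrix.smul_apply, smul_eq_mul]

theorem measurable_det {Ω : Type*} [MeasurableSpace Ω] {N : Ω → Matrix κ κ ℝ}
    (hN : ∀ a b, Measurable fun ω => N ω a b) : Measurable fun ω => (N ω).det := by
  simp only [Matrix.det_apply]
  exact Finset.measurable_fun_sum _ fun s _ =>
    (Finset.measurable_fun_prod _ fun i _ => hN _ _).const_smul _

theorem measurable_matrix_inv {Ω : Type*} [MeasurableSpace Ω] {N : Ω → Matrix κ κ ℝ}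
    (hN : ∀ a b, Measurable fun ω => N ω a b) (a b : κ) : Measurable fun ω => (N ω)⁻¹ a b := by
  simp only [matrix_inv_apply]
  refine (measurable_det hN).inv.mul ?_
  simp only [Matrix.adjugate_apply]
  refine measurable_det fun c d => ?_
  simp only [Matrix.updateRow_apply]
  split_ifs
  · exact measurable_const
  · exact hN _ _

theorem continuousAt_inv_mulVec {α : Type*} [TopologicalSpace α] {N : α → Matrix κ κ ℝ}
    {T : α → κ → ℝ} (hN : Continuous N) (hT : Continuous T) {z : α} (hz : (N z).det ≠ 0) (a : κ) :
    ContinuousAt (fun z => ((N z)⁻¹ *ᵥ T z) a) z := by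
  simp only [Matrix.mulVec, dotProduct, matrix_inv_apply]
  refine tendsto_finsetSum _ fun b _ => ?_
  refine ContinuousAt.mul (ContinuousAt.mul (ContinuousAt.inv₀ ?_ hz) ?_) ?_
  · exact hN.matrix_det.continuousAt
  · exact (hN.matrix_adjugate.matrix_elem a b).continuousAt
  · exact ((continuous_apply b).comp hT).continuousAt

end MatrixInverse

/-! ### The estimator in rescaled form -/

section Estimator

variable {q n p : ℕ}

/-- The scaling between the columns of the design matrix and the regressors. -/
def columnScale (p q : ℕ) (h : ℝ) (a : Unit ⊕ (Fin p × Fin q)) : ℝ :=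
  Sum.elim (fun _ => 1) (fun _ => h) a

theorem columnScale_ne_zero {h : ℝ} (hh : h ≠ 0) (a : Unit ⊕ (Fin p × Fin q)) :
    columnScale p q h a ≠ 0 := by
  rcases a with a | a
  · exact one_ne_zero
  · exact hh

/-- Since Bᵀx = 0, centring at x has no effect on the tangential coordinates, and each slope entry
is h times the rescaled coordinate. -/
theorem designMatrix_apply {x : Sph q} {B : Matrix (Fin (q + 1)) (Fin q) ℝ}
    (hB : IsProjectionMatrix x B) {h : ℝ} (hh : h ≠ 0) (X : Fin n → Sph q) (i : Fin n)
    (a : Unit ⊕ (Fin p × Fin q)) :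
    designMatrix p B x X i a =
      columnScale p q h a * regressor p a (h⁻¹ • tangentCoord B (X i : Amb q)) := by
  rcases a with a | ⟨k, j⟩
  · simp [designMatrix, columnScale, regressor]
  · have h1 : (Bᵀ *ᵥ WithLp.ofLp ((X i : Amb q) - (x : Amb q))) j =
        tangentCoord B (X i : Amb q) j := by
      have h2 := congrArg (fun v => v j) hB.tangentCoord_self
      simp only [tangentCoord, PiLp.zero_apply] at h2
      rw [WithLp.ofLp_sub, Matrix.mulVec_sub, Pi.sub_apply, h2, sub_zero]
      rfl
    have h3 : designMatrix p B x X i (Sum.inr (k, j)) =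
        (Bᵀ *ᵥ WithLp.ofLp ((X i : Amb q) - (x : Amb q))) j := rfl
    rw [h3, h1]
    simp [columnScale, regressor, hh]

/-- The rescaled normal matrix. -/
def scaledNormal (p : ℕ) (L : ℝ → ℝ) (h : ℝ) (B : Matrix (Fin (q + 1)) (Fin q) ℝ) (x : Sph q)
    (X : Fin n → Sph q) : Matrix (Unit ⊕ (Fin p × Fin q)) (Unit ⊕ (Fin p × Fin q)) ℝ :=
  Matrix.of fun a b => ((n : ℝ) * h ^ q)⁻¹ *
    ∑ i, localKernel L (fun u => regressor p a u * regressor p b u) h x B (X i)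

/-- The rescaled vector of local moments of the responses. -/
def scaledMoment (p : ℕ) (L : ℝ → ℝ) (h : ℝ) (B : Matrix (Fin (q + 1)) (Fin q) ℝ) (x : Sph q)
    (X : Fin n → Sph q) (Y : Fin n → ℝ) (a : Unit ⊕ (Fin p × Fin q)) : ℝ :=
  ((n : ℝ) * h ^ q)⁻¹ * ∑ i, localKernel L (regressor p a) h x B (X i) * Y i

variable {L : ℝ → ℝ} {h : ℝ} {x : Sph q} {B : Matrix (Fin (q + 1)) (Fin q) ℝ}

theorem normalMatrix_eq (hB : IsProjectionMatrix x B) (hh : 0 < h) (hn : n ≠ 0)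
    (X : Fin n → Sph q) :
    normalMatrix p L h B x X =
      Matrix.diagonal (fun a => (n / kernelMassAt q L h) * columnScale p q h a) *
        scaledNormal p L h B x X * Matrix.diagonal (columnScale p q h) := by
  have hn' : (n : ℝ) ≠ 0 := by exact_mod_cast hn
  ext a b
  rw [Matrix.mul_diagonal, Matrix.diagonal_mul, normalMatrix, weightMatrix, Matrix.mul_apply]
  simp only [Matrix.mul_diagonal, Matrix.transpose_apply, designMatrix_apply hB hh.ne',
    scaledNormal, Matrix.of_apply, Finset.mul_sum, Finset.sum_mul]
  refine Finset.sum_congr rfl fun i _ => ?_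
  simp only [dirKernel, localKernel, mul_inv]
  field_simp

theorem designMatrix_weight_mulVec_eq (hB : IsProjectionMatrix x B) (hh : 0 < h) (hn : n ≠ 0)
    (X : Fin n → Sph q) (Y : Fin n → ℝ) :
    ((designMatrix p B x X)ᵀ * weightMatrix L h x X) *ᵥ Y =
      Matrix.diagonal (fun a => (n / kernelMassAt q L h) * columnScale p q h a) *ᵥ
        scaledMoment p L h B x X Y := by
  have hn' : (n : ℝ) ≠ 0 := by exact_mod_cast hn
  ext a
  rw [Matrix.mulVec_diagonal, Matrix.mulVec, dotProduct, weightMatrix]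
  simp only [Matrix.mul_diagonal, Matrix.transpose_apply, designMatrix_apply hB hh.ne',
    scaledMoment, Finset.mul_sum]
  refine Finset.sum_congr rfl fun i _ => ?_
  simp only [dirKernel, localKernel, mul_inv]
  field_simp

/-- The left diagonal factor, which carries λ_{h,q}(L), is common to the normal matrix and the
moment vector and cancels. The right factor leaves its inverse in front, whose intercept entry is 1.
The identity also holds when the rescaled matrix is singular. -/
theorem localEstimator_eq (hB : IsProjectionMatrix x B) (hh : 0 < h) (hn : n ≠ 0)
    (hc : kernelMassAt q L h ≠ 0) (X : Fin n → Sph q) (Y : Fin n → ℝ) :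
    localEstimator p L h B x X Y =
      ((scaledNormal p L h B x X)⁻¹ *ᵥ scaledMoment p L h B x X Y) (Sum.inl ()) := by
  have hn' : (n : ℝ) ≠ 0 := by exact_mod_cast hn
  have hD : IsUnit (Matrix.diagonal
      (fun a => (n / kernelMassAt q L h) * columnScale p q h a)).det := by
    rw [Matrix.det_diagonal, isUnit_iff_ne_zero]
    exact Finset.prod_ne_zero_iff.mpr fun a _ =>
      mul_ne_zero (div_ne_zero hn' hc) (columnScale_ne_zero hh.ne' a)
  have hS : (Matrix.diagonal (columnScale p q h))⁻¹ =
      Matrix.diagonal (fun a => (columnScale p q h a)⁻¹) := by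
    refine Matrix.inv_eq_right_inv ?_
    rw [Matrix.diagonal_mul_diagonal, ← Matrix.diagonal_one]
    congr 1
    funext a
    exact mul_inv_cancel₀ (columnScale_ne_zero hh.ne' a)
  rw [localEstimator, Matrix.mul_assoc, ← Matrix.mulVec_mulVec,
    designMatrix_weight_mulVec_eq hB hh hn, normalMatrix_eq hB hh hn, Matrix.mul_inv_rev,
    Matrix.mul_inv_rev, Matrix.mulVec_mulVec, Matrix.mul_assoc, Matrix.mul_assoc,
    Matrix.nonsing_inv_mul _ hD, Matrix.mul_one, hS, ← Matrix.mulVec_mulVec,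
    Matrix.mulVec_diagonal]
  simp [columnScale]

theorem isUnit_det_normalMatrix (hB : IsProjectionMatrix x B) (hh : 0 < h) (hn : n ≠ 0)
    (hc : kernelMassAt q L h ≠ 0) (X : Fin n → Sph q)
    (hdet : (scaledNormal p L h B x X).det ≠ 0) : IsUnit (normalMatrix p L h B x X).det := by
  have hn' : (n : ℝ) ≠ 0 := by exact_mod_cast hn
  rw [normalMatrix_eq hB hh hn, Matrix.det_mul, Matrix.det_mul, Matrix.det_diagonal,
    Matrix.det_diagonal, isUnit_iff_ne_zero]
  refine mul_ne_zero (mul_ne_zero ?_ hdet) ?_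
  · exact Finset.prod_ne_zero_iff.mpr fun a _ =>
      mul_ne_zero (div_ne_zero hn' hc) (columnScale_ne_zero hh.ne' a)
  · exact Finset.prod_ne_zero_iff.mpr fun a _ => columnScale_ne_zero hh.ne' a

/-- Needed for the degenerate samples in which ∑ L*_h |Y_i| = 0, where the individual representation
must still hold exactly. -/
theorem localWeight_mul_eq_zero {X : Fin n → Sph q} {Y : Fin n → ℝ} {i : Fin n}
    (hi : L ((1 - inner ℝ (x : Amb q) (X i : Amb q)) / h ^ 2) * Y i = 0) :
    localWeight p L h B x X i * Y i = 0 := by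
  rw [localWeight, weightMatrix, Matrix.mul_diagonal, dirKernel]
  rw [show ∀ a b c d : ℝ, a * (b * c) * d = a * b * (c * d) by intros; ring, hi, mul_zero]

theorem measurable_localEstimator {Ω : Type*} [MeasurableSpace Ω] (hL : IsDirectionalKernel L)
    {X : Fin n → Ω → Sph q} {Y : Fin n → Ω → ℝ} (hX : ∀ i, Measurable (X i))
    (hY : ∀ i, Measurable (Y i)) :
    Measurable fun ω => localEstimator p L h B x (fun i => X i ω) (fun i => Y i ω) := by
  have hD : ∀ i a, Measurable fun ω => designMatrix p B x (fun i => X i ω) i a := by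
    intro i a
    rcases a with a | ⟨k, j⟩
    · exact measurable_const
    · have h1 : Continuous fun y : Sph q =>
          (Bᵀ *ᵥ WithLp.ofLp ((y : Amb q) - (x : Amb q))) j :=
        (continuous_apply j).comp (Continuous.matrix_mulVec continuous_const
          ((PiLp.continuous_ofLp 2 _).comp (continuous_subtype_val.sub continuous_const)))
      exact h1.measurable.comp (hX i)
  have hW : ∀ i, Measurable fun ω => dirKernel L h x (X i ω) := fun i =>
    (((hL.continuous_sphere h x).measurable.comp (hX i)).const_mul _)
  have hN : ∀ a b, Measurable fun ω => normalMatrix p L h B x (fun i => X i ω) a b := by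
    intro a b
    simp only [normalMatrix, weightMatrix, Matrix.mul_apply (M := _ * _), Matrix.mul_diagonal,
      Matrix.transpose_apply]
    exact Finset.measurable_fun_sum _ fun i _ => ((hD i a).mul (hW i)).mul (hD i b)
  simp only [localEstimator_eq_sum, localWeight, weightMatrix, Matrix.mul_diagonal]
  simp only [Matrix.mul_apply, Matrix.transpose_apply]
  exact Finset.measurable_fun_sum _ fun i _ =>
    ((Finset.measurable_fun_sum _ fun a _ => (measurable_matrix_inv hN _ a).mul (hD i a)).mul
      (hW i)).mul (hY i)

theorem sum_equivKernel_mul {f : Sph q → ℝ} (X : Fin n → Sph q) (Z : Fin n → ℝ) :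
    ∑ i, equivKernel L f n h x (X i) * Z i =
      (((n : ℝ) * h ^ q)⁻¹ * ∑ i, localKernel L (fun _ => 1) h x B (X i) * Z i) /
        (kernelMass q L * f x) := by
  simp only [Finset.mul_sum, Finset.sum_div]
  refine Finset.sum_congr rfl fun i _ => ?_
  simp only [equivKernel, localKernel, mul_inv, div_eq_mul_inv]
  ring

end Estimator

/-! ### Uniform limits of the local statistics and the three conclusions -/

section LocalStatistics

variable {q : ℕ} {Ω : Type*} [MeasurableSpace Ω] {μ : Measure Ω} {m σ f : Sph q → ℝ} {L : ℝ → ℝ}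
  {h : ℕ → ℝ} {X : ℕ → Ω → Sph q} {Y ε : ℕ → Ω → ℝ}
  {B : Sph q → Matrix (Fin (q + 1)) (Fin q) ℝ}

/-- A base point together with an array and a vector indexed by the regressors. -/
abbrev LocalStat (q p : ℕ) : Type :=
  Sph q × (Unit ⊕ (Fin p × Fin q) → Unit ⊕ (Fin p × Fin q) → ℝ) × (Unit ⊕ (Fin p × Fin q) → ℝ)

/-- The base point, the rescaled normal matrix and the rescaled moments of the responses. -/
def localStat (p : ℕ) (L : ℝ → ℝ) (h : ℕ → ℝ) (X : ℕ → Ω → Sph q) (Y : ℕ → Ω → ℝ)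
    (B : Sph q → Matrix (Fin (q + 1)) (Fin q) ℝ) (n : ℕ) (x : Sph q) (ω : Ω) : LocalStat q p :=
  (x, scaledNormal p L (h n) (B x) x (fun i : Fin n => X i ω),
    scaledMoment p L (h n) (B x) x (fun i : Fin n => X i ω) fun i => Y i ω)

/-- The limit in probability of `localStat`. -/
def limitStat (p : ℕ) (L : ℝ → ℝ) (m f : Sph q → ℝ) (x : Sph q) : LocalStat q p :=
  (x, fun a b => f x * gram q p L a b, fun a => m x * f x * kernelMoment L (regressor p a))

theorem continuous_limitStat (p : ℕ) (L : ℝ → ℝ) (hm : Continuous m) (hf : Continuous f) :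
    Continuous (limitStat p L m f) := by
  unfold limitStat
  fun_prop

namespace SamplingScheme

/-- There are finitely many entries, the number not depending on n, and the distance is their
maximum, so the laws of large numbers combine by a union bound. -/
theorem negligible_dist_localStat [IsProbabilityMeasure μ]
    (H : SamplingScheme μ m σ f L h X Y ε B) (p : ℕ) {ρ : ℝ} (hρ : 0 < ρ) :
    UniformlyNegligible μ Set.univ fun n x =>
      {ω | ρ ≤ dist (localStat p L h X Y B n x ω) (limitStat p L m f x)} := by
  have h1 : ∀ ab : (Unit ⊕ (Fin p × Fin q)) × (Unit ⊕ (Fin p × Fin q)),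
      UniformlyNegligible μ Set.univ fun n x => {ω | ρ ≤
        |scaledNormal p L (h n) (B x) x (fun i : Fin n => X i ω) ab.1 ab.2 -
          f x * gram q p L ab.1 ab.2|} := by
    intro ab
    have h2 := H.uniformOP_localAverage_one
      ((moderateGrowth_regressor p ab.1).mul (moderateGrowth_regressor p ab.2)) ρ hρ
    simpa only [localAverage, mul_one, scaledNormal, Matrix.of_apply, gram] using h2
  have h2 : ∀ a : Unit ⊕ (Fin p × Fin q),
      UniformlyNegligible μ Set.univ fun n x => {ω | ρ ≤
        |scaledMoment p L (h n) (B x) x (fun i : Fin n => X i ω) (fun i => Y i ω) a -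
          m x * f x * kernelMoment L (regressor p a)|} := fun a =>
    H.uniformOP_localAverage_id (moderateGrowth_regressor p a) ρ hρ
  refine ((UniformlyNegligible.iUnion h1).union (UniformlyNegligible.iUnion h2)).mono
    (Eventually.of_forall fun n x _ ω hω => ?_)
  by_contra hcon
  simp only [Set.mem_union, Set.mem_iUnion, Set.mem_ofPred_eq, not_or, not_exists, not_le] at hcon
  refine absurd (show ρ ≤ _ from hω) (not_le.mpr ?_)
  rw [localStat, limitStat, Prod.dist_eq, Prod.dist_eq, dist_self]
  refine max_lt hρ (max_lt ?_ ?_)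
  · refine (dist_pi_lt_iff hρ).mpr fun a => (dist_pi_lt_iff hρ).mpr fun b => ?_
    rw [Real.dist_eq]
    exact hcon.1 (a, b)
  · refine (dist_pi_lt_iff hρ).mpr fun a => ?_
    rw [Real.dist_eq]
    exact hcon.2 a

/-- Continuous mapping, uniformly over compact sets of base points. -/
theorem uniformOP_comp_localStat [IsProbabilityMeasure μ]
    (H : SamplingScheme μ m σ f L h X Y ε B) {p : ℕ} {C : Set (Sph q)} (hC : IsCompact C)
    {Φ : LocalStat q p → ℝ} (hΦ : ∀ x ∈ C, ContinuousAt Φ (limitStat p L m f x)) {c : ℝ}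
    (hc : ∀ x ∈ C, Φ (limitStat p L m f x) = c) :
    UniformOP μ C fun n x ω => Φ (localStat p L h X Y B n x ω) - c := by
  intro δ hδ
  have hK : IsCompact (limitStat p L m f '' C) :=
    hC.image (continuous_limitStat p L H.continuous_m H.continuous_f)
  -- Continuity at the points of a compact set yields one radius ρ that serves all limit points
  -- simultaneously, compared with arbitrary points nearby.
  have h1 := hK.uniformContinuousAt_of_continuousAt Φ
    (by rintro _ ⟨x, hx, rfl⟩; exact hΦ x hx) (Metric.dist_mem_uniformity hδ)
  obtain ⟨ρ, hρ, h2⟩ := Metric.mem_uniformity_dist.mp h1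
  refine ((H.negligible_dist_localStat p hρ).subset (Set.subset_univ C)).mono
    (Eventually.of_forall fun n x hx ω hω => ?_)
  by_contra hcon
  have h3 : dist (limitStat p L m f x) (localStat p L h X Y B n x ω) < ρ := by
    rw [dist_comm]; exact not_le.mp hcon
  have h4 : dist (Φ (limitStat p L m f x)) (Φ (localStat p L h X Y B n x ω)) < δ :=
    h2 h3 (Set.mem_image_of_mem _ hx)
  rw [hc x hx, dist_comm, Real.dist_eq] at h4
  exact absurd (show δ ≤ _ from hω) (not_le.mpr h4)

theorem f_pos (H : SamplingScheme μ m σ f L h X Y ε B) (x : Sph q) : 0 < f x := by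
  obtain ⟨c, hc, h⟩ := H.f_lower
  exact hc.trans_le (h x)

theorem kernelMass_pos (H : SamplingScheme μ m σ f L h X Y ε B) : 0 < kernelMass q L :=
  DirReg.kernelMass_pos H.one_le H.kernel

theorem det_limit_ne_zero (H : SamplingScheme μ m σ f L h X Y ε B) {p : ℕ} (hp : p = 0 ∨ p = 1)
    (x : Sph q) : (Matrix.of (limitStat p L m f x).2.1).det ≠ 0 := by
  have h1 : Matrix.of (limitStat p L m f x).2.1 = f x • Matrix.of (gram q p L) := by
    ext a b; simp [limitStat]
  rw [h1, Matrix.det_smul]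
  exact mul_ne_zero (pow_ne_zero _ (H.f_pos x).ne') (det_gram_ne_zero H.one_le H.kernel hp)

/-- The limit in probability of the estimator is the regression function. -/
theorem inv_mulVec_limit (H : SamplingScheme μ m σ f L h X Y ε B) {p : ℕ} (hp : p = 0 ∨ p = 1)
    (x : Sph q) :
    ((Matrix.of (limitStat p L m f x).2.1)⁻¹ *ᵥ (limitStat p L m f x).2.2) (Sum.inl ()) = m x := by
  -- The limiting moment vector is m(x) times the intercept column of the limiting matrix.
  have h1 : (limitStat p L m f x).2.2 =
      Matrix.of (limitStat p L m f x).2.1 *ᵥ Pi.single (Sum.inl ()) (m x) := by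
    funext a
    have h2 : kernelMoment L (regressor p a) = gram q p L a (Sum.inl ()) :=
      congrArg (kernelMoment L) (funext fun u => (mul_one _).symm)
    rw [Matrix.mulVec_single]
    simp only [limitStat, h2, MulOpposite.smul_eq_mul_unop,
      Pi.smul_apply, Matrix.col_apply, Matrix.of_apply, MulOpposite.unop_op]
    ring
  rw [h1, Matrix.mulVec_mulVec, Matrix.nonsing_inv_mul _
    (isUnit_iff_ne_zero.mpr (H.det_limit_ne_zero hp x)), Matrix.one_mulVec, Pi.single_eq_same]

theorem limit_moment_inl (H : SamplingScheme μ m σ f L h X Y ε B) (p : ℕ) (x : Sph q) :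
    (limitStat p L m f x).2.2 (Sum.inl ()) = m x * f x * kernelMass q L := by
  rw [← kernelMoment_one H.one_le]
  rfl

theorem continuousAt_estimator (H : SamplingScheme μ m σ f L h X Y ε B) {p : ℕ}
    (hp : p = 0 ∨ p = 1) (x : Sph q) :
    ContinuousAt (fun V : LocalStat q p => ((Matrix.of V.2.1)⁻¹ *ᵥ V.2.2) (Sum.inl ()))
      (limitStat p L m f x) :=
  continuousAt_inv_mulVec (N := fun V : LocalStat q p => Matrix.of V.2.1)
    (T := fun V : LocalStat q p => V.2.2) (continuous_fst.comp continuous_snd)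
    (continuous_snd.comp continuous_snd) (H.det_limit_ne_zero hp x) _

theorem continuous_equivMean (H : SamplingScheme μ m σ f L h X Y ε B) (p : ℕ) :
    Continuous fun V : LocalStat q p => V.2.2 (Sum.inl ()) / (kernelMass q L * f V.1) := by
  refine Continuous.div (by fun_prop) (continuous_const.mul (H.continuous_f.comp continuous_fst))
    fun V => (mul_pos H.kernelMass_pos (H.f_pos _)).ne'

theorem equivMean_limit (H : SamplingScheme μ m σ f L h X Y ε B) (p : ℕ) (x : Sph q) :
    (limitStat p L m f x).2.2 (Sum.inl ()) / (kernelMass q L * f (limitStat p L m f x).1) =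
      m x := by
  rw [H.limit_moment_inl]
  have h1 := H.f_pos x
  have h2 := H.kernelMass_pos
  show m x * f x * kernelMass q L / (kernelMass q L * f x) = m x
  field_simp

theorem localStat_equivMean (p n : ℕ) (x : Sph q) (ω : Ω) :
    ∑ i : Fin n, equivKernel L f n (h n) x (X i ω) * Y i ω =
      (localStat p L h X Y B n x ω).2.2 (Sum.inl ()) / (kernelMass q L * f x) :=
  sum_equivKernel_mul (B := B x) (fun i : Fin n => X i ω) fun i => Y i ω

theorem localStat_equivMean_abs (n : ℕ) (x : Sph q) (ω : Ω) :
    ∑ i : Fin n, equivKernel L f n (h n) x (X i ω) * |Y i ω| =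
      localAverage L (fun _ => 1) (fun t => |t|) h X Y B n x ω / (kernelMass q L * f x) :=
  sum_equivKernel_mul (B := B x) (fun i : Fin n => X i ω) fun i => |Y i ω|

theorem eventually_localEstimator_eq (H : SamplingScheme μ m σ f L h X Y ε B) (p : ℕ) :
    ∀ᶠ n in atTop, ∀ x ω,
      localEstimator p L (h n) (B x) x (fun i : Fin n => X i ω) (fun i => Y i ω) =
        ((Matrix.of (localStat p L h X Y B n x ω).2.1)⁻¹ *ᵥ
          (localStat p L h X Y B n x ω).2.2) (Sum.inl ()) := by
  filter_upwards [eventually_kernelMassAt_pos H.one_le H.kernel H.bandwidth.pos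
    H.bandwidth.tendsto_zero, eventually_ne_atTop 0] with n hn hn0 x ω
  exact localEstimator_eq (H.frame x) (H.bandwidth.pos n) hn0 hn.ne' _ _

variable [IsProbabilityMeasure μ]

theorem negligible_singular (H : SamplingScheme μ m σ f L h X Y ε B) {p : ℕ}
    (hp : p = 0 ∨ p = 1) :
    UniformlyNegligible μ Set.univ fun (n : ℕ) (x : Sph q) => {ω | ¬ IsUnit
      (normalMatrix p L (h n) (B x) x (fun i : Fin n => X i ω)).det} := by
  -- The function det⁻¹ · det equals 1 at invertible matrices and 0 at singular ones, so singularity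
  -- forces a deviation of size 1 from its limit.
  have h1 := H.uniformOP_comp_localStat (p := p) isCompact_univ
    (Φ := fun V => (Matrix.of V.2.1).det⁻¹ * (Matrix.of V.2.1).det) (c := 1) (fun x _ => ?_)
    (fun x _ => inv_mul_cancel₀ (H.det_limit_ne_zero hp x))
  · refine (h1 1 one_pos).mono ?_
    filter_upwards [eventually_kernelMassAt_pos H.one_le H.kernel H.bandwidth.pos
      H.bandwidth.tendsto_zero, eventually_ne_atTop 0] with n hn hn0 x _ ω hω
    have hdet : (scaledNormal p L (h n) (B x) x (fun i : Fin n => X i ω)).det = 0 := by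
      by_contra hdet
      exact hω (isUnit_det_normalMatrix (H.frame x) (H.bandwidth.pos n) hn0 hn.ne' _ hdet)
    have h2 : (Matrix.of (localStat p L h X Y B n x ω).2.1).det = 0 := hdet
    simp [h2]
  · have hc : Continuous fun V : LocalStat q p => (Matrix.of V.2.1).det :=
      Continuous.matrix_det (continuous_fst.comp continuous_snd)
    exact (hc.continuousAt.inv₀ (H.det_limit_ne_zero hp x)).mul hc.continuousAt

/-- The estimator and its equivalent form have the same limit in probability. -/
theorem uniformOP_estimator_sub (H : SamplingScheme μ m σ f L h X Y ε B) {p : ℕ}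
    (hp : p = 0 ∨ p = 1) :
    UniformOP μ Set.univ fun n x ω =>
      localEstimator p L (h n) (B x) x (fun i : Fin n => X i ω) (fun i => Y i ω) -
        ∑ i : Fin n, equivKernel L f n (h n) x (X i ω) * Y i ω := by
  have h1 := H.uniformOP_comp_localStat (p := p) isCompact_univ
    (Φ := fun V => ((Matrix.of V.2.1)⁻¹ *ᵥ V.2.2) (Sum.inl ()) -
      V.2.2 (Sum.inl ()) / (kernelMass q L * f V.1)) (c := 0)
    (fun x _ => (H.continuousAt_estimator hp x).sub (H.continuous_equivMean p).continuousAt)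
    (fun x _ => by rw [H.inv_mulVec_limit hp, H.equivMean_limit, sub_self])
  intro δ hδ
  refine (h1 δ hδ).mono ?_
  filter_upwards [H.eventually_localEstimator_eq p] with n hn x _ ω hω
  rw [Set.mem_ofPred_eq, hn, localStat_equivMean (B := B) p] at hω
  rw [Set.mem_ofPred_eq, sub_zero]
  exact hω

/-- Giving each term a correction with the sign of its response makes the corrections add up to t ∑
L*_h |Y_i|, without cancellation. Hence t is the difference of the two estimators over a quantity
bounded below in probability, and it is small even where m vanishes. -/
theorem exists_individual_factors (H : SamplingScheme μ m σ f L h X Y ε B) {p : ℕ}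
    (hp : p = 0 ∨ p = 1) :
    ∃ r : (n : ℕ) → Sph q → Fin n → Ω → ℝ, (∀ n x i, Measurable (r n x i)) ∧
      (∀ n x ω, localEstimator p L (h n) (B x) x (fun i : Fin n => X i ω) (fun i => Y i ω) =
        ∑ i : Fin n, equivKernel L f n (h n) x (X i ω) * Y i ω * (1 + r n x i ω)) ∧
      UniformOP μ Set.univ fun n x ω => ⨆ i : Fin n, |r n x i ω| := by
  set t : ℕ → Sph q → Ω → ℝ := fun n x ω =>
    (localEstimator p L (h n) (B x) x (fun i : Fin n => X i ω) (fun i => Y i ω) -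
      ∑ i : Fin n, equivKernel L f n (h n) x (X i ω) * Y i ω) /
    ∑ i : Fin n, equivKernel L f n (h n) x (X i ω) * |Y i ω| with ht
  have hX : ∀ i, Measurable (X i) := fun i => (H.model i).measurable_X
  have hY : ∀ i, Measurable (Y i) := fun i => (H.model i).measurable_Y
  have hker : ∀ n x, Measurable fun y => equivKernel L f n (h n) x y := fun n x =>
    (H.kernel.continuous_sphere (h n) x).measurable.const_mul _
  have htm : ∀ n x, Measurable (t n x) := by
    intro n x
    have h1 : Measurable fun ω => ∑ i : Fin n, equivKernel L f n (h n) x (X i ω) * Y i ω :=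
      Finset.measurable_fun_sum _ fun i _ => ((hker n x).comp (hX i)).mul (hY i)
    have h2 : Measurable fun ω => ∑ i : Fin n, equivKernel L f n (h n) x (X i ω) * |Y i ω| :=
      Finset.measurable_fun_sum _ fun i _ => ((hker n x).comp (hX i)).mul
        (continuous_abs.measurable.comp (hY i))
    exact ((measurable_localEstimator H.kernel (fun i : Fin n => hX i) fun i => hY i).sub h1).div
      h2
  -- The quotient Y/|Y| is the sign of Y, with value 0 at Y = 0.
  refine ⟨fun n x i ω => t n x ω * (Y i ω / |Y i ω|), fun n x i => ?_, fun n x ω => ?_, ?_⟩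
  · exact (htm n x).mul ((hY i).div (continuous_abs.measurable.comp (hY i)))
  · have hsplit : ∀ i : Fin n, equivKernel L f n (h n) x (X i ω) * Y i ω *
        (1 + t n x ω * (Y i ω / |Y i ω|)) = equivKernel L f n (h n) x (X i ω) * Y i ω +
          t n x ω * (equivKernel L f n (h n) x (X i ω) * |Y i ω|) := by
      intro i
      have h1 : Y i ω * (Y i ω / |Y i ω|) = |Y i ω| := by
        rw [← mul_div_assoc, ← abs_mul_abs_self (Y i ω), mul_self_div_self]
      linear_combination equivKernel L f n (h n) x (X i ω) * t n x ω * h1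
    rw [Finset.sum_congr rfl fun i _ => hsplit i, Finset.sum_add_distrib, ← Finset.mul_sum]
    -- If the denominator vanishes, every product of kernel and response is zero, and then so are
    -- both sides.
    by_cases hA : ∑ i : Fin n, equivKernel L f n (h n) x (X i ω) * |Y i ω| = 0
    · have hnn : ∀ i : Fin n, 0 ≤ equivKernel L f n (h n) x (X i ω) * |Y i ω| := by
        intro i
        have h1 := H.kernel.nonneg _
          (div_nonneg (one_sub_inner_nonneg x (X i ω)) (sq_nonneg (h n)))
        have h2 := H.kernelMass_pos
        have h3 := H.f_pos x
        have h4 := H.bandwidth.pos n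
        unfold equivKernel
        positivity
      have hz := (Finset.sum_eq_zero_iff_of_nonneg fun i _ => hnn i).mp hA
      have hz' : ∀ i : Fin n, L ((1 - inner ℝ (x : Amb q) (X i ω : Amb q)) / h n ^ 2) *
          Y i ω = 0 := by
        intro i
        have h2 := H.kernelMass_pos
        have h3 := H.f_pos x
        have h4 := H.bandwidth.pos n
        have h5 : (0 : ℝ) < n := by exact_mod_cast i.pos
        have h6 : 1 / ((n : ℝ) * h n ^ q * kernelMass q L * f x) ≠ 0 := by positivity
        have h7 := hz i (Finset.mem_univ i)
        rw [equivKernel, mul_assoc] at h7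
        rcases mul_eq_zero.mp ((mul_eq_zero.mp h7).resolve_left h6) with h8 | h8
        · rw [h8, zero_mul]
        · rw [abs_eq_zero.mp h8, mul_zero]
      rw [hA, mul_zero, add_zero, localEstimator_eq_sum]
      refine Finset.sum_congr rfl fun i _ => ?_
      rw [localWeight_mul_eq_zero (X := fun i : Fin n => X i ω) (Y := fun i => Y i ω) (hz' i),
        equivKernel, mul_assoc, hz', mul_zero]
    · rw [ht]
      simp only
      rw [div_mul_cancel₀ _ hA]
      ring
  · obtain ⟨c, hc, hlow⟩ := H.exists_localAverage_abs_lower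
    obtain ⟨D, hD, hfD⟩ := exists_abs_le_of_continuous H.continuous_f
    have hlam := H.kernelMass_pos
    intro δ hδ
    -- δ times a lower bound for ∑ L*_h |Y_i| off the exceptional event; f ≤ D, and D + 1 keeps the
    -- denominator positive.
    set η : ℝ := δ * (c / (kernelMass q L * (D + 1))) with hη
    have hηpos : 0 < η := by positivity
    refine (hlow.union (H.uniformOP_estimator_sub hp η hηpos)).mono
      (Eventually.of_forall fun n x _ ω hω => ?_)
    by_contra hcon
    simp only [Set.mem_union, Set.mem_ofPred_eq, not_or, not_lt, not_le] at hcon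
    obtain ⟨hA, hdiff⟩ := hcon
    have hfx := H.f_pos x
    have hS : c / (kernelMass q L * (D + 1)) ≤
        ∑ i : Fin n, equivKernel L f n (h n) x (X i ω) * |Y i ω| := by
      rw [localStat_equivMean_abs (B := B)]
      have h1 := (le_abs_self _).trans (hfD x)
      exact div_le_div₀ (hc.le.trans hA) hA (by positivity)
        (mul_le_mul_of_nonneg_left (by linarith) hlam.le)
    have hSpos : 0 < c / (kernelMass q L * (D + 1)) := by positivity
    have htlt : |t n x ω| < δ := by
      rw [ht]
      simp only
      rw [abs_div, abs_of_pos (hSpos.trans_le hS), div_lt_iff₀ (hSpos.trans_le hS)]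
      exact hdiff.trans_le (mul_le_mul_of_nonneg_left hS hδ.le)
    have hsup : (⨆ i : Fin n, |t n x ω * (Y i ω / |Y i ω|)|) ≤ |t n x ω| := by
      refine Real.iSup_le (fun i => ?_) (abs_nonneg _)
      rw [abs_mul, abs_div (Y i ω), abs_abs]
      exact mul_le_of_le_one_right (abs_nonneg _) (div_self_le_one _)
    have hsup0 : 0 ≤ ⨆ i : Fin n, |t n x ω * (Y i ω / |Y i ω|)| :=
      Real.iSup_nonneg fun i => abs_nonneg _
    have hω' : δ ≤ |(⨆ i : Fin n, |t n x ω * (Y i ω / |Y i ω|)|)| := hω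
    rw [abs_of_nonneg hsup0] at hω'
    exact absurd hω' (not_le.mpr (hsup.trans_lt htlt))

/-- A common factor away from the zeros of the regression function. -/
theorem exists_common_factor (H : SamplingScheme μ m σ f L h X Y ε B) {p : ℕ}
    (hp : p = 0 ∨ p = 1) {S : Set (Sph q)} {c : ℝ} (hc : 0 < c) (hS : ∀ x ∈ S, c ≤ |m x|) :
    ∃ R : ℕ → Sph q → Ω → ℝ, (∀ n x, Measurable (R n x)) ∧
      UniformlyNegligible μ S (fun n x =>
        {ω | ¬ (localEstimator p L (h n) (B x) x (fun i : Fin n => X i ω) (fun i => Y i ω) =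
          (∑ i : Fin n, equivKernel L f n (h n) x (X i ω) * Y i ω) * (1 + R n x ω))}) ∧
      UniformOP μ S R := by
  have hX : ∀ i, Measurable (X i) := fun i => (H.model i).measurable_X
  have hY : ∀ i, Measurable (Y i) := fun i => (H.model i).measurable_Y
  have hker : ∀ n x, Measurable fun y => equivKernel L f n (h n) x y := fun n x =>
    (H.kernel.continuous_sphere (h n) x).measurable.const_mul _
  -- S itself is arbitrary; it lies in this closed, hence compact, set on which m still has no zero.
  have hC : IsCompact {x | c ≤ |m x|} :=
    (isClosed_le continuous_const (continuous_abs.comp H.continuous_m)).isCompact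
  have hm0 : ∀ x ∈ {x | c ≤ |m x|}, m x ≠ 0 := fun x hx => abs_pos.mp (hc.trans_le hx)
  have h1 := H.uniformOP_comp_localStat (p := p) hC
    (Φ := fun V => ((Matrix.of V.2.1)⁻¹ *ᵥ V.2.2) (Sum.inl ()) /
      (V.2.2 (Sum.inl ()) / (kernelMass q L * f V.1))) (c := 1)
    (fun x hx => (H.continuousAt_estimator hp x).div (H.continuous_equivMean p).continuousAt
      (by rw [H.equivMean_limit]; exact hm0 x hx))
    (fun x hx => by rw [H.inv_mulVec_limit hp, H.equivMean_limit, div_self (hm0 x hx)])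
  have hR : UniformOP μ S fun n x ω =>
      localEstimator p L (h n) (B x) x (fun i : Fin n => X i ω) (fun i => Y i ω) /
        (∑ i : Fin n, equivKernel L f n (h n) x (X i ω) * Y i ω) - 1 := by
    intro δ hδ
    refine ((h1 δ hδ).subset hS).mono ?_
    filter_upwards [H.eventually_localEstimator_eq p] with n hn x _ ω hω
    rw [Set.mem_ofPred_eq, hn, localStat_equivMean (B := B) p] at hω
    exact hω
  refine ⟨_, fun n x => ?_, (hR 1 one_pos).mono (Eventually.of_forall fun n x _ ω hω => ?_), hR⟩
  · have hsum : Measurable fun ω => ∑ i : Fin n, equivKernel L f n (h n) x (X i ω) * Y i ω :=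
      Finset.measurable_fun_sum _ fun i _ => ((hker n x).comp (hX i)).mul (hY i)
    exact ((measurable_localEstimator H.kernel (fun i : Fin n => hX i) fun i => hY i).div
      hsum).sub_const 1
  -- With R the ratio minus 1, the identity can fail only if the denominator is zero; then the ratio
  -- is 0 and R = -1, so failure lies in the negligible event |R| ≥ 1.
  · have h2 : ∑ i : Fin n, equivKernel L f n (h n) x (X i ω) * Y i ω = 0 := by
      by_contra h0
      exact hω (by rw [add_sub_cancel, mul_div_cancel₀ _ h0])
    simp [h2]

/-- A common factor for the local constant fit. -/
theorem exists_common_factor_of_degree_zero (H : SamplingScheme μ m σ f L h X Y ε B)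
    (S : Set (Sph q)) :
    ∃ R : ℕ → Sph q → Ω → ℝ, (∀ n x, Measurable (R n x)) ∧
      UniformlyNegligible μ S (fun n x =>
        {ω | ¬ (localEstimator 0 L (h n) (B x) x (fun i : Fin n => X i ω) (fun i => Y i ω) =
          (∑ i : Fin n, equivKernel L f n (h n) x (X i ω) * Y i ω) * (1 + R n x ω))}) ∧
      UniformOP μ S R := by
  have hX : ∀ i, Measurable (X i) := fun i => (H.model i).measurable_X
  have hfl : ∀ x, kernelMass q L * f x ≠ 0 := fun x =>
    (mul_pos H.kernelMass_pos (H.f_pos x)).ne'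
  have hlim : ∀ x, (limitStat 0 L m f x).2.1 (Sum.inl ()) (Sum.inl ()) = kernelMass q L * f x := by
    intro x
    simp only [limitStat, gram_inl_inl H.one_le]
    ring
  have hnum : Continuous fun V : LocalStat q 0 => kernelMass q L * f V.1 :=
    continuous_const.mul (H.continuous_f.comp continuous_fst)
  have hden : Continuous fun V : LocalStat q 0 => V.2.1 (Sum.inl ()) (Sum.inl ()) := by fun_prop
  have h1 := H.uniformOP_comp_localStat (p := 0) isCompact_univ
    (Φ := fun V => kernelMass q L * f V.1 / V.2.1 (Sum.inl ()) (Sum.inl ())) (c := 1)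
    (fun x _ => hnum.continuousAt.div hden.continuousAt (by rw [hlim]; exact hfl x))
    (fun x _ => by rw [hlim]; exact div_self (hfl x))
  have hN : ∀ n x, Measurable fun ω =>
      (localStat 0 L h X Y B n x ω).2.1 (Sum.inl ()) (Sum.inl ()) := by
    intro n x
    refine (Finset.measurable_fun_sum _ fun i _ => ?_).const_mul _
    exact (continuous_localKernel H.kernel ((moderateGrowth_regressor 0 _).mul
      (moderateGrowth_regressor 0 _)) _ _ _).measurable.comp (hX i)
  -- For p = 0 the estimator is T₁/N₁₁ and the equivalent sum is T₁/(λ_q(L) f(x)), so this factor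
  -- does not involve the responses.
  refine ⟨fun n x ω => kernelMass q L * f x /
    (localStat 0 L h X Y B n x ω).2.1 (Sum.inl ()) (Sum.inl ()) - 1, fun n x => ?_, ?_,
    fun δ hδ => (h1 δ hδ).subset (Set.subset_univ S)⟩
  · exact ((hN n x).const_div _).sub_const 1
  -- For all large n the identity holds at every sample point, including N₁₁ = 0, where both sides
  -- are 0.
  · refine UniformlyNegligible.of_le (b := fun _ => 0) tendsto_const_nhds ?_
    filter_upwards [H.eventually_localEstimator_eq 0] with n hn x _
    refine le_of_eq (measure_mono_null (fun ω hω => hω ?_) measure_empty)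
    rw [hn, localStat_equivMean (B := B) 0, add_sub_cancel]
    have hsub : Subsingleton (Unit ⊕ (Fin 0 × Fin q)) := ⟨by
      rintro (⟨⟩ | ⟨k, -⟩) (⟨⟩ | ⟨l, -⟩)
      · rfl
      · exact l.elim0
      · exact k.elim0
      · exact k.elim0⟩
    have h2 : ∀ (N : Matrix (Unit ⊕ (Fin 0 × Fin q)) (Unit ⊕ (Fin 0 × Fin q)) ℝ)
        (T : Unit ⊕ (Fin 0 × Fin q) → ℝ),
        (N⁻¹ *ᵥ T) (Sum.inl ()) = T (Sum.inl ()) / N (Sum.inl ()) (Sum.inl ()) := by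
      intro N T
      simp [Matrix.mulVec, dotProduct, Fintype.sum_sum_type, div_eq_inv_mul]
    rw [h2, Matrix.of_apply]
    exact (div_mul_div_cancel₀ (hfl x)).symm

end SamplingScheme

end LocalStatistics

end DirReg

end

theorem corollary1 {q : ℕ} (hq : 1 ≤ q)
    {Ω : Type*} [MeasurableSpace Ω] (μ : Measure Ω) [IsProbabilityMeasure μ]
    (m σ f : DirReg.Sph q → ℝ) (L : ℝ → ℝ) (h : ℕ → ℝ)
    (X : ℕ → Ω → DirReg.Sph q) (Y ε : ℕ → Ω → ℝ)
    (B : DirReg.Sph q → Matrix (Fin (q + 1)) (Fin q) ℝ)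
    (hB : ∀ x, DirReg.IsProjectionMatrix x (B x))
    (hmodel : ∀ i, DirReg.RegressionModel μ m σ f (X i) (Y i) (ε i))
    (hindep : iIndepFun (fun i ω => (X i ω, Y i ω)) μ)
    (hident : ∀ i, IdentDistrib (fun ω => (X i ω, Y i ω)) (fun ω => (X 0 ω, Y 0 ω)) μ μ)
    (hsmooth : DirReg.SmoothDesign m f)
    (hnoise : DirReg.RegularNoise σ)
    (hL : DirReg.IsDirectionalKernel L)
    (hh : DirReg.IsBandwidth q h)
    (p : ℕ) (hp : p = 0 ∨ p = 1) :
    -- the estimator is well defined with probability tending to one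
    DirReg.UniformlyNegligible μ Set.univ (fun (n : ℕ) (x : DirReg.Sph q) =>
      {ω | ¬ IsUnit
        (DirReg.normalMatrix p L (h n) (B x) x (fun i : Fin n => X i ω)).det}) ∧
    -- the estimator is the sum of the terms `L*_h(x, X_i) Y_i (1 + o_P(1))`
    (∃ r : (n : ℕ) → DirReg.Sph q → Fin n → Ω → ℝ,
      (∀ n x i, Measurable (r n x i)) ∧
      (∀ n x ω,
        DirReg.localEstimator p L (h n) (B x) x (fun i : Fin n => X i ω) (fun i => Y i ω) =
          ∑ i : Fin n, DirReg.equivKernel L f n (h n) x (X i ω) * Y i ω * (1 + r n x i ω)) ∧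
      DirReg.UniformOP μ Set.univ (fun n x ω => ⨆ i : Fin n, |r n x i ω|)) ∧
    -- one common factor `1 + o_P(1)`: everywhere for `p = 0`, and away from the zeros of `m`
    -- for `p = 1`
    (∀ S : Set (DirReg.Sph q), (p = 0 ∨ ∃ c : ℝ, 0 < c ∧ ∀ x ∈ S, c ≤ |m x|) →
      ∃ R : ℕ → DirReg.Sph q → Ω → ℝ,
        (∀ n x, Measurable (R n x)) ∧
        DirReg.UniformlyNegligible μ S (fun n x =>
          {ω | ¬ (DirReg.localEstimator p L (h n) (B x) x
              (fun i : Fin n => X i ω) (fun i => Y i ω) =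
            (∑ i : Fin n, DirReg.equivKernel L f n (h n) x (X i ω) * Y i ω) * (1 + R n x ω))}) ∧
        DirReg.UniformOP μ S R) := by
  have H : DirReg.SamplingScheme μ m σ f L h X Y ε B :=
    { one_le := hq
      frame := hB
      model := hmodel
      indep := hindep
      ident := hident
      continuous_m := DirReg.continuous_of_radialExt hsmooth.contDiff_m
      continuous_σ := hnoise.continuous
      continuous_f := DirReg.continuous_of_radialExt hsmooth.contDiff_f
      f_lower := hsmooth.f_lower
      σ_lower := hnoise.sq_lower
      kernel := hL
      bandwidth := hh }
  refine ⟨H.negligible_singular hp, H.exists_individual_factors hp, fun S hS => ?_⟩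
  rcases hS with rfl | ⟨c, hc, hS⟩
  · exact H.exists_common_factor_of_degree_zero S
  · exact H.exists_common_factor hp hc hS
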